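/- Let $G=(V,E)$ be a finite connected undirected simple graph with at least one edge, in which every edge has a positive real length. A point of $G$ is a triple $(u,v,t)$: the point of the edge $uv$ at distance $t$ from $u$ along this edge, with $0\le t\le$ the length of $uv$. The distance $d(p,q)$ of two points is the length of a shortest route between them along $G$. An uncertain point $P_i$ has a weight $w_i\ge 0$ and $m$ possible locations $p_{i1},\dots,p_{im}$, which are points of $G$, with probabilities $f_{ij}\ge 0$, $\sum_{j=1}^m f_{ij}=1$; its expected distance to a point $x$ is $\mathsf{Ed}(P_i,x)=\sum_{j=1}^m f_{ij}\,d(p_{ij},x)$. Given $n\ge 1$ uncertain points $P_1,\dots,P_n$ with $m\ge1$ locations each, the one-center problem asks for a point $x$ of $G$ that minimizes $\phi(x)=\max_{1\le i\le n} w_i\,\mathsf{Ed}(P_i,x)$ over all points of $G$. Theorem. There are one algorithm (a real RAM program: exact arithmetic operations and comparisons of reals, additions, subtractions and comparisons of nonnegative integers, and indexed memory accesses take unit time each) and a constant $C$ such that, for all such $G$, $n$, $m$ and $P_1,\dots,P_n$, if the memory initially holds the numbers $|V|,|E|,n,m$, the list of the edges of $G$ with their lengths, the matrix of the distances of all pairs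 of vertices of $G$, and the weights, locations $(u,v,t)$ and probabilities of the uncertain points, then the algorithm halts after at most $C\,|E|\,mn\log(mn+1)$ time units and outputs a point $x^*=(u,v,t)$ that minimizes $\phi$, together with the value $\phi(x^*)$. That is, provided with the distance matrix, the one-center problem is solved in $O(|E|\,mn\log mn)$ time. -/

import Mathlib

/-! ## Networks, points on edges, distances -/

/-- A network: an undirected simple graph whose edges carry positive lengths. -/
structure Network (V : Type*) where
  graph : SimpleGraph V
  len : Sym2 V → ℝ
  len_pos : ∀ e ∈ graph.edgeSet, 0 < len e

namespace Network

/-- A point `(u, v, t)` of the network: the point of the edge `uv` at distance `t` from `u`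
along this edge. A vertex is the point with `t = 0` of any edge that starts there. -/
structure Point {V : Type*} (Γ : Network V) where
  fst : V
  snd : V
  adj : Γ.graph.Adj fst snd
  pos : ℝ
  pos_nonneg : 0 ≤ pos
  pos_le : pos ≤ Γ.len s(fst, snd)

variable {V : Type*} {Γ : Network V}

/-- The length of a walk: the sum of the lengths of its edges. -/
def walkLength (Γ : Network V) {u v : V} (W : Γ.graph.Walk u v) : ℝ :=
  (W.edges.map Γ.len).sum

/-- The distance of two vertices: the length of a shortest walk between them. -/
noncomputable def vertexDist (Γ : Network V) (u v : V) : ℝ :=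
  sInf {l : ℝ | ∃ W : Γ.graph.Walk u v, l = Γ.walkLength W}

/-- `x` is an end of the edge carrying `p`, and the part of this edge from `p` to `x` has
length `a`. -/
def Point.ToEnd (p : Γ.Point) (x : V) (a : ℝ) : Prop :=
  (x = p.fst ∧ a = p.pos) ∨ (x = p.snd ∧ a = Γ.len s(p.fst, p.snd) - p.pos)

/-- `p` and `q` are given on the same edge (in the same or in opposite directions), and the part
of this edge between them has length `l`. -/
def Point.OnSameEdge (p q : Γ.Point) (l : ℝ) : Prop :=
  (p.fst = q.fst ∧ p.snd = q.snd ∧ l = |p.pos - q.pos|) ∨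
  (p.fst = q.snd ∧ p.snd = q.fst ∧ l = |p.pos - (Γ.len s(q.fst, q.snd) - q.pos)|)

/-- The lengths of the routes from `p` to `q`: straight along a common edge, or from `p` to an
end of its edge, along a walk of the graph to an end of the edge of `q`, and from there to `q`. -/
def routeLengths (p q : Γ.Point) : Set ℝ :=
  {l | p.OnSameEdge q l ∨
    ∃ (x y : V) (a b : ℝ) (W : Γ.graph.Walk x y),
      p.ToEnd x a ∧ q.ToEnd y b ∧ l = a + Γ.walkLength W + b}

/-- The distance of two points of the network: the length of a shortest route. -/
noncomputable def pointDist (p q : Γ.Point) : ℝ := sInf (routeLengths p q)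

/-- A weighted uncertain point with `m` possible locations. -/
structure UncertainPoint (Γ : Network V) (m : ℕ) where
  loc : Fin m → Γ.Point
  prob : Fin m → ℝ
  prob_nonneg : ∀ j, 0 ≤ prob j
  prob_sum : ∑ j, prob j = 1
  weight : ℝ
  weight_nonneg : 0 ≤ weight

/-- The expected distance of an uncertain point to a point of the network. -/
noncomputable def UncertainPoint.expDist {m : ℕ} (P : Γ.UncertainPoint m) (x : Γ.Point) : ℝ :=
  ∑ j, P.prob j * pointDist (P.loc j) x

/-- The maximum weighted expected distance to `x` of the uncertain points of a family
(a maximum of finitely many reals; the family is nonempty where this is used). -/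
noncomputable def objective {n m : ℕ} (P : Fin n → Γ.UncertainPoint m) (x : Γ.Point) : ℝ :=
  ⨆ i, (P i).weight * (P i).expDist x

/-- `x` is a center: it minimizes the maximum weighted expected distance over all points. -/
def IsCenter {n m : ℕ} (P : Fin n → Γ.UncertainPoint m) (x : Γ.Point) : Prop :=
  ∀ y : Γ.Point, objective P x ≤ objective P y

/-- `ends` lists every edge of the graph exactly once, each in one of its two directions. -/
def ListsEdges (Γ : Network V) {E : ℕ} (ends : Fin E → V × V) : Prop :=
  Function.Injective (fun k => s((ends k).1, (ends k).2)) ∧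
  Set.range (fun k => s((ends k).1, (ends k).2)) = Γ.graph.edgeSet

end Network

/-! ## The real RAM: random access machine with exact real arithmetic, unit-cost operations -/

namespace RealRAM

/-- The memory: arrays of natural numbers (indices, counters) and arrays of real numbers.
A program names its arrays by literals, so it uses only finitely many; the cells of an array are
accessed through computed indices. A scalar variable is a cell of an array. -/
structure Mem where
  nat : ℕ → ℕ → ℕ
  real : ℕ → ℕ → ℝ

/-- Expressions for natural numbers. -/
inductive NExp where
  | const (c : ℕ)
  | read (arr : ℕ) (idx : NExp)
  | add (a b : NExp)
  | sub (a b : NExp)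

/-- Expressions for real numbers. There is no conversion of reals to natural numbers. -/
inductive RExp where
  | const (c : ℚ)
  | read (arr : ℕ) (idx : NExp)
  | add (a b : RExp)
  | sub (a b : RExp)
  | mul (a b : RExp)
  | div (a b : RExp)

/-- Tests. -/
inductive Test where
  | natEq (a b : NExp)
  | natLt (a b : NExp)
  | realLt (a b : RExp)
  | not (t : Test)
  | and (t₁ t₂ : Test)

/-- Programs. -/
inductive Prog where
  | skip
  | setNat (arr : ℕ) (idx : NExp) (e : NExp)
  | setReal (arr : ℕ) (idx : NExp) (e : RExp)
  | seq (p q : Prog)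
  | cond (t : Test) (p q : Prog)
  | loop (t : Test) (p : Prog)

/-- Value (subtraction is truncated at `0`). -/
def NExp.eval (σ : Mem) : NExp → ℕ
  | .const c => c
  | .read arr idx => σ.nat arr (idx.eval σ)
  | .add a b => a.eval σ + b.eval σ
  | .sub a b => a.eval σ - b.eval σ

/-- Value (a division by `0` gives `0`). -/
noncomputable def RExp.eval (σ : Mem) : RExp → ℝ
  | .const c => (c : ℝ)
  | .read arr idx => σ.real arr (idx.eval σ)
  | .add a b => a.eval σ + b.eval σ
  | .sub a b => a.eval σ - b.eval σ
  | .mul a b => a.eval σ * b.eval σ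
  | .div a b => a.eval σ / b.eval σ

def Test.Holds (σ : Mem) : Test → Prop
  | .natEq a b => a.eval σ = b.eval σ
  | .natLt a b => a.eval σ < b.eval σ
  | .realLt a b => a.eval σ < b.eval σ
  | .not t => ¬ t.Holds σ
  | .and t₁ t₂ => t₁.Holds σ ∧ t₂.Holds σ

/-- Time to evaluate an expression: one unit for each constant, memory access and operation. -/
def NExp.cost : NExp → ℕ
  | .const _ => 1
  | .read _ idx => idx.cost + 1
  | .add a b => a.cost + b.cost + 1
  | .sub a b => a.cost + b.cost + 1

def RExp.cost : RExp → ℕ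
  | .const _ => 1
  | .read _ idx => idx.cost + 1
  | .add a b => a.cost + b.cost + 1
  | .sub a b => a.cost + b.cost + 1
  | .mul a b => a.cost + b.cost + 1
  | .div a b => a.cost + b.cost + 1

def Test.cost : Test → ℕ
  | .natEq a b => a.cost + b.cost + 1
  | .natLt a b => a.cost + b.cost + 1
  | .realLt a b => a.cost + b.cost + 1
  | .not t => t.cost + 1
  | .and t₁ t₂ => t₁.cost + t₂.cost + 1

/-- Write `v` into cell `i` of the array `arr` of natural numbers. -/
def Mem.writeNat (σ : Mem) (arr i v : ℕ) : Mem where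
  nat := fun b j => if b = arr ∧ j = i then v else σ.nat b j
  real := σ.real

/-- Write `v` into cell `i` of the array `arr` of real numbers. -/
def Mem.writeReal (σ : Mem) (arr i : ℕ) (v : ℝ) : Mem where
  nat := σ.nat
  real := fun b j => if b = arr ∧ j = i then v else σ.real b j

/-- `Exec p σ τ T`: started in memory `σ`, the program `p` halts after exactly `T` time units, with
memory `τ`. -/
inductive Exec : Prog → Mem → Mem → ℕ → Prop where
  | skip (σ : Mem) : Exec .skip σ σ 1
  | setNat (σ : Mem) (arr : ℕ) (idx e : NExp) :
      Exec (.setNat arr idx e) σ (σ.writeNat arr (idx.eval σ) (e.eval σ)) (idx.cost + e.cost + 1)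
  | setReal (σ : Mem) (arr : ℕ) (idx : NExp) (e : RExp) :
      Exec (.setReal arr idx e) σ (σ.writeReal arr (idx.eval σ) (e.eval σ)) (idx.cost + e.cost + 1)
  | seq {p q : Prog} {σ τ ρ : Mem} {T₁ T₂ : ℕ} :
      Exec p σ τ T₁ → Exec q τ ρ T₂ → Exec (.seq p q) σ ρ (T₁ + T₂)
  | cond_true {t : Test} {p q : Prog} {σ τ : Mem} {T : ℕ} :
      t.Holds σ → Exec p σ τ T → Exec (.cond t p q) σ τ (t.cost + 1 + T)
  | cond_false {t : Test} {p q : Prog} {σ τ : Mem} {T : ℕ} :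
      ¬ t.Holds σ → Exec q σ τ T → Exec (.cond t p q) σ τ (t.cost + 1 + T)
  | loop_stop {t : Test} {p : Prog} {σ : Mem} :
      ¬ t.Holds σ → Exec (.loop t p) σ σ (t.cost + 1)
  | loop_step {t : Test} {p : Prog} {σ τ ρ : Mem} {T₁ T₂ : ℕ} :
      t.Holds σ → Exec p σ τ T₁ → Exec (.loop t p) τ ρ T₂ →
      Exec (.loop t p) σ ρ (t.cost + 1 + T₁ + T₂)

end RealRAM

/-! ## Input and output of the one-center problem -/

namespace OneCenter

/-- The memory `σ` holds the input: the sizes `|V|, |E|, n, m`; the edges, with their ends and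
lengths; the distance matrix, row by row; and, for each uncertain point, its weight and its
locations `(u, v, t)` with their probabilities. All other cells may have arbitrary contents. -/
structure HoldsInput {N n m E : ℕ} (Γ : Network (Fin N)) (P : Fin n → Γ.UncertainPoint m)
    (ends : Fin E → Fin N × Fin N) (σ : RealRAM.Mem) : Prop where
  num_vertices : σ.nat 0 0 = N
  num_edges : σ.nat 0 1 = E
  num_points : σ.nat 0 2 = n
  num_locations : σ.nat 0 3 = m
  edge_fst : ∀ k : Fin E, σ.nat 1 k = (ends k).1
  edge_snd : ∀ k : Fin E, σ.nat 2 k = (ends k).2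
  edge_len : ∀ k : Fin E, σ.real 0 k = Γ.len s((ends k).1, (ends k).2)
  dist_matrix : ∀ u v : Fin N, σ.real 1 (u * N + v) = Γ.vertexDist u v
  weight : ∀ i : Fin n, σ.real 2 i = (P i).weight
  loc_fst : ∀ (i : Fin n) (j : Fin m), σ.nat 3 (i * m + j) = ((P i).loc j).fst
  loc_snd : ∀ (i : Fin n) (j : Fin m), σ.nat 4 (i * m + j) = ((P i).loc j).snd
  loc_pos : ∀ (i : Fin n) (j : Fin m), σ.real 3 (i * m + j) = ((P i).loc j).pos
  prob : ∀ (i : Fin n) (j : Fin m), σ.real 4 (i * m + j) = (P i).prob j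

/-- The memory `τ` holds the output: a point `(u, v, t)` of the network and a real number. -/
structure HoldsOutput {N : ℕ} {Γ : Network (Fin N)} (x : Γ.Point) (val : ℝ)
    (τ : RealRAM.Mem) : Prop where
  fst : τ.nat 5 0 = x.fst
  snd : τ.nat 5 1 = x.snd
  pos : τ.real 5 0 = x.pos
  value : τ.real 5 1 = val

end OneCenter

/-! ## Execution with a postcondition on memory and time -/

namespace RealRAM

attribute [simp] NExp.eval RExp.eval Test.Holds NExp.cost RExp.cost Test.cost

/-! Fix an edge of length `L` and follow a point at position `t` along it. A shortest route from a
fixed location enters the edge through one of its ends or never leaves it, so the distance is the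
minimum of `a + t`, `b + (L - t)` and, for a location at position `s` of the same edge, `|s - t|`.
In every case this is a function that starts with slope 1 and whose slope changes by -2, 2, -2 at
three points of the edge (`pointDist_eq_zigzag`, `breakpoints_mem`), found in constant time from the
distance matrix. The `n` weighted expected distances are therefore piecewise linear with `3mn`
breakpoints in all, and the task on one edge is to find a lowest point of their upper envelope in
time `O(mn log mn)`.

Sorting the breakpoints cuts the edge into `Q = 3mn + 1` intervals, the leaves, and the functions
into `S = 3mn + n` segments, each a line over a range of consecutive leaves (`sweepProg_spec`). If
lines over a fixed interval arrive in order of slope, their upper hull is a stack and an insertion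
takes amortized constant time (`IsHull.push`, `pushProg_spec`). Inserting a segment into every leaf
of its range would be too slow. Instead its range is decomposed into dyadic cells, at most two on
each of the logarithmically many levels (`emitProg_spec`). On one level the cell hulls have at most
`2S` pieces in all. Walking through a hull and through the leaves of its cell simultaneously assigns
to each leaf the lines of the pieces that meet it, which makes at most `2S + Q` assignments and does
not lower the maximum over any leaf (`walkCell_spec`, `levelProg_spec`). So all levels together make
`O((S + Q) log Q)` assignments. They are stored by line, hence running through the lines once more
in order of slope builds the hulls of all leaves in linear time without a further sort
(`insertProg_spec`). Each hull is a convex polygonal function, whose minimum is at a vertex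
(`Chain.vertex_bound`).

Correctness is carried by two opposite inequalities about the stored output. `Valid` says that the
stored value bounds the objective at the stored point from above; `Beats` says that the stored value
is at most the objective at every point already treated. After all edges the stored point is a
center and the stored value is its objective.

The machine has neither multiplication nor division of naturals, so multiples, halves and owners of
locations are tabulated beforehand in time `O(|V| + |E| + mn)`, and `|V| ≤ |E| + 1` by
connectedness. Programs are verified with postconditions on memory and time (`Runs`), a frame rule
(`Exec.frame`), and loops paid for by potentials (`runs_loop`). -/

@[simp] theorem Mem.writeNat_real (σ : Mem) (a i v : ℕ) : (σ.writeNat a i v).real = σ.real := rfl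

@[simp] theorem Mem.writeReal_nat (σ : Mem) (a i : ℕ) (v : ℝ) :
    (σ.writeReal a i v).nat = σ.nat := rfl

@[simp] theorem Mem.writeNat_nat_ne (σ : Mem) {a b : ℕ} (i v : ℕ) (h : b ≠ a) :
    (σ.writeNat a i v).nat b = σ.nat b := by
  funext j; simp [Mem.writeNat, h]

@[simp] theorem Mem.writeNat_nat_same (σ : Mem) (a i v : ℕ) :
    (σ.writeNat a i v).nat a = Function.update (σ.nat a) i v := by
  funext j; simp [Mem.writeNat, Function.update_apply]

@[simp] theorem Mem.writeReal_real_ne (σ : Mem) {a b : ℕ} (i : ℕ) (v : ℝ) (h : b ≠ a) :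
    (σ.writeReal a i v).real b = σ.real b := by
  funext j; simp [Mem.writeReal, h]

@[simp] theorem Mem.writeReal_real_same (σ : Mem) (a i : ℕ) (v : ℝ) :
    (σ.writeReal a i v).real a = Function.update (σ.real a) i v := by
  funext j; simp [Mem.writeReal, Function.update_apply]

/-- The arrays of natural numbers that a program may write. -/
def Prog.natWrites : Prog → List ℕ
  | .skip => []
  | .setNat a _ _ => [a]
  | .setReal _ _ _ => []
  | .seq p q => p.natWrites ++ q.natWrites
  | .cond _ p q => p.natWrites ++ q.natWrites
  | .loop _ p => p.natWrites

/-- The arrays of reals that a program may write. -/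
def Prog.realWrites : Prog → List ℕ
  | .skip => []
  | .setNat _ _ _ => []
  | .setReal a _ _ => [a]
  | .seq p q => p.realWrites ++ q.realWrites
  | .cond _ p q => p.realWrites ++ q.realWrites
  | .loop _ p => p.realWrites

/-- The memories agree on all arrays that `p` cannot write. -/
structure Prog.Frame (p : Prog) (σ τ : Mem) : Prop where
  nat : ∀ a, a ∉ p.natWrites → τ.nat a = σ.nat a
  real : ∀ a, a ∉ p.realWrites → τ.real a = σ.real a

theorem Prog.Frame.refl (p : Prog) (σ : Mem) : p.Frame σ σ := ⟨fun _ _ => rfl, fun _ _ => rfl⟩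

theorem Prog.Frame.trans {p : Prog} {σ τ ρ : Mem} (h₁ : p.Frame σ τ) (h₂ : p.Frame τ ρ) :
    p.Frame σ ρ :=
  ⟨fun a ha => (h₂.nat a ha).trans (h₁.nat a ha), fun a ha => (h₂.real a ha).trans (h₁.real a ha)⟩

theorem Prog.Frame.mono {p q : Prog} {σ τ : Mem} (h : p.Frame σ τ)
    (h₁ : ∀ a ∈ p.natWrites, a ∈ q.natWrites) (h₂ : ∀ a ∈ p.realWrites, a ∈ q.realWrites) :
    q.Frame σ τ :=
  ⟨fun a ha => h.nat a fun h' => ha (h₁ a h'), fun a ha => h.real a fun h' => ha (h₂ a h')⟩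

/-- Array names are literals, so the arrays that can change are read off from the program text.
Specifications then mention only what changes, and the rest is settled by `decide` or `simp`. -/
theorem Exec.frame {p : Prog} {σ τ : Mem} {T : ℕ} (h : Exec p σ τ T) : p.Frame σ τ := by
  induction h with
  | skip σ => exact .refl _ _
  | setNat σ arr idx e =>
    exact ⟨fun a ha => Mem.writeNat_nat_ne _ _ _ (by simpa [Prog.natWrites] using ha),
      fun a _ => rfl⟩
  | setReal σ arr idx e =>
    exact ⟨fun a _ => rfl,
      fun a ha => Mem.writeReal_real_ne _ _ _ (by simpa [Prog.realWrites] using ha)⟩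
  | seq _ _ h₁ h₂ =>
    exact (h₁.mono (by simp +contextual [Prog.natWrites])
      (by simp +contextual [Prog.realWrites])).trans
        (h₂.mono (by simp +contextual [Prog.natWrites]) (by simp +contextual [Prog.realWrites]))
  | cond_true _ _ h =>
    exact h.mono (by simp +contextual [Prog.natWrites]) (by simp +contextual [Prog.realWrites])
  | cond_false _ _ h =>
    exact h.mono (by simp +contextual [Prog.natWrites]) (by simp +contextual [Prog.realWrites])
  | loop_stop _ => exact .refl _ _
  | loop_step _ _ _ h₁ h₂ =>
    exact (h₁.mono (by simp [Prog.natWrites]) (by simp [Prog.realWrites])).trans h₂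

/-- Started in `σ`, the program halts with memory and time satisfying `Q`. -/
def Runs (p : Prog) (σ : Mem) (Q : Mem → ℕ → Prop) : Prop := ∃ τ T, Exec p σ τ T ∧ Q τ T

/-- The frame of the execution is handed to the weakened postcondition. This is how facts about
untouched arrays survive a call. -/
theorem Runs.mono {p : Prog} {σ : Mem} {Q Q' : Mem → ℕ → Prop} (h : Runs p σ Q)
    (hQ : ∀ τ T, p.Frame σ τ → Q τ T → Q' τ T) : Runs p σ Q' := by
  obtain ⟨τ, T, he, hq⟩ := h
  exact ⟨τ, T, he, hQ τ T he.frame hq⟩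

-- Weakest precondition rules, valid as equivalences because execution is deterministic. As `simp`
-- lemmas they execute straight-line code symbolically.
@[simp] theorem runs_skip {σ : Mem} {Q : Mem → ℕ → Prop} : Runs .skip σ Q ↔ Q σ 1 := by
  constructor
  · rintro ⟨τ, T, h, hq⟩; cases h; exact hq
  · exact fun h => ⟨_, _, .skip σ, h⟩

@[simp] theorem runs_setNat {σ : Mem} {a : ℕ} {i e : NExp} {Q : Mem → ℕ → Prop} :
    Runs (.setNat a i e) σ Q ↔
      Q (σ.writeNat a (i.eval σ) (e.eval σ)) (i.cost + e.cost + 1) := by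
  constructor
  · rintro ⟨τ, T, h, hq⟩; cases h; exact hq
  · exact fun h => ⟨_, _, .setNat σ a i e, h⟩

@[simp] theorem runs_setReal {σ : Mem} {a : ℕ} {i : NExp} {e : RExp} {Q : Mem → ℕ → Prop} :
    Runs (.setReal a i e) σ Q ↔
      Q (σ.writeReal a (i.eval σ) (e.eval σ)) (i.cost + e.cost + 1) := by
  constructor
  · rintro ⟨τ, T, h, hq⟩; cases h; exact hq
  · exact fun h => ⟨_, _, .setReal σ a i e, h⟩

@[simp] theorem runs_seq {σ : Mem} {p q : Prog} {Q : Mem → ℕ → Prop} :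
    Runs (.seq p q) σ Q ↔ Runs p σ fun τ T₁ => Runs q τ fun ρ T₂ => Q ρ (T₁ + T₂) := by
  constructor
  · rintro ⟨τ, T, h, hq⟩; cases h with
    | seq h₁ h₂ => exact ⟨_, _, h₁, _, _, h₂, hq⟩
  · rintro ⟨τ, T₁, h₁, ρ, T₂, h₂, hq⟩; exact ⟨_, _, .seq h₁ h₂, hq⟩

@[simp] theorem runs_cond {σ : Mem} {t : Test} {p q : Prog} {Q : Mem → ℕ → Prop} :
    Runs (.cond t p q) σ Q ↔
      (t.Holds σ → Runs p σ fun τ T => Q τ (t.cost + 1 + T)) ∧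
      (¬ t.Holds σ → Runs q σ fun τ T => Q τ (t.cost + 1 + T)) := by
  constructor
  · rintro ⟨τ, T, h, hq⟩; cases h with
    | cond_true ht h => exact ⟨fun _ => ⟨_, _, h, hq⟩, fun h' => absurd ht h'⟩
    | cond_false ht h => exact ⟨fun h' => absurd h' ht, fun _ => ⟨_, _, h, hq⟩⟩
  · rintro ⟨h₁, h₂⟩
    by_cases ht : t.Holds σ
    · obtain ⟨τ, T, h, hq⟩ := h₁ ht; exact ⟨_, _, .cond_true ht h, hq⟩
    · obtain ⟨τ, T, h, hq⟩ := h₂ ht; exact ⟨_, _, .cond_false ht h, hq⟩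

/-- Loop rule with a ghost state `a` and a potential `Φ` that pays for the iterations. -/
theorem runs_loop {α : Type*} (I : α → Mem → Prop) (Φ : α → ℕ) {t : Test} {p : Prog} {σ : Mem}
    {a₀ : α} (h₀ : I a₀ σ)
    (step : ∀ a τ, (Prog.loop t p).Frame σ τ → I a τ → t.Holds τ →
      Runs p τ fun ρ T => ∃ a', I a' ρ ∧ t.cost + 1 + T + Φ a' ≤ Φ a) :
    Runs (.loop t p) σ fun τ T => ∃ a, I a τ ∧ ¬ t.Holds τ ∧ T + Φ a ≤ Φ a₀ + t.cost + 1 := by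
  -- Each iteration lowers the potential by at least `t.cost + 1 > 0`, so strong induction on it
  -- gives termination together with the time bound.
  have key : ∀ n a τ, Φ a = n → (Prog.loop t p).Frame σ τ → I a τ →
      Runs (.loop t p) τ fun ρ T => ∃ a', I a' ρ ∧ ¬ t.Holds ρ ∧
        T + Φ a' ≤ Φ a + t.cost + 1 := by
    intro n
    induction n using Nat.strong_induction_on with
    | _ n ih =>
      intro a τ hn hf hI
      by_cases ht : t.Holds τ
      · obtain ⟨ρ, T, he, a', hI', hT⟩ := step a τ hf hI ht
        have hf' : (Prog.loop t p).Frame τ ρ := he.frame.mono (by simp [Prog.natWrites])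
          (by simp [Prog.realWrites])
        obtain ⟨ρ', T', he', a'', hI'', ht'', hT'⟩ := ih (Φ a') (by omega) a' ρ rfl (hf.trans hf') hI'
        exact ⟨ρ', _, .loop_step ht he he', a'', hI'', ht'', by omega⟩
      · exact ⟨τ, _, Exec.loop_stop ht, a, hI, ht, by omega⟩
  exact key _ a₀ σ rfl (.refl _ _) h₀

/-- The scalar variable kept in cell `0` of an array. -/
abbrev NExp.var (a : ℕ) : NExp := .read a (.const 0)

/-- The real scalar variable kept in cell `0` of an array. -/
abbrev RExp.var (a : ℕ) : RExp := .read a (.const 0)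

/-- `for c = 0, …, bnd - 1 do body`. -/
def Prog.forTo (c : ℕ) (bnd : NExp) (body : Prog) : Prog :=
  .seq (.setNat c (.const 0) (.const 0))
    (.loop (.natLt (.var c) bnd)
      (.seq body (.setNat c (.const 0) (.add (.var c) (.const 1)))))

@[simp] theorem Prog.natWrites_forTo (c : ℕ) (bnd : NExp) (body : Prog) :
    (Prog.forTo c bnd body).natWrites = c :: (body.natWrites ++ [c]) := rfl

@[simp] theorem Prog.realWrites_forTo (c : ℕ) (bnd : NExp) (body : Prog) :
    (Prog.forTo c bnd body).realWrites = body.realWrites := by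
  simp [Prog.forTo, Prog.realWrites]

/-- Rule for counting loops whose bound is a memory cell: amortized form. -/
theorem runs_forTo_amortized {α : Type*} (I : ℕ → α → Mem → Prop) (Φ : ℕ → α → ℕ) (B N : ℕ)
    {c b j : ℕ} {body : Prog} {σ : Mem} {a₀ : α}
    (hc : c ∉ body.natWrites) (hb : b ∉ body.natWrites) (hbc : b ≠ c) (hN : σ.nat b j = N)
    (h₀ : I 0 a₀ σ) (hI : ∀ i a τ v, I i a τ → I i a (τ.writeNat c 0 v))
    (step : ∀ i a τ, i < N → τ.nat c 0 = i →
      (Prog.forTo c (.read b (.const j)) body).Frame σ τ → I i a τ →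
      Runs body τ fun ρ T => ∃ a', I (i + 1) a' ρ ∧ T + Φ (i + 1) a' ≤ Φ i a + B) :
    Runs (Prog.forTo c (.read b (.const j)) body) σ fun τ T =>
      ∃ a, I N a τ ∧ τ.nat c 0 = N ∧ T + Φ N a ≤ Φ 0 a₀ + N * (B + 12) + 9 := by
  simp only [Prog.forTo, runs_seq, runs_setNat, NExp.eval]
  have hf₀ : (Prog.forTo c (.read b (.const j)) body).Frame σ (σ.writeNat c 0 0) :=
    ⟨fun a ha => Mem.writeNat_nat_ne _ _ _ (by simp at ha; tauto), fun a ha => rfl⟩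
  -- Of the 12 units per iteration, 6 are for the test and 6 for incrementing the counter; the final
  -- 9 are 3 for the initialization and 6 for the failing test.
  refine (runs_loop (α := ℕ × α)
    (fun s τ => I s.1 s.2 τ ∧ s.1 ≤ N ∧ τ.nat c 0 = s.1 ∧ τ.nat b j = N)
    (fun s => Φ s.1 s.2 + (N - s.1) * (B + 12)) (a₀ := (0, a₀))
    ⟨hI _ _ _ _ h₀, Nat.zero_le _, by simp, by simp [hbc, hN]⟩ ?_).mono ?_
  · rintro ⟨i, a⟩ τ hf ⟨hIi, hi, hci, hbj⟩ ht
    simp only [Test.Holds, NExp.eval, hci, hbj] at ht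
    have hf' : (Prog.forTo c (.read b (.const j)) body).Frame σ τ :=
      hf₀.trans (hf.mono (by simp [Prog.natWrites]; tauto) (by simp [Prog.realWrites]))
    rw [runs_seq]
    refine (step i a τ ht hci hf' hIi).mono ?_
    rintro ρ T hfr ⟨a', hI', hT⟩
    have h1 : ρ.nat c 0 = i := by rw [hfr.nat c hc, hci]
    have h2 : ρ.nat b j = N := by rw [hfr.nat b hb, hbj]
    simp only [runs_setNat, NExp.eval, NExp.cost, Test.cost, h1]
    refine ⟨(i + 1, a'), ⟨hI _ _ _ _ hI', ht, by simp, by simp [hbc, h2]⟩, ?_⟩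
    obtain ⟨d, hd⟩ := Nat.exists_eq_add_of_lt ht
    have e1 : N - i = d + 1 := by omega
    have e2 : N - (i + 1) = d := by omega
    simp only [e1, e2]
    linarith
  · rintro τ T - ⟨⟨i, a⟩, ⟨hIi, hi, hci, hbj⟩, ht, hT⟩
    simp only [Test.Holds, NExp.eval, hci, hbj, not_lt] at ht
    obtain rfl : i = N := le_antisymm hi ht
    refine ⟨a, hIi, hci, ?_⟩
    simp only [Nat.sub_self, Nat.sub_zero, Test.cost, NExp.cost] at hT ⊢
    omega

/-- Rule for counting loops whose bound is a memory cell. -/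
theorem runs_forTo (I : ℕ → Mem → Prop) (B N : ℕ)
    {c b j : ℕ} {body : Prog} {σ : Mem}
    (hc : c ∉ body.natWrites) (hb : b ∉ body.natWrites) (hbc : b ≠ c) (hN : σ.nat b j = N)
    (h₀ : I 0 σ) (hI : ∀ i τ v, I i τ → I i (τ.writeNat c 0 v))
    (step : ∀ i τ, i < N → τ.nat c 0 = i →
      (Prog.forTo c (.read b (.const j)) body).Frame σ τ → I i τ →
      Runs body τ fun ρ T => I (i + 1) ρ ∧ T ≤ B) :
    Runs (Prog.forTo c (.read b (.const j)) body) σ fun τ T =>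
      I N τ ∧ τ.nat c 0 = N ∧ T ≤ N * (B + 12) + 9 := by
  refine (runs_forTo_amortized (α := Unit) (fun i _ => I i) (fun _ _ => 0) B N (a₀ := ())
    hc hb hbc hN h₀ (fun i _ => hI i) ?_).mono ?_
  · intro i _ τ h1 h2 h3 h4
    exact (step i τ h1 h2 h3 h4).mono fun ρ T _ h => ⟨(), h.1, by simpa using h.2⟩
  · rintro τ T - ⟨_, h1, h2, h3⟩
    exact ⟨h1, h2, by simpa using h3⟩

/-- Execution of consecutive parts. -/
infixr:60 " ;; " => Prog.seq

end RealRAM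

/-! ## Sorting by merging -/

namespace RealRAM

open Finset

/-- The rows of `ord`, cut into blocks of width `w`, are sorted by `key` within each block. -/
def BlockSorted (key : ℕ → ℝ) (ord : ℕ → ℕ) (q w : ℕ) : Prop :=
  ∀ c s t, c * w ≤ s → s ≤ t → t < (c + 1) * w → t < q → key (ord s) ≤ key (ord t)

/-- State of the merge of two adjacent blocks `[g, ae)`, `[ae, be)` of `src` into `dst`, after `o`
entries of `dst` have been written. -/
structure MergeState (key : ℕ → ℝ) (src dst : ℕ → ℕ) (q w o c a ae b be : ℕ) : Prop where
  ae_eq : ae = min (c * (2 * w) + w) q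
  be_eq : be = min (c * (2 * w) + 2 * w) q
  le_a : c * (2 * w) ≤ a
  a_le : a ≤ ae
  le_b : ae ≤ b
  b_le : b ≤ be
  pos : o + ae = a + b
  sum : ∀ F : ℕ → ℝ, ∑ t ∈ range o, F (dst t) =
    ∑ t ∈ range a, F (src t) + ∑ t ∈ Ico ae b, F (src t)
  sorted : BlockSorted key dst o (2 * w)
  head_a : ∀ s, c * (2 * w) ≤ s → s < o → a < ae → key (dst s) ≤ key (src a)
  head_b : ∀ s, c * (2 * w) ≤ s → s < o → b < be → key (dst s) ≤ key (src b)

variable {key : ℕ → ℝ} {src dst : ℕ → ℕ} {q w o c a ae b be : ℕ}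

/-- That `dst` rearranges `src` is expressed by equal sums of every real function `F` over the
entries. This form splits over ranges without bookkeeping of permutations, and later it is applied
directly to sums over breakpoints. Both head conditions are vacuous here because the new block is
still empty. -/
theorem MergeState.init (hw : 0 < w) (h : BlockSorted key dst o (2 * w)) (ho : o = c * (2 * w))
    (hq : o ≤ q) (hs : ∀ F : ℕ → ℝ, ∑ t ∈ range o, F (dst t) = ∑ t ∈ range o, F (src t)) :
    MergeState key src dst q w o c o (min (o + w) q) (min (o + w) q)
      (min (min (o + w) q + w) q) := by
  subst ho
  refine ⟨rfl, by omega, le_rfl, by omega, le_rfl, by omega, by omega, fun F => ?_, h, ?_, ?_⟩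
  · rw [hs F]; simp
  · intro s h1 h2; omega
  · intro s h1 h2; omega

theorem MergeState.next (hw : 0 < w) (h : MergeState key src dst q w o c a ae b be)
    (ha : a = ae) (hb : b = be) (hoq : o < q) :
    MergeState key src dst q w o (c + 1) o (min (o + w) q) (min (o + w) q)
      (min (min (o + w) q + w) q) := by
  have h1 := h.ae_eq; have h2 := h.be_eq; have h3 := h.pos
  have ho : o = (c + 1) * (2 * w) := by rw [add_mul, one_mul]; omega
  refine MergeState.init hw h.sorted ho hoq.le fun F => ?_
  have ho' : b = o := by omega
  rw [h.sum F, ha, ← ho', range_eq_Ico, range_eq_Ico, sum_Ico_consecutive _ (Nat.zero_le _) h.le_b]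

theorem BlockSorted.push {W v : ℕ} (hs : BlockSorted key dst o W) (c : ℕ)
    (hc : ∀ s, c * W ≤ s → s < o → key (dst s) ≤ key v) (h1 : c * W ≤ o) (h2 : o < (c + 1) * W) :
    BlockSorted key (Function.update dst o v) (o + 1) W := by
  intro c' s t hs1 hst ht hto
  rcases Nat.lt_or_ge t o with h | h
  · rw [Function.update_of_ne (by omega), Function.update_of_ne (by omega)]
    exact hs c' s t hs1 hst ht h
  · obtain rfl : t = o := by omega
    rcases Nat.lt_or_ge s t with h' | h'
    · rw [Function.update_self, Function.update_of_ne (by omega)]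
      refine hc s ?_ h'
      -- Position `o` lies in block `c'` as well, so `c ≤ c'`, and the hypothesis on block `c`
      -- applies.
      have : c < c' + 1 := lt_of_mul_lt_mul_right (h1.trans_lt ht) (Nat.zero_le W)
      exact (Nat.mul_le_mul_right W (Nat.lt_succ_iff.1 this)).trans hs1 |>.trans le_rfl
    · obtain rfl : s = t := by omega
      exact le_rfl

theorem sum_range_update_succ (F : ℕ → ℝ) (dst : ℕ → ℕ) (o v : ℕ) :
    ∑ t ∈ range (o + 1), F (Function.update dst o v t) = ∑ t ∈ range o, F (dst t) + F v := by
  rw [sum_range_succ, Function.update_self]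
  congr 1
  refine sum_congr rfl fun t ht => ?_
  rw [Function.update_of_ne (mem_range.1 ht).ne]

/-- The written entries of the block stay below both remaining heads: the new head of the first
block is at least the old one, and the head of the second block is at least the entry just taken. -/
theorem MergeState.takeA (h : MergeState key src dst q w o c a ae b be)
    (hsrc : BlockSorted key src q w) (ha : a < ae) (hab : b < be → key (src a) ≤ key (src b)) :
    MergeState key src (Function.update dst o (src a)) q w (o + 1) c (a + 1) ae b be := by
  have h1 := h.ae_eq; have h2 := h.be_eq; have h3 := h.pos; have h4 := h.le_a; have h5 := h.a_le
  have h6 := h.le_b; have h7 := h.b_le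
  refine ⟨h1, h2, by omega, ha, h6, h7, by omega, fun F => ?_, ?_, ?_, ?_⟩
  · rw [sum_range_update_succ, h.sum F, sum_range_succ]; ring
  · exact h.sorted.push c (fun s hs hso => h.head_a s hs hso ha) (by omega)
      (by rw [add_mul, one_mul]; omega)
  · intro s hs hso ha'
    have hstep : key (src a) ≤ key (src (a + 1)) := by
      -- The pair `c` of width `2 * w` consists of the source blocks `2 * c` and `2 * c + 1` of
      -- width `w`.
      refine hsrc (2 * c) a (a + 1) ?_ (by omega) ?_ (by omega)
      · calc 2 * c * w = c * (2 * w) := by ring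
          _ ≤ a := h4
      · have : (2 * c + 1) * w = c * (2 * w) + w := by ring
        omega
    rcases Nat.lt_or_ge s o with h' | h'
    · rw [Function.update_of_ne (by omega)]
      exact (h.head_a s hs h' ha).trans hstep
    · obtain rfl : s = o := by omega
      rwa [Function.update_self]
  · intro s hs hso hb
    rcases Nat.lt_or_ge s o with h' | h'
    · rw [Function.update_of_ne (by omega)]
      exact h.head_b s hs h' hb
    · obtain rfl : s = o := by omega
      rw [Function.update_self]; exact hab hb

theorem MergeState.takeB (h : MergeState key src dst q w o c a ae b be)
    (hsrc : BlockSorted key src q w) (hb : b < be) (hab : a < ae → key (src b) ≤ key (src a)) :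
    MergeState key src (Function.update dst o (src b)) q w (o + 1) c a ae (b + 1) be := by
  have h1 := h.ae_eq; have h2 := h.be_eq; have h3 := h.pos; have h4 := h.le_a; have h5 := h.a_le
  have h6 := h.le_b; have h7 := h.b_le
  refine ⟨h1, h2, h4, h5, by omega, hb, by omega, fun F => ?_, ?_, ?_, ?_⟩
  · rw [sum_range_update_succ, h.sum F, sum_Ico_succ_top h6]; ring
  · exact h.sorted.push c (fun s hs hso => h.head_b s hs hso hb) (by omega)
      (by rw [add_mul, one_mul]; omega)
  · intro s hs hso ha
    rcases Nat.lt_or_ge s o with h' | h'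
    · rw [Function.update_of_ne (by omega)]
      exact h.head_a s hs h' ha
    · obtain rfl : s = o := by omega
      rw [Function.update_self]; exact hab ha
  · intro s hs hso hb'
    have hstep : key (src b) ≤ key (src (b + 1)) := by
      refine hsrc (2 * c + 1) b (b + 1) ?_ (by omega) ?_ (by omega)
      · have : (2 * c + 1) * w = c * (2 * w) + w := by ring
        omega
      · have : (2 * c + 1 + 1) * w = c * (2 * w) + 2 * w := by ring
        omega
    rcases Nat.lt_or_ge s o with h' | h'
    · rw [Function.update_of_ne (by omega)]
      exact (h.head_b s hs h' hb).trans hstep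
    · obtain rfl : s = o := by omega
      rwa [Function.update_self]

/-- `min x q`. -/
abbrev NExp.minus (x q : NExp) : NExp := .sub q (.sub q x)

/-- Merge adjacent blocks of width `w` (cell `36`) of array `30` into array `31`. The keys are in
the real array `ka`, their number is in the scalar `nq`. -/
def mergePass (ka nq : ℕ) : Prog :=
  .setNat 32 (.const 0) (.const 0) ;;
  .setNat 33 (.const 0) (.const 0) ;;
  .setNat 34 (.const 0) (.const 0) ;;
  .setNat 35 (.const 0) (.const 0) ;;
  .forTo 37 (.read nq (.const 0))
    (.cond (.and (.natEq (.var 32) (.var 33)) (.natEq (.var 34) (.var 35)))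
      (.setNat 32 (.const 0) (.var 37) ;;
       .setNat 33 (.const 0) (.minus (.add (.var 37) (.var 36)) (.var nq)) ;;
       .setNat 34 (.const 0) (.var 33) ;;
       .setNat 35 (.const 0) (.minus (.add (.var 33) (.var 36)) (.var nq)))
      .skip ;;
     .cond (.and (.natLt (.var 32) (.var 33)) (.not (.and (.natLt (.var 34) (.var 35))
        (.realLt (.read ka (.read 30 (.var 34))) (.read ka (.read 30 (.var 32)))))))
      (.setNat 31 (.var 37) (.read 30 (.var 32)) ;;
       .setNat 32 (.const 0) (.add (.var 32) (.const 1)))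
      (.setNat 31 (.var 37) (.read 30 (.var 34)) ;;
       .setNat 34 (.const 0) (.add (.var 34) (.const 1)))) ;;
  .forTo 37 (.read nq (.const 0)) (.setNat 30 (.var 37) (.read 31 (.var 37)))

/-- One flat loop writes exactly one entry per iteration, opening the next pair of blocks first when
the current pair is exhausted; hence linear time whatever the number of blocks. -/
theorem mergePass_spec {ka nq : ℕ} (hnq : nq < 30) {σ : Mem} {q w : ℕ} (hq : σ.nat nq 0 = q)
    (hw : σ.nat 36 0 = w) (hw0 : 0 < w) (hs : BlockSorted (σ.real ka) (σ.nat 30) q w) :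
    Runs (mergePass ka nq) σ fun τ T => BlockSorted (σ.real ka) (τ.nat 30) q (2 * w) ∧
      (∀ F : ℕ → ℝ, ∑ t ∈ range q, F (τ.nat 30 t) = ∑ t ∈ range q, F (σ.nat 30 t)) ∧
      T ≤ 200 * (q + 1) := by
  have n30 : nq ≠ 30 := by omega
  have n31 : nq ≠ 31 := by omega
  have n32 : nq ≠ 32 := by omega
  have n33 : nq ≠ 33 := by omega
  have n34 : nq ≠ 34 := by omega
  have n35 : nq ≠ 35 := by omega
  have n36 : nq ≠ 36 := by omega
  have n37 : nq ≠ 37 := by omega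
  simp only [mergePass, runs_seq, runs_setNat, NExp.eval, NExp.cost]
  -- The first alternative describes the start: four zero cells look like a pair of exhausted
  -- blocks, so the first iteration opens pair 0.
  refine (runs_forTo (fun o τ =>
      (o = 0 ∧ τ.nat 32 0 = τ.nat 33 0 ∧ τ.nat 34 0 = τ.nat 35 0) ∨
      ∃ c, MergeState (σ.real ka) (σ.nat 30) (τ.nat 31) q w o c
        (τ.nat 32 0) (τ.nat 33 0) (τ.nat 34 0) (τ.nat 35 0)) 150 q
    (by simp [Prog.natWrites]) (by simp [Prog.natWrites, *]) n37 (by simp [*])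
    (.inl ⟨rfl, by simp, by simp⟩)
    (fun i τ v h => by simpa using h) ?_).mono ?_
  · intro o τ ho hco hf hI
    have f30 : τ.nat 30 = σ.nat 30 := by
      rw [hf.nat 30 (by simp [Prog.natWrites])]; simp
    have f36 : τ.nat 36 0 = w := by
      rw [hf.nat 36 (by simp [Prog.natWrites])]; simpa
    have fq : τ.nat nq 0 = q := by
      rw [hf.nat nq (by simp [Prog.natWrites, *])]; simp [*]
    have fk : τ.real = σ.real := by
      funext a; rw [hf.real a (by simp [Prog.realWrites])]; simp
    have key : ∀ (ρ : Mem), ρ.nat 30 = σ.nat 30 → ρ.nat 37 0 = o → ρ.real = σ.real →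
        (¬ (ρ.nat 32 0 = ρ.nat 33 0 ∧ ρ.nat 34 0 = ρ.nat 35 0)) →
        (∃ c, MergeState (σ.real ka) (σ.nat 30) (ρ.nat 31) q w o c
        (ρ.nat 32 0) (ρ.nat 33 0) (ρ.nat 34 0) (ρ.nat 35 0)) →
        Runs (.cond (.and (.natLt (.var 32) (.var 33)) (.not (.and (.natLt (.var 34) (.var 35))
        (.realLt (.read ka (.read 30 (.var 34))) (.read ka (.read 30 (.var 32)))))))
      (.setNat 31 (.var 37) (.read 30 (.var 32)) ;;
       .setNat 32 (.const 0) (.add (.var 32) (.const 1)))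
      (.setNat 31 (.var 37) (.read 30 (.var 34)) ;;
       .setNat 34 (.const 0) (.add (.var 34) (.const 1)))) ρ fun ρ' T =>
        (∃ c, MergeState (σ.real ka) (σ.nat 30) (ρ'.nat 31) q w (o + 1) c
        (ρ'.nat 32 0) (ρ'.nat 33 0) (ρ'.nat 34 0) (ρ'.nat 35 0)) ∧ T ≤ 60 := by
      rintro ρ g30 g37 gk hne ⟨c, hm⟩
      simp [g30, g37, gk]
      refine ⟨fun h1 h2 => ⟨c, ?_⟩, fun h => ⟨c, ?_⟩⟩
      · simpa using hm.takeA hs h1 h2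
      · have hb : ρ.nat 34 0 < ρ.nat 35 0 := by
          by_contra hb
          have e1 := hm.a_le; have e2 := hm.b_le
          rcases Nat.lt_or_ge (ρ.nat 32 0) (ρ.nat 33 0) with h' | h'
          · exact hb (h h').1
          · exact hne ⟨by omega, by omega⟩
        simpa using hm.takeB hs hb fun ha => (h ha).2.le
    rw [runs_seq, runs_cond]
    refine ⟨fun h => ?_, fun h => ?_⟩
    · simp only [Test.Holds, NExp.eval] at h
      simp only [runs_seq, runs_setNat, NExp.eval, NExp.cost, Test.cost]
      refine (key _ (by simp [f30]) (by simp [hco]) (by simp [fk]) ?_ ?_).mono ?_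
      · simp [hco, f36, fq, n32, n33, n34]; omega
      · have hmin : ∀ x, q - (q - x) = min x q := by omega
        rcases hI with ⟨rfl, h1, h2⟩ | ⟨c, hm⟩
        · refine ⟨0, ?_⟩
          simpa [hco, f36, fq, hmin, n32, n33, n34] using
            MergeState.init (key := σ.real ka) (src := σ.nat 30) (dst := τ.nat 31) (q := q) (c := 0)
              hw0 (fun _ _ _ _ _ _ h => absurd h (Nat.not_lt_zero _)) (by simp) (Nat.zero_le q)
              (by simp)
        · refine ⟨c + 1, ?_⟩
          simpa [hco, f36, fq, hmin, n32, n33, n34] using hm.next hw0 h.1 h.2 ho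
      · rintro ρ T - ⟨h1, h2⟩
        exact ⟨.inr h1, by omega⟩
    · simp only [Test.Holds, NExp.eval] at h
      simp only [runs_skip, NExp.cost, Test.cost]
      refine (key _ f30 hco fk h ?_).mono ?_
      · rcases hI with ⟨-, hI⟩ | hI
        · exact absurd hI h
        · exact hI
      · rintro ρ T - ⟨h1, h2⟩
        exact ⟨.inr h1, by omega⟩
  · rintro τ T hf ⟨hI, -, hT⟩
    have fq : τ.nat nq 0 = q := by
      rw [hf.nat nq (by simp [Prog.natWrites, *])]; simp [*]
    have hres : BlockSorted (σ.real ka) (τ.nat 31) q (2 * w) ∧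
        ∀ F : ℕ → ℝ, ∑ t ∈ range q, F (τ.nat 31 t) = ∑ t ∈ range q, F (σ.nat 30 t) := by
      rcases hI with ⟨rfl, -⟩ | ⟨c, hm⟩
      · exact ⟨fun _ _ _ _ _ _ h => absurd h (Nat.not_lt_zero _), by simp⟩
      · refine ⟨hm.sorted, fun F => ?_⟩
        have h1 := hm.ae_eq; have h2 := hm.be_eq; have h3 := hm.pos; have h5 := hm.a_le
        have h6 := hm.le_b; have h7 := hm.b_le
        have e1 : τ.nat 32 0 = τ.nat 33 0 := by omega
        have e2 : τ.nat 34 0 = q := by omega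
        rw [hm.sum F, e1, ← e2, range_eq_Ico, range_eq_Ico,
          sum_Ico_consecutive _ (Nat.zero_le _) h6]
    refine (runs_forTo (fun i ρ => ∀ t < i, ρ.nat 30 t = τ.nat 31 t) 20 q
      (by simp [Prog.natWrites]) (by simp [Prog.natWrites, *]) n37 (by simp [*])
      (by simp) (fun i τ v h => by simpa using h) ?_).mono ?_
    · intro i ρ hi hc hf' hI
      have f31 : ρ.nat 31 = τ.nat 31 := hf'.nat 31 (by simp [Prog.natWrites])
      simp [hc, f31]
      intro t ht
      rcases Nat.lt_or_ge t i with h | h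
      · rw [Function.update_of_ne (by omega)]; exact hI t h
      · obtain rfl : t = i := by omega
        simp
    · rintro ρ T' - ⟨hI, -, hT'⟩
      refine ⟨fun c s t h1 h2 h3 h4 => ?_, fun F => ?_, by omega⟩
      · rw [hI s (by omega), hI t h4]; exact hres.1 c s t h1 h2 h3 h4
      · rw [← hres.2 F]
        exact sum_congr rfl fun t ht => by rw [hI t (mem_range.1 ht)]

/-- Sort the indices `0, …, q - 1` by their keys in the real array `ka`; the sorted list of
indices is left in array `30`. -/
def sortProg (ka nq : ℕ) : Prog :=
  .forTo 37 (.read nq (.const 0)) (.setNat 30 (.var 37) (.var 37)) ;;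
  .setNat 36 (.const 0) (.const 1) ;;
  .loop (.natLt (.var 36) (.var nq))
    (mergePass ka nq ;; .setNat 36 (.const 0) (.add (.var 36) (.var 36)))

/-- The block width doubles from 1, so after `Nat.clog 2 q` passes a single block contains
everything. Only indices are moved; the keys stay in place. -/
theorem sortProg_spec {ka nq : ℕ} (hnq : nq < 30) {σ : Mem} {q : ℕ} (hq : σ.nat nq 0 = q) :
    Runs (sortProg ka nq) σ fun τ T =>
      (∀ s t, s ≤ t → t < q → σ.real ka (τ.nat 30 s) ≤ σ.real ka (τ.nat 30 t)) ∧
      (∀ F : ℕ → ℝ, ∑ t ∈ range q, F (τ.nat 30 t) = ∑ t ∈ range q, F t) ∧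
      T ≤ 300 * ((q + 1) * (Nat.clog 2 q + 1)) := by
  have n30 : nq ≠ 30 := by omega
  have n36 : nq ≠ 36 := by omega
  have n37 : nq ≠ 37 := by omega
  simp only [sortProg, runs_seq, runs_setNat, NExp.eval, NExp.cost]
  refine (runs_forTo (fun i ρ => ∀ t < i, ρ.nat 30 t = t) 20 q
      (by simp [Prog.natWrites]) (by simp [Prog.natWrites, *]) n37 (by simp [*])
      (by simp) (fun i τ v h => by simpa using h) ?_).mono ?_
  · intro i ρ hi hc _ hI
    simp [hc]
    intro t ht
    rcases Nat.lt_or_ge t i with h | h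
    · rw [Function.update_of_ne (by omega)]; exact hI t h
    · obtain rfl : t = i := by omega
      simp
  rintro τ T hf ⟨hI, -, hT⟩
  have fq : τ.nat nq 0 = q := by
    rw [hf.nat nq (by simp [Prog.natWrites, *])]; simp [*]
  have fr : τ.real = σ.real := by
    funext a; rw [hf.real a (by simp [Prog.realWrites])]
  refine (runs_loop (α := ℕ) (fun k ρ => ρ.nat 36 0 = 2 ^ k ∧ k ≤ Nat.clog 2 q ∧
      ρ.nat nq 0 = q ∧ ρ.real = σ.real ∧ BlockSorted (σ.real ka) (ρ.nat 30) q (2 ^ k) ∧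
      (∀ F : ℕ → ℝ, ∑ t ∈ range q, F (ρ.nat 30 t) = ∑ t ∈ range q, F t))
    (fun k => (Nat.clog 2 q - k) * (200 * (q + 1) + 40)) (a₀ := 0)
    ⟨by simp, Nat.zero_le _, by simp [*], by simp [*], ?_, ?_⟩ ?_).mono ?_
  · intro c s t h1 h2 h3 h4
    simp at h1 h3
    obtain rfl : s = t := by omega
    exact le_rfl
  · intro F
    refine sum_congr rfl fun t ht => ?_
    simp [hI t (mem_range.1 ht)]
  · rintro k ρ - ⟨h36, hk, hρq, hρr, hb, hs⟩ ht
    simp only [Test.Holds, NExp.eval, h36, hρq] at ht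
    have hk' : k < Nat.clog 2 q := (Nat.lt_clog_iff_pow_lt (by norm_num)).2 ht
    rw [runs_seq]
    refine (mergePass_spec hnq hρq h36 (by positivity) (by rwa [hρr])).mono ?_
    rintro ρ' T' hf' ⟨hb', hs', hT'⟩
    have e36 : ρ'.nat 36 0 = 2 ^ k := by
      rw [hf'.nat 36 (by simp [mergePass, Prog.natWrites]), h36]
    have eq' : ρ'.nat nq 0 = q := by
      rw [hf'.nat nq (by simp [mergePass, Prog.natWrites]; omega), hρq]
    have er : ρ'.real = σ.real := by
      rw [← hρr]; funext a; rw [hf'.real a (by simp [mergePass, Prog.realWrites])]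
    simp only [runs_setNat, NExp.eval, NExp.cost, Test.cost]
    refine ⟨k + 1, ⟨?_, hk', by simp [*], by simp [er], ?_, ?_⟩, ?_⟩
    · simp [e36, pow_succ, mul_two]
    · rw [hρr] at hb'
      simpa [pow_succ, mul_comm] using hb'
    · simpa [hs] using hs'
    · obtain ⟨d, hd⟩ := Nat.exists_eq_add_of_lt hk'
      have e1 : Nat.clog 2 q - k = d + 1 := by omega
      have e2 : Nat.clog 2 q - (k + 1) = d := by omega
      rw [e1, e2]
      linarith
  · rintro ρ T' - ⟨k, ⟨h36, hk, hρq, hρr, hb, hs⟩, ht, hT'⟩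
    simp only [Test.Holds, NExp.eval, h36, hρq, not_lt] at ht
    refine ⟨fun s t h1 h2 => hb 0 s t (by simp) h1 (by omega) h2, hs, ?_⟩
    simp only [Nat.sub_zero, Test.cost, NExp.cost] at hT'
    have : 0 ≤ (Nat.clog 2 q - k) * (200 * (q + 1) + 40) := Nat.zero_le _
    nlinarith [Nat.zero_le (Nat.clog 2 q), Nat.zero_le (q * Nat.clog 2 q)]

end RealRAM

/-! ## Upper hulls of lines over an interval, kept as stacks -/

namespace Hull

/-- The value at `x` of the line with number `t`. -/
def val (A B : ℕ → ℝ) (t : ℕ) (x : ℝ) : ℝ := A t + B t * x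

/-- The inequality behind all hull arguments: a steeper line gains on a flatter one from left to
right, so it overtakes it at most once. -/
theorem val_sub_mono {A B : ℕ → ℝ} {s t : ℕ} (h : B s ≤ B t) {x y : ℝ} (hxy : x ≤ y) :
    val A B t x - val A B s x ≤ val A B t y - val A B s y := by
  unfold val
  nlinarith [mul_nonneg (sub_nonneg.2 h) (sub_nonneg.2 hxy)]

/-- The piece of the stack (a list of pairs of a starting point and a line, the rightmost piece
first) that contains `x` is at least `y` there. -/
def Below (A B : ℕ → ℝ) (y x : ℝ) : List (ℝ × ℕ) → Prop
  | [] => False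
  | e :: l => (e.1 ≤ x ∧ y ≤ val A B e.2 x) ∨ (x < e.1 ∧ Below A B y x l)

/-- The pieces start at increasing points of `[a, b]`, the first one at `a`, and fit together
continuously. -/
def Chain (A B : ℕ → ℝ) (a b : ℝ) : List (ℝ × ℕ) → Prop
  | [] => True
  | [e] => e.1 = a ∧ e.1 ≤ b
  | e :: f :: l => e.1 ≤ b ∧ f.1 < e.1 ∧ val A B f.2 e.1 = val A B e.2 e.1 ∧
      Chain A B a b (f :: l)

variable {A B : ℕ → ℝ} {a b : ℝ}

theorem Chain.tail {e : ℝ × ℕ} {l : List (ℝ × ℕ)} (h : Chain A B a b (e :: l)) :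
    Chain A B a b l := by
  cases l with
  | nil => trivial
  | cons f l => exact h.2.2.2

theorem Chain.head_le {e : ℝ × ℕ} {l : List (ℝ × ℕ)} (h : Chain A B a b (e :: l)) : e.1 ≤ b := by
  cases l with
  | nil => exact h.2
  | cons f l => exact h.1

theorem Chain.le_head {e : ℝ × ℕ} {l : List (ℝ × ℕ)} (h : Chain A B a b (e :: l)) : a ≤ e.1 := by
  induction l generalizing e with
  | nil => exact h.1.ge
  | cons f l ih => exact (ih h.2.2.2).trans h.2.1.le

theorem Below.mono {y y' x : ℝ} (hy : y' ≤ y) {l : List (ℝ × ℕ)} (h : Below A B y x l) :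
    Below A B y' x l := by
  induction l with
  | nil => exact h
  | cons e l ih =>
    rcases h with h | h
    · exact .inl ⟨h.1, hy.trans h.2⟩
    · exact .inr ⟨h.1, ih h.2⟩

/-- A line steeper than all lines of the stack that is below the hull at `y` is below the hull on
the left of `y`. -/
theorem Chain.below {e : ℝ × ℕ} {l : List (ℝ × ℕ)} (h : Chain A B a b (e :: l)) {t : ℕ}
    (hB : ∀ f ∈ e :: l, B f.2 ≤ B t) {y : ℝ} (hey : e.1 ≤ y)
    (hy : val A B t y ≤ val A B e.2 y) {x : ℝ} (hax : a ≤ x) (hxy : x ≤ y) : Below A B (val A B t x) x (e :: l) := by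
  induction l generalizing e y with
  | nil =>
    refine .inl ⟨h.1.trans_le hax, ?_⟩
    have := val_sub_mono (A := A) (hB e (by simp)) hxy
    linarith
  | cons f l ih =>
    have hmono := fun u v => val_sub_mono (A := A) (x := u) (y := v) (hB e (by simp))
    rcases le_or_gt e.1 x with hx | hx
    · refine .inl ⟨hx, ?_⟩
      have := hmono x y hxy
      linarith
    · refine .inr ⟨hx, ih h.2.2.2 (fun g hg => hB g (List.mem_cons_of_mem _ hg)) h.2.1.le ?_ hx.le⟩
      -- Neighbouring pieces agree at `e.1`, so being below the top piece there means being below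
      -- the next piece, and the induction continues with `e.1` in place of `y`.
      rw [h.2.2.1]
      linarith [hmono e.1 y hey]

/-- Remove the pieces that lie below the line `t` on their right. -/
noncomputable def pop (A B : ℕ → ℝ) (t : ℕ) : List (ℝ × ℕ) → List (ℝ × ℕ)
  | [] => []
  | e :: l => open Classical in if val A B e.2 e.1 ≤ val A B t e.1 then pop A B t l else e :: l

/-- The abscissa where the lines `s` and `t` cross. -/
noncomputable def crossing (A B : ℕ → ℝ) (s t : ℕ) : ℝ := (A s - A t) / (B t - B s)

/-- Add the line `t` on top of a stack whose lowest pieces are below `t`. -/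
noncomputable def place (A B : ℕ → ℝ) (a b : ℝ) (t : ℕ) : List (ℝ × ℕ) → List (ℝ × ℕ)
  | [] => [(a, t)]
  | e :: l => open Classical in
    if val A B e.2 b < val A B t b then (crossing A B e.2 t, t) :: e :: l else e :: l

/-- Insert the line `t`, which is steeper than the others, into the hull over `[a, b]`. -/
noncomputable def push (A B : ℕ → ℝ) (a b : ℝ) (t : ℕ) (l : List (ℝ × ℕ)) : List (ℝ × ℕ) :=
  place A B a b t (pop A B t l)

theorem pop_suffix (t : ℕ) (l : List (ℝ × ℕ)) : pop A B t l <:+ l := by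
  induction l with
  | nil => exact List.suffix_rfl
  | cons e l ih =>
    rw [pop]
    split_ifs
    · exact ih.trans (List.suffix_cons _ _)
    · exact List.suffix_rfl

theorem chain_pop {t : ℕ} {l : List (ℝ × ℕ)} (h : Chain A B a b l) :
    Chain A B a b (pop A B t l) := by
  induction l with
  | nil => trivial
  | cons e l ih =>
    rw [pop]
    split_ifs
    · exact ih h.tail
    · exact h

/-- A popped piece is not above `t` at its start, hence nowhere to the right of it, so `t` takes
over whatever that piece dominated. -/
theorem below_pop {t : ℕ} {l : List (ℝ × ℕ)} (hB : ∀ f ∈ l, B f.2 ≤ B t) {x y : ℝ}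
    (h : Below A B y x l) : Below A B y x (pop A B t l) ∨ y ≤ val A B t x := by
  induction l with
  | nil => exact .inl h
  | cons e l ih =>
    rw [pop]
    split_ifs with hp
    · rcases h with h | h
      · right
        have := val_sub_mono (A := A) (hB e (by simp)) h.1
        linarith [h.2]
      · exact ih (fun f hf => hB f (List.mem_cons_of_mem _ hf)) h.2
    · exact .inl h

theorem pop_head {t : ℕ} {l m : List (ℝ × ℕ)} {e : ℝ × ℕ} (h : pop A B t l = e :: m) :
    val A B t e.1 < val A B e.2 e.1 := by
  induction l with
  | nil => simp [pop] at h
  | cons f l ih =>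
    rw [pop] at h
    split_ifs at h with hp
    · exact ih h
    · obtain ⟨rfl, rfl⟩ := List.cons.inj h
      exact not_le.1 hp

theorem val_crossing {s t : ℕ} (h : B s ≠ B t) :
    val A B s (crossing A B s t) = val A B t (crossing A B s t) := by
  have : B t - B s ≠ 0 := sub_ne_zero.2 h.symm
  unfold val crossing
  field_simp
  ring

/-- The stack is the upper hull over `[a, b]` of the lines in `D`. -/
structure IsHull (A B : ℕ → ℝ) (a b : ℝ) (D : Set ℕ) (l : List (ℝ × ℕ)) : Prop where
  chain : Chain A B a b l
  mem : ∀ e ∈ l, e.2 ∈ D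
  below : ∀ s ∈ D, ∀ x, a ≤ x → x ≤ b → Below A B (val A B s x) x l

theorem isHull_nil : IsHull A B a b ∅ [] := ⟨trivial, by simp, by simp⟩

/-- After popping, the top piece `e` is strictly above `t` at its own start. If `t` is above `e` at
`b`, they cross in between, `t` dominates to the right of the crossing, and `Chain.below` shows that
the old hull dominates `t` to the left. If not, `Chain.below` applied at `b` shows that `t` is
nowhere above the hull and may be dropped. -/
theorem IsHull.push {D : Set ℕ} {l : List (ℝ × ℕ)} (h : IsHull A B a b D l) (hab : a ≤ b) {t : ℕ}
    (ht : ∀ s ∈ D, B s ≤ B t) : IsHull A B a b (insert t D) (push A B a b t l) := by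
  have hslope : ∀ f ∈ l, B f.2 ≤ B t := fun f hf => ht _ (h.mem f hf)
  have hsub := pop_suffix (A := A) (B := B) t l
  have hmem : ∀ e ∈ pop A B t l, e.2 ∈ insert t D := fun e he => .inr (h.mem e (hsub.subset he))
  have hslope' : ∀ f ∈ pop A B t l, B f.2 ≤ B t := fun f hf => hslope f (hsub.subset hf)
  have hch := chain_pop (t := t) h.chain
  have hbel : ∀ s ∈ insert t D, ∀ x, a ≤ x → x ≤ b →
      Below A B (val A B s x) x (pop A B t l) ∨ val A B s x ≤ val A B t x := by
    rintro s (rfl | hs) x h1 h2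
    · exact .inr le_rfl
    · exact below_pop hslope (h.below s hs x h1 h2)
  unfold Hull.push
  rcases hp : pop A B t l with _ | ⟨e, m⟩
  · rw [hp] at hbel
    refine ⟨⟨rfl, hab⟩, by simp [place], fun s hs x h1 h2 => .inl ⟨h1, ?_⟩⟩
    exact (hbel s hs x h1 h2).resolve_left id
  · have hlt := pop_head hp
    rw [hp] at hbel hmem hslope' hch
    have hmono := fun u v => val_sub_mono (A := A) (x := u) (y := v) (hslope' e (by simp))
    simp only [place]
    split_ifs with hb
    · have hne : B e.2 ≠ B t := by
        intro he
        unfold val at hlt hb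
        rw [he] at hlt hb
        linarith
      have hd : 0 < B t - B e.2 := sub_pos.2 (lt_of_le_of_ne (hslope' e (by simp)) hne)
      have hc := val_crossing (A := A) hne
      -- The difference of `t` and `e` is monotone and vanishes at `p`; its signs at `e.1` and `b`
      -- place `p` between them.
      set p := crossing A B e.2 t
      have hp1 : e.1 < p := by
        by_contra hcon
        linarith [hmono p e.1 (not_lt.1 hcon)]
      have hp2 : p ≤ b := by
        by_contra hcon
        linarith [hmono b p (not_le.1 hcon).le]
      refine ⟨⟨hp2, hp1, hc, hch⟩, ?_, fun s hs x h1 h2 => ?_⟩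
      · intro f hf
        rcases List.mem_cons.1 hf with rfl | hf
        · exact .inl rfl
        · exact hmem f hf
      · rcases le_or_gt p x with hx | hx
        · refine .inl ⟨hx, ?_⟩
          rcases hbel s hs x h1 h2 with (h3 | h3) | h3
          · linarith [hmono p x hx, h3.2]
          · linarith [h3.1]
          · exact h3
        · refine .inr ⟨hx, ?_⟩
          rcases hbel s hs x h1 h2 with h3 | h3
          · exact h3
          · exact (hch.below hslope' hp1.le hc.ge h1 hx.le).mono h3
    · refine ⟨hch, hmem, fun s hs x h1 h2 => ?_⟩
      rcases hbel s hs x h1 h2 with h3 | h3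
      · exact h3
      · exact (hch.below hslope' hch.head_le (not_lt.1 hb) h1 h2).mono h3

/-- Together with `pop_suffix` this is the amortization: an insertion adds at most one piece, and
each popped piece is gone for good. -/
theorem length_push_le (t : ℕ) (l : List (ℝ × ℕ)) :
    (push A B a b t l).length ≤ (pop A B t l).length + 1 := by
  unfold push
  rcases pop A B t l with _ | ⟨e, m⟩
  · simp [place]
  · simp only [place]
    split_ifs <;> simp

end Hull

/-! ### Hull stacks as linked lists in memory -/

namespace RealRAM

open Hull Finset

/-- A linked list in memory: `h` is the address of its first node (`0` for the empty list), and all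
its nodes have addresses below `free`. -/
def ListAt {β : Type*} (nxt : ℕ → ℕ) (pay : ℕ → β) (free : ℕ) : ℕ → List β → Prop
  | h, [] => h = 0
  | h, e :: l => h ≠ 0 ∧ h < free ∧ pay h = e ∧ ListAt nxt pay free (nxt h) l

/-- New nodes are written at the free address and popped nodes are not reused, so cells below `free`
keep their contents and all existing lists survive an allocation. -/
theorem ListAt.congr {β : Type*} {nxt nxt' : ℕ → ℕ} {pay pay' : ℕ → β} {free free' : ℕ}
    (h₁ : ∀ i < free, nxt' i = nxt i) (h₂ : ∀ i < free, pay' i = pay i) (hf : free ≤ free')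
    {l : List β} {h : ℕ} (hl : ListAt nxt pay free h l) : ListAt nxt' pay' free' h l := by
  induction l generalizing h with
  | nil => exact hl
  | cons e l ih =>
    obtain ⟨h0, hlt, he, hl⟩ := hl
    exact ⟨h0, by omega, (h₂ h hlt).trans he, ih (by rwa [h₁ h hlt])⟩

theorem ListAt.eq_nil_iff {β : Type*} {nxt : ℕ → ℕ} {pay : ℕ → β} {free h : ℕ} {l : List β}
    (hl : ListAt nxt pay free h l) : h = 0 ↔ l = [] := by
  cases l with
  | nil => exact ⟨fun _ => rfl, fun _ => hl⟩
  | cons e l => simpa using hl.1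

/-- The stacks `stk 0, …, stk (n - 1)` are stored in memory: heads in array `42`, links in array
`43`, lines in array `44`, starting points in the real array `42`, next free address in `45`. -/
structure Stacks (σ : Mem) (n : ℕ) (stk : ℕ → List (ℝ × ℕ)) : Prop where
  free_pos : 0 < σ.nat 45 0
  list : ∀ c < n, ListAt (σ.nat 43) (fun i => (σ.real 42 i, σ.nat 44 i)) (σ.nat 45 0)
    (σ.nat 42 c) (stk c)

/-- The value of the line with number `t` at `x`. -/
abbrev lineAt (t : NExp) (x : RExp) : RExp := .add (.read 44 t) (.mul (.read 45 t) x)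

/-- Allocate a node for the line in cell `41` starting at `p` on the stack in cell `40`. -/
def allocNode (p : RExp) : Prog :=
  .setReal 42 (.var 45) p ;;
  .setNat 44 (.var 45) (.var 41) ;;
  .setNat 43 (.var 45) (.read 42 (.var 40)) ;;
  .setNat 42 (.var 40) (.var 45) ;;
  .setNat 45 (.const 0) (.add (.var 45) (.const 1))

/-- Insert the line in cell `41` (coefficients in the real arrays `44`, `45`) into the hull of the
cell in `40`, whose ends are consecutive entries of the real array `43`. -/
def pushProg : Prog :=
  .loop (.and (.natLt (.const 0) (.read 42 (.var 40)))
      (.not (.realLt (lineAt (.var 41) (.read 42 (.read 42 (.var 40))))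
        (lineAt (.read 44 (.read 42 (.var 40))) (.read 42 (.read 42 (.var 40)))))))
    (.setNat 42 (.var 40) (.read 43 (.read 42 (.var 40)))) ;;
  .cond (.natEq (.read 42 (.var 40)) (.const 0))
    (allocNode (.read 43 (.var 40)))
    (.cond (.realLt (lineAt (.read 44 (.read 42 (.var 40))) (.read 43 (.add (.var 40) (.const 1))))
        (lineAt (.var 41) (.read 43 (.add (.var 40) (.const 1)))))
      (allocNode (.div
        (.sub (.read 44 (.read 44 (.read 42 (.var 40)))) (.read 44 (.var 41)))
        (.sub (.read 45 (.var 41)) (.read 45 (.read 44 (.read 42 (.var 40)))))))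
      .skip)

theorem allocNode_spec {σ : Mem} {n c t : ℕ} {stk : ℕ → List (ℝ × ℕ)} (hs : Stacks σ n stk)
    (hcn : c < n) (hc : σ.nat 40 0 = c) (ht : σ.nat 41 0 = t) (p : RExp) :
    Runs (allocNode p) σ fun τ T =>
      Stacks τ n (Function.update stk c ((p.eval σ, t) :: stk c)) ∧ T ≤ p.cost + 60 := by
  simp [allocNode, hc, ht]
  refine ⟨⟨by simp, fun d hd => ?_⟩, by omega⟩
  have hpos := hs.free_pos
  have key : ∀ h l, ListAt (σ.nat 43) (fun i => (σ.real 42 i, σ.nat 44 i)) (σ.nat 45 0) h l →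
      ListAt (Function.update (σ.nat 43) (σ.nat 45 0) (σ.nat 42 c))
        (fun i => (Function.update (σ.real 42) (σ.nat 45 0) (p.eval σ) i,
          Function.update (σ.nat 44) (σ.nat 45 0) t i)) (σ.nat 45 0 + 1) h l := by
    intro h l hl
    refine hl.congr (fun i hi => ?_) (fun i hi => ?_) (Nat.le_succ _)
    · rw [Function.update_of_ne (by omega)]
    · simp only [Function.update_of_ne hi.ne]
  simp
  rcases eq_or_ne d c with rfl | hdc
  · simp only [Function.update_self]
    exact ⟨by omega, by omega, by simp, by simpa using key _ _ (hs.list d hd)⟩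
  · rw [Function.update_of_ne hdc, Function.update_of_ne hdc]
    exact key _ _ (hs.list d hd)

/-- A credit of 100 on every stack entry pays for the iteration that pops it, so an insertion has
constant amortized time. -/
theorem pushProg_spec {σ : Mem} {n c t : ℕ} {stk : ℕ → List (ℝ × ℕ)} (hs : Stacks σ n stk)
    (hcn : c < n) (hc : σ.nat 40 0 = c) (ht : σ.nat 41 0 = t) :
    Runs pushProg σ fun τ T =>
      Stacks τ n (Function.update stk c (push (σ.real 44) (σ.real 45) (σ.real 43 c)
        (σ.real 43 (c + 1)) t (stk c))) ∧
      T + 100 * (push (σ.real 44) (σ.real 45) (σ.real 43 c)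
        (σ.real 43 (c + 1)) t (stk c)).length ≤ 100 * (stk c).length + 400 := by
  simp only [pushProg, runs_seq]
  -- The invariant does not describe how far popping has gone; it says that completing it from the
  -- present stack gives the same result as from the original one.
  refine (runs_loop (α := List (ℝ × ℕ))
    (fun l τ => Stacks τ n (Function.update stk c l) ∧
      pop (σ.real 44) (σ.real 45) t l = pop (σ.real 44) (σ.real 45) t (stk c))
    (fun l => 100 * l.length) (a₀ := stk c) ⟨by simpa using hs, rfl⟩ ?_).mono ?_
  · rintro l τ hf ⟨hI, hp⟩ h
    have e40 : τ.nat 40 0 = c := by rw [hf.nat 40 (by simp [Prog.natWrites]), hc]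
    have e41 : τ.nat 41 0 = t := by rw [hf.nat 41 (by simp [Prog.natWrites]), ht]
    have er : τ.real = σ.real := by
      funext a; exact hf.real a (by simp [Prog.realWrites])
    have hl := hI.list c hcn
    simp only [Function.update_self] at hl
    simp [e40, e41, er] at h
    rcases l with _ | ⟨e, l⟩
    · exact absurd (show τ.nat 42 c = 0 from hl) h.1.ne'
    obtain ⟨h0, h1, rfl, h3⟩ := hl
    simp [e40]
    refine ⟨l, ⟨⟨by simpa using hI.free_pos, fun d hd => ?_⟩, ?_⟩, by omega⟩
    · have := hI.list d hd
      rcases eq_or_ne d c with rfl | hdc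
      · simpa using h3
      · simpa [Function.update_of_ne hdc] using this
    · rw [← hp]
      conv_rhs => rw [pop]
      rw [if_pos]
      simpa [Hull.val, er] using h.2
  · rintro τ T hf ⟨l, ⟨hI, hp⟩, h, hT⟩
    have e40 : τ.nat 40 0 = c := by rw [hf.nat 40 (by simp [Prog.natWrites]), hc]
    have e41 : τ.nat 41 0 = t := by rw [hf.nat 41 (by simp [Prog.natWrites]), ht]
    have er : τ.real = σ.real := by
      funext a; exact hf.real a (by simp [Prog.realWrites])
    have hl := hI.list c hcn
    simp only [Function.update_self] at hl
    simp [e40, e41, er] at h hT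
    have hpop : pop (σ.real 44) (σ.real 45) t l = l := by
      rcases l with _ | ⟨e, l⟩
      · rfl
      obtain ⟨h0, h1, rfl, h3⟩ := hl
      have := h (Nat.pos_of_ne_zero h0)
      rw [pop, if_neg]
      simpa [Hull.val, er] using this
    have hpush : push (σ.real 44) (σ.real 45) (σ.real 43 c) (σ.real 43 (c + 1)) t (stk c) =
        place (σ.real 44) (σ.real 45) (σ.real 43 c) (σ.real 43 (c + 1)) t l := by
      rw [push, ← hp, hpop]
    rw [hpush]
    have halloc := fun p => allocNode_spec hI hcn e40 e41 p
    simp only [Function.update_self, Function.update_idem] at halloc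
    rw [runs_cond]
    rcases l with _ | ⟨e, l⟩
    · have h0 : τ.nat 42 c = 0 := hl
      refine ⟨fun _ => ?_, fun h' => absurd h0 (by simpa [e40] using h')⟩
      refine (halloc _).mono ?_
      rintro ρ T' - ⟨h1, h2⟩
      simp [e40, er] at h1 h2 hT ⊢
      exact ⟨h1, by simp [place]; omega⟩
    · obtain ⟨h0, h1, rfl, h3⟩ := hl
      refine ⟨fun h' => absurd (by simpa [e40] using h') h0, fun _ => ?_⟩
      rw [runs_cond]
      refine ⟨fun hb => ?_, fun hb => ?_⟩
      · simp [e40, e41, er] at hb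
        refine (halloc _).mono ?_
        rintro ρ T' - ⟨h1, h2⟩
        simp [e40, e41, er] at h1 h2 hT ⊢
        rw [place, if_pos (by simpa [Hull.val] using hb)]
        refine ⟨by simpa [crossing, er] using h1, ?_⟩
        simp; omega
      · simp [e40, e41, er] at hb
        simp
        rw [place, if_neg (by simpa [Hull.val] using hb)]
        refine ⟨hI, ?_⟩
        simp at hT ⊢; omega

theorem sum_length_update {β : Type*} (stk : ℕ → List β) {n c : ℕ} (hc : c < n) (l : List β) :
    ∑ d ∈ range n, (Function.update stk c l d).length + (stk c).length =
      ∑ d ∈ range n, (stk d).length + l.length := by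
  have hc' : c ∈ range n := mem_range.2 hc
  rw [← add_sum_erase _ _ hc', ← add_sum_erase (range n) (fun d => (stk d).length) hc']
  rw [sum_congr rfl fun d hd => by rw [Function.update_of_ne (ne_of_mem_erase hd)]]
  simp only [Function.update_self]
  omega

end RealRAM

/-! ## Covering ranges of leaves by dyadic cells -/

namespace RealRAM

open Hull Finset

/-- The first `n` stacks in memory are hulls, over the cells with ends `43`, of the sets `D c` of
lines. -/
structure Hulls (σ : Mem) (n : ℕ) (stk : ℕ → List (ℝ × ℕ)) (D : ℕ → Set ℕ) : Prop where
  stack : Stacks σ n stk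
  hull : ∀ c < n, IsHull (σ.real 44) (σ.real 45) (σ.real 43 c) (σ.real 43 (c + 1)) (D c) (stk c)

/-- The total number of entries of the first `n` lists. -/
abbrev total {β : Type*} (n : ℕ) (stk : ℕ → List β) : ℕ := ∑ c ∈ range n, (stk c).length

theorem Hulls.push {σ : Mem} {n c t : ℕ} {stk : ℕ → List (ℝ × ℕ)} {D : ℕ → Set ℕ}
    (h : Hulls σ n stk D) (hcn : c < n) (hc : σ.nat 40 0 = c) (ht : σ.nat 41 0 = t)
    (hle : σ.real 43 c ≤ σ.real 43 (c + 1)) (hB : ∀ s ∈ D c, σ.real 45 s ≤ σ.real 45 t) :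
    Runs pushProg σ fun τ T => ∃ stk', Hulls τ n stk' (Function.update D c (insert t (D c))) ∧
      T + 100 * total n stk' ≤ 100 * total n stk + 400 ∧ total n stk' ≤ total n stk + 1 := by
  refine (pushProg_spec h.stack hcn hc ht).mono ?_
  rintro τ T hf ⟨hs, hT⟩
  have f43 : τ.real 43 = σ.real 43 := hf.real 43 (by simp [pushProg, allocNode, Prog.realWrites])
  have f44 : τ.real 44 = σ.real 44 := hf.real 44 (by simp [pushProg, allocNode, Prog.realWrites])
  have f45 : τ.real 45 = σ.real 45 := hf.real 45 (by simp [pushProg, allocNode, Prog.realWrites])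
  have hsum := sum_length_update stk hcn
    (Hull.push (σ.real 44) (σ.real 45) (σ.real 43 c) (σ.real 43 (c + 1)) t (stk c))
  have hlen := length_push_le (A := σ.real 44) (B := σ.real 45) (a := σ.real 43 c)
    (b := σ.real 43 (c + 1)) t (stk c)
  have hlen' := (pop_suffix (A := σ.real 44) (B := σ.real 45) t (stk c)).length_le
  refine ⟨_, ⟨hs, fun d hd => ?_⟩, by unfold total; omega, by unfold total; omega⟩
  rw [f43, f44, f45]
  rcases eq_or_ne d c with rfl | hdc
  · simpa using (h.hull d hd).push hle hB
  · simpa [Function.update_of_ne hdc] using h.hull d hd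

/-- Memory in which the first `n` stacks are empty. -/
theorem hulls_empty {σ : Mem} {n : ℕ} (h : ∀ c < n, σ.nat 42 c = 0) (hf : 0 < σ.nat 45 0) :
    Hulls σ n (fun _ => []) (fun _ => ∅) :=
  ⟨⟨hf, fun c hc => h c hc⟩, fun _ _ => isHull_nil⟩

/-- Empty the stacks; their number is in the scalar `b`. -/
def clearStacks (b : ℕ) : Prog :=
  .forTo 40 (.read b (.const 0)) (.setNat 42 (.var 40) (.const 0)) ;;
  .setNat 45 (.const 0) (.const 1)

theorem clearStacks_spec {b n : ℕ} (hb : 45 < b) {σ : Mem} (hn : σ.nat b 0 = n) :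
    Runs (clearStacks b) σ fun τ T => Hulls τ n (fun _ => []) (fun _ => ∅) ∧
      T ≤ 40 * (n + 1) := by
  simp only [clearStacks, runs_seq]
  refine (runs_forTo (fun i ρ => ∀ t < i, ρ.nat 42 t = 0) 20 n
      (by simp [Prog.natWrites]) (by simp [Prog.natWrites]; omega) (by omega) hn
      (by simp) (fun i τ v h => by simpa using h) ?_).mono ?_
  · intro i ρ hi hc _ hI
    simp [hc]
    intro t ht
    rcases Nat.lt_or_ge t i with h | h
    · rw [Function.update_of_ne (by omega)]; exact hI t h
    · obtain rfl : t = i := by omega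
      simp
  · rintro τ T - ⟨hI, -, hT⟩
    simp
    exact ⟨hulls_empty (by simpa using hI) (by simp), by omega⟩

theorem natWrites_pushProg : pushProg.natWrites = [42, 44, 43, 42, 45, 44, 43, 42, 45] := rfl

theorem realWrites_pushProg : pushProg.realWrites = [42, 42] := rfl

/-- If the left end of the range `[47, 48)` of line `41` is odd, push the line there and advance. -/
def emitLeft : Prog :=
  .cond (.and (.natLt (.read 47 (.var 41)) (.read 48 (.var 41)))
      (.natLt (.add (.read 51 (.read 47 (.var 41))) (.read 51 (.read 47 (.var 41))))
        (.read 47 (.var 41))))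
    (.setNat 40 (.const 0) (.read 47 (.var 41)) ;; pushProg ;;
      .setNat 47 (.var 41) (.add (.read 47 (.var 41)) (.const 1))) .skip

/-- If the right end of the range of line `41` is odd, retreat and push the line there. -/
def emitRight : Prog :=
  .cond (.and (.natLt (.read 47 (.var 41)) (.read 48 (.var 41)))
      (.natLt (.add (.read 51 (.read 48 (.var 41))) (.read 51 (.read 48 (.var 41))))
        (.read 48 (.var 41))))
    (.setNat 48 (.var 41) (.sub (.read 48 (.var 41)) (.const 1)) ;;
      .setNat 40 (.const 0) (.read 48 (.var 41)) ;; pushProg) .skip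

/-- Push every line into the cells in which its range exceeds the range of its parent cells, and
halve the ranges. -/
def emitProg : Prog :=
  .forTo 41 (.var 50)
    (emitLeft ;; emitRight ;;
     .setNat 47 (.var 41) (.read 51 (.read 47 (.var 41))) ;;
     .setNat 48 (.var 41) (.read 51 (.read 48 (.var 41))))

/-- Parity is tested with the table of halves: twice the half of `l` is less than `l` exactly when
`l` is odd. -/
theorem emitLeft_spec {σ : Mem} {n t l r : ℕ} {stk : ℕ → List (ℝ × ℕ)} {D : ℕ → Set ℕ}
    (h : Hulls σ n stk D) (ht : σ.nat 41 0 = t) (hl : σ.nat 47 t = l) (hr : σ.nat 48 t = r)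
    (hrn : r ≤ n) (hlr : l ≤ r) (hhalf : σ.nat 51 l = l / 2)
    (hle : ∀ c < n, σ.real 43 c ≤ σ.real 43 (c + 1))
    (hB : ∀ c, ∀ s ∈ D c, σ.real 45 s ≤ σ.real 45 t) :
    Runs emitLeft σ fun τ T => ∃ stk' D', Hulls τ n stk' D' ∧
      (∀ c s, s ∈ D' c ↔ s ∈ D c ∨ (s = t ∧ c = l ∧ l < r ∧ l % 2 = 1)) ∧
      τ.nat 47 = Function.update (σ.nat 47) t (if l < r ∧ l % 2 = 1 then l + 1 else l) ∧
      T + 100 * total n stk' ≤ 100 * total n stk + 500 ∧ total n stk' ≤ total n stk + 1 := by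
  simp only [emitLeft, runs_cond, Test.Holds, NExp.eval, ht, hl, hr, hhalf]
  refine ⟨fun hc => ?_, fun hc => ?_⟩
  · have h2 : l % 2 = 1 := by omega
    simp only [runs_seq, runs_setNat, NExp.eval, ht, hl]
    refine (Hulls.push (n := n) (c := l) (t := t) (stk := stk) (D := D)
      ⟨⟨by simpa using h.stack.free_pos, by simpa using h.stack.list⟩, by simpa using h.hull⟩
      (by omega) (by simp) (by simp [ht]) (by simpa using hle l (by omega))
      (by simpa using hB l)).mono ?_
    rintro τ T hf ⟨stk', hs, hT, hlen⟩
    have e41 : τ.nat 41 0 = t := by rw [hf.nat 41 (by simp [natWrites_pushProg])]; simp [ht]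
    have e47 : τ.nat 47 = σ.nat 47 := by rw [hf.nat 47 (by simp [natWrites_pushProg])]; simp
    simp [e41, e47, hl]
    refine ⟨stk', _, ⟨⟨by simpa using hs.stack.free_pos, by simpa using hs.stack.list⟩,
      by simpa using hs.hull⟩, fun c s => ?_, by simp [hc.1, h2], by omega, by omega⟩
    rcases eq_or_ne c l with rfl | hcl
    · simp [hc.1, h2, or_comm]
    · simp [hcl]
  · have h2 : ¬ (l < r ∧ l % 2 = 1) := by omega
    simp
    refine ⟨stk, D, h, fun c s => ?_, by rw [if_neg h2, hl], by omega, by omega⟩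
    constructor
    · exact .inl
    · rintro (h | ⟨-, -, h⟩)
      · exact h
      · exact absurd h h2

theorem emitRight_spec {σ : Mem} {n t l r : ℕ} {stk : ℕ → List (ℝ × ℕ)} {D : ℕ → Set ℕ}
    (h : Hulls σ n stk D) (ht : σ.nat 41 0 = t) (hl : σ.nat 47 t = l) (hr : σ.nat 48 t = r)
    (hrn : r ≤ n) (hhalf : σ.nat 51 r = r / 2)
    (hle : ∀ c < n, σ.real 43 c ≤ σ.real 43 (c + 1))
    (hB : ∀ c, ∀ s ∈ D c, σ.real 45 s ≤ σ.real 45 t) :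
    Runs emitRight σ fun τ T => ∃ stk' D', Hulls τ n stk' D' ∧
      (∀ c s, s ∈ D' c ↔ s ∈ D c ∨ (s = t ∧ c = r - 1 ∧ l < r ∧ r % 2 = 1)) ∧
      τ.nat 48 = Function.update (σ.nat 48) t (if l < r ∧ r % 2 = 1 then r - 1 else r) ∧
      T + 100 * total n stk' ≤ 100 * total n stk + 500 ∧ total n stk' ≤ total n stk + 1 := by
  simp only [emitRight, runs_cond, Test.Holds, NExp.eval, ht, hl, hr, hhalf]
  refine ⟨fun hc => ?_, fun hc => ?_⟩
  · have h2 : r % 2 = 1 := by omega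
    simp [ht, hr]
    refine (Hulls.push (n := n) (c := r - 1) (t := t) (stk := stk) (D := D)
      ⟨⟨by simpa using h.stack.free_pos, by simpa using h.stack.list⟩, by simpa using h.hull⟩
      (by omega) (by simp) (by simp [ht]) (by simpa using hle (r - 1) (by omega))
      (by simpa using hB (r - 1))).mono ?_
    rintro τ T hf ⟨stk', hs, hT, hlen⟩
    have e48 : τ.nat 48 = Function.update (σ.nat 48) t (r - 1) := by
      rw [hf.nat 48 (by simp [natWrites_pushProg])]; simp
    refine ⟨stk', _, hs, fun c s => ?_, by simp [e48, hc.1, h2], by omega, by omega⟩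
    rcases eq_or_ne c (r - 1) with rfl | hcl
    · simp [hc.1, h2, or_comm]
    · simp [hcl]
  · have h2 : ¬ (l < r ∧ r % 2 = 1) := by omega
    simp
    refine ⟨stk, D, h, fun c s => ?_, by rw [if_neg h2, hr], by omega, by omega⟩
    constructor
    · exact .inl
    · rintro (h | ⟨-, -, h⟩)
      · exact h
      · exact absurd h h2

/-- The ranges `[l, r)` of cells are covered by the cells `c` with `s ∈ D c` and by the halved
ranges `[l', r')`. -/
structure Emitted (n i : ℕ) (l r l' r' : ℕ → ℕ) (D : ℕ → Set ℕ) : Prop where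
  mem : ∀ c, ∀ s ∈ D c, s < i ∧ l s ≤ c ∧ c < r s
  cover : ∀ s < i, ∀ c, l s ≤ c → c < r s → s ∈ D c ∨ (l' s ≤ c / 2 ∧ c / 2 < r' s)
  sub : ∀ s < i, ∀ c, l' s ≤ c / 2 → c / 2 < r' s → l s ≤ c ∧ c < r s
  le : ∀ s < i, l' s ≤ r' s ∧ r' s ≤ n / 2

/-- An odd left end is a right child whose parent sticks out of the range, and an odd right end
(exclusive) leaves a left child with the same defect. Once these cells are split off, both ends of a
nonempty remaining range are even, and the halved range describes the same leaves one level up. So a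
line is pushed at most twice per level. The number of cells need not be a power of two: an unpaired
last cell is split off from any nonempty range reaching it. The lines come in order of slope, as the
hulls require. -/
theorem emitProg_spec {σ : Mem} {n S : ℕ} (h : Hulls σ n (fun _ => []) (fun _ => ∅))
    (hS : σ.nat 50 0 = S) (hhalf : ∀ j ≤ n, σ.nat 51 j = j / 2)
    (hlr : ∀ t < S, σ.nat 47 t ≤ σ.nat 48 t ∧ σ.nat 48 t ≤ n)
    (hle : ∀ c < n, σ.real 43 c ≤ σ.real 43 (c + 1))
    (hB : ∀ s t, s ≤ t → t < S → σ.real 45 s ≤ σ.real 45 t) :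
    Runs emitProg σ fun τ T => ∃ stk D, Hulls τ n stk D ∧
      Emitted n S (σ.nat 47) (σ.nat 48) (τ.nat 47) (τ.nat 48) D ∧
      total n stk ≤ 2 * S ∧ T ≤ 1200 * (S + 1) := by
  unfold emitProg
  refine (runs_forTo_amortized (α := (ℕ → List (ℝ × ℕ)) × (ℕ → Set ℕ))
    (fun i a τ => Hulls τ n a.1 a.2 ∧
      Emitted n i (σ.nat 47) (σ.nat 48) (τ.nat 47) (τ.nat 48) a.2 ∧
      (∀ s, i ≤ s → τ.nat 47 s = σ.nat 47 s ∧ τ.nat 48 s = σ.nat 48 s) ∧ total n a.1 ≤ 2 * i)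
    (fun _ a => 100 * total n a.1) 1100 S (a₀ := (fun _ => [], fun _ => ∅))
    (by decide) (by decide) (by decide) hS ?_ ?_ ?_).mono ?_
  · exact ⟨h, ⟨by simp, by simp, by simp, by simp⟩, by simp, by simp [total]⟩
  · rintro i a τ v ⟨h1, h2, h3, h4⟩
    exact ⟨⟨⟨by simpa using h1.stack.free_pos, by simpa using h1.stack.list⟩,
      by simpa using h1.hull⟩, by simpa using h2, by simpa using h3, h4⟩
  · rintro i ⟨stk, D⟩ τ hi hci hf ⟨h1, h2, h3, h4⟩
    dsimp only at h1 h2 h4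
    have e51 : τ.nat 51 = σ.nat 51 := hf.nat 51 (by decide)
    have e43 : τ.real 43 = σ.real 43 := hf.real 43 (by decide)
    have e45 : τ.real 45 = σ.real 45 := hf.real 45 (by decide)
    obtain ⟨el, er⟩ := h3 i le_rfl
    obtain ⟨hlri, hrn⟩ := hlr i hi
    set l := σ.nat 47 i with hl
    set r := σ.nat 48 i with hr
    rw [runs_seq]
    refine (emitLeft_spec h1 hci el er hrn hlri (by rw [e51]; exact hhalf l (by omega))
      (by simpa [e43] using hle) ?_).mono ?_
    · intro c s hs
      rw [e45]
      exact hB s i (h2.mem c s hs).1.le hi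
    rintro τ₁ T₁ hf₁ ⟨stk₁, D₁, hh₁, hD₁, h47, hT₁, hlen₁⟩
    have a41 : τ₁.nat 41 0 = i := by rw [hf₁.nat 41 (by decide), hci]
    have a48 : τ₁.nat 48 = τ.nat 48 := hf₁.nat 48 (by decide)
    have a51 : τ₁.nat 51 = σ.nat 51 := by rw [hf₁.nat 51 (by decide), e51]
    have a43 : τ₁.real 43 = σ.real 43 := by rw [hf₁.real 43 (by decide), e43]
    have a45 : τ₁.real 45 = σ.real 45 := by rw [hf₁.real 45 (by decide), e45]
    set l₁ := if l < r ∧ l % 2 = 1 then l + 1 else l with hl₁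
    have hl₁r : l₁ ≤ r := by rw [hl₁]; split_ifs <;> omega
    rw [runs_seq]
    refine (emitRight_spec (l := l₁) hh₁ a41 (by rw [h47]; simp) (by rw [a48]; exact er) hrn
      (by rw [a51]; exact hhalf r (by omega)) (by simpa [a43] using hle) ?_).mono ?_
    · intro c s hs
      rw [a45]
      rcases (hD₁ c s).1 hs with hs | ⟨rfl, -⟩
      · exact hB s i (h2.mem c s hs).1.le hi
      · exact le_rfl
    rintro τ₂ T₂ hf₂ ⟨stk₂, D₂, hh₂, hD₂, h48, hT₂, hlen₂⟩
    have b41 : τ₂.nat 41 0 = i := by rw [hf₂.nat 41 (by decide), a41]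
    have b47 : τ₂.nat 47 = Function.update (τ.nat 47) i l₁ := by rw [hf₂.nat 47 (by decide), h47]
    have b51 : τ₂.nat 51 = σ.nat 51 := by rw [hf₂.nat 51 (by decide), a51]
    set r₁ := if l₁ < r ∧ r % 2 = 1 then r - 1 else r with hr₁
    have hl₁r₁ : l₁ ≤ r₁ ∧ r₁ ≤ r := by rw [hr₁]; split_ifs <;> omega
    simp [b41, b47, b51, h48, a48, hhalf l₁ (by omega), hhalf r₁ (by omega)]
    refine ⟨stk₂, ⟨D₂, ⟨⟨by simpa using hh₂.stack.free_pos, by simpa using hh₂.stack.list⟩,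
      by simpa using hh₂.hull⟩, ⟨?_, ?_, ?_, ?_⟩, ?_, by omega⟩, by omega⟩
    · intro c s hs
      rw [hD₂, hD₁] at hs
      rcases hs with (hs | ⟨rfl, rfl, h5, h6⟩) | ⟨rfl, rfl, h5, h6⟩
      · have := h2.mem c s hs
        exact ⟨by omega, this.2⟩
      · exact ⟨by omega, le_rfl, h5⟩
      · refine ⟨by omega, ?_, ?_⟩
        · have : l ≤ l₁ := by rw [hl₁]; split_ifs <;> omega
          omega
        · omega
    · intro s hs c hc1 hc2
      rw [hD₂, hD₁]
      rcases Nat.lt_or_ge s i with h | h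
      · rw [Function.update_of_ne h.ne, Function.update_of_ne h.ne]
        rcases h2.cover s h c hc1 hc2 with h | h
        · exact .inl (.inl (.inl h))
        · exact .inr h
      · obtain rfl : s = i := by omega
        rw [Function.update_self, Function.update_self]
        rw [← hl] at hc1
        rw [← hr] at hc2
        -- A cell of the range is split off on the left, split off on the right, or has its parent
        -- in the halved range.
        by_cases hx : c = l ∧ l % 2 = 1
        · exact .inl (.inl (.inr ⟨rfl, hx.1, by omega, hx.2⟩))
        · by_cases hy : c = r - 1 ∧ l₁ < r ∧ r % 2 = 1
          · exact .inl (.inr ⟨rfl, hy⟩)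
          · right
            rw [hr₁, hl₁]
            rw [hl₁] at hy
            split_ifs at hy ⊢ <;> omega
    · intro s hs c
      rcases Nat.lt_or_ge s i with h | h
      · rw [Function.update_of_ne h.ne, Function.update_of_ne h.ne]
        exact h2.sub s h c
      · obtain rfl : s = i := by omega
        rw [Function.update_self, Function.update_self, ← hl, ← hr]
        intro h5 h6
        rw [hl₁] at h5
        rw [hr₁] at h6
        rw [hl₁] at h6
        split_ifs at h5 h6 <;> omega
    · intro s hs
      rcases Nat.lt_or_ge s i with h | h
      · rw [Function.update_of_ne h.ne, Function.update_of_ne h.ne]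
        exact h2.le s h
      · obtain rfl : s = i := by omega
        rw [Function.update_self, Function.update_self]
        omega
    · intro s hs
      rw [Function.update_of_ne (by omega), Function.update_of_ne (by omega)]
      exact h3 s (by omega)
  · rintro τ T - ⟨⟨stk, D⟩, ⟨h1, h2, -, h4⟩, -, hT⟩
    refine ⟨stk, D, h1, h2, h4, ?_⟩
    have : total n (fun _ => ([] : List (ℝ × ℕ))) = 0 := by simp [total]
    simp only [this] at hT
    omega

end RealRAM

/-! ## Distributing the pieces of the hulls of all cells to the leaves -/

namespace RealRAM

open Hull Finset

/-- For every line `t < S`, the list of the leaves it has been assigned to is stored in memory. -/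
structure Incidences (σ : Mem) (S : ℕ) (inc : ℕ → List ℕ) : Prop where
  free_pos : 0 < σ.nat 55 0
  list : ∀ t < S, ListAt (σ.nat 53) (σ.nat 54) (σ.nat 55 0) (σ.nat 52 t) (inc t)

/-- Assign the line of node `57` to the leaf before `56`. -/
def recordProg : Prog :=
  .setNat 53 (.var 55) (.read 52 (.read 44 (.var 57))) ;;
  .setNat 54 (.var 55) (.sub (.var 56) (.const 1)) ;;
  .setNat 52 (.read 44 (.var 57)) (.var 55) ;;
  .setNat 55 (.const 0) (.add (.var 55) (.const 1))

/-- Walk down the stack of cell `40` and through its leaves, from right to left, and assign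
the line of every piece to the leaves that the piece meets. -/
def walkCell : Prog :=
  .setNat 56 (.const 0) (.read 46 (.add (.var 40) (.const 1))) ;;
  .setNat 57 (.const 0) (.read 42 (.var 40)) ;;
  .loop (.and (.natLt (.read 46 (.var 40)) (.var 56)) (.natLt (.const 0) (.var 57)))
    (recordProg ;;
     .cond (.realLt (.read 46 (.sub (.var 56) (.const 1))) (.read 42 (.var 57)))
      (.setNat 57 (.const 0) (.read 43 (.var 57)))
      (.setNat 56 (.const 0) (.sub (.var 56) (.const 1))))

theorem recordProg_spec {σ : Mem} {S p t m : ℕ} {inc : ℕ → List ℕ} (h : Incidences σ S inc)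
    (hp : σ.nat 57 0 = p) (ht : σ.nat 44 p = t) (htS : t < S) (hm : σ.nat 56 0 = m) :
    Runs recordProg σ fun τ T =>
      Incidences τ S (Function.update inc t ((m - 1) :: inc t)) ∧ T ≤ 40 := by
  simp [recordProg, hp, ht, hm]
  refine ⟨by simp, fun d hd => ?_⟩
  have hpos := h.free_pos
  have key : ∀ h l, ListAt (σ.nat 53) (σ.nat 54) (σ.nat 55 0) h l →
      ListAt (Function.update (σ.nat 53) (σ.nat 55 0) (σ.nat 52 t))
        (Function.update (σ.nat 54) (σ.nat 55 0) (m - 1)) (σ.nat 55 0 + 1) h l := by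
    intro h l hl
    refine hl.congr (fun i hi => ?_) (fun i hi => ?_) (Nat.le_succ _) <;>
    rw [Function.update_of_ne (by omega)]
  simp
  rcases eq_or_ne d t with rfl | hdc
  · simp only [Function.update_self]
    exact ⟨by omega, by omega, by simp, by simpa using key _ _ (h.list d hd)⟩
  · rw [Function.update_of_ne hdc, Function.update_of_ne hdc]
    exact key _ _ (h.list d hd)

/-- Some line assigned to leaf `j` is at least `y` at `x`. -/
def Reached (A B : ℕ → ℝ) (S : ℕ) (inc : ℕ → List ℕ) (j : ℕ) (y x : ℝ) : Prop :=
  ∃ t < S, j ∈ inc t ∧ y ≤ val A B t x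

theorem Reached.mono {A B : ℕ → ℝ} {S j : ℕ} {inc inc' : ℕ → List ℕ} {y x : ℝ}
    (hi : ∀ t, inc t ⊆ inc' t) (h : Reached A B S inc j y x) : Reached A B S inc' j y x := by
  obtain ⟨t, h1, h2, h3⟩ := h
  exact ⟨t, h1, hi t h2, h3⟩

/-- State of the walk over the leaves `[u, v)` with the hull `stk`: leaves from `m` on are done,
`l` is the rest of the stack. -/
structure WalkState (A B X : ℕ → ℝ) (S u v m : ℕ) (D : Set ℕ) (stk l : List (ℝ × ℕ))
    (inc₀ inc : ℕ → List ℕ) : Prop where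
  le_m : u ≤ m
  m_le : m ≤ v
  suffix : l <:+ stk
  new : ∀ t, ∀ j ∈ inc t, j ∈ inc₀ t ∨ (t ∈ D ∧ u ≤ j ∧ j < v)
  old : ∀ t, inc₀ t ⊆ inc t
  left : u < m → ∀ y x, x ≤ X (m - 1) → Below A B y x stk → Below A B y x l
  here : u < m → ∀ y x, X (m - 1) ≤ x → x ≤ X m → Below A B y x stk →
    Below A B y x l ∨ Reached A B S inc (m - 1) y x
  done : ∀ j, m ≤ j → j < v → ∀ y x, X j ≤ x → x ≤ X (j + 1) → Below A B y x stk →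
    Reached A B S inc j y x
  total : total S inc + l.length + (m - u) = total S inc₀ + stk.length + (v - u)

theorem subset_update_cons (inc : ℕ → List ℕ) (t j s : ℕ) :
    inc s ⊆ Function.update inc t (j :: inc t) s := by
  rcases eq_or_ne s t with rfl | h
  · simp
  · simp [h]

theorem mem_update_cons {inc : ℕ → List ℕ} {t j s i : ℕ}
    (h : i ∈ Function.update inc t (j :: inc t) s) : i ∈ inc s ∨ (s = t ∧ i = j) := by
  rcases eq_or_ne s t with rfl | h'
  · simp at h; tauto
  · simp [h'] at h; exact .inl h

section

variable {A B X : ℕ → ℝ} {S u v m : ℕ} {D : Set ℕ} {stk l : List (ℝ × ℕ)} {e : ℝ × ℕ}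
  {inc₀ inc : ℕ → List ℕ}

/-- The piece `e` starts to the right of the left end of leaf `m - 1`, so it is irrelevant for all
leaves further left; what it contributes to the present leaf is recorded before it is dropped. -/
theorem WalkState.down (h : WalkState A B X S u v m D stk (e :: l) inc₀ inc) (hm : u < m)
    (he : e.2 < S) (heD : e.2 ∈ D) (hlt : X (m - 1) < e.1) :
    WalkState A B X S u v m D stk l inc₀
      (Function.update inc e.2 ((m - 1) :: inc e.2)) := by
  have h1 := h.m_le
  have h2 := h.total
  have h3 := sum_length_update inc he ((m - 1) :: inc e.2)
  refine ⟨h.le_m, h.m_le, (List.suffix_cons e l).trans h.suffix, fun t j hj => ?_,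
    fun t => List.Subset.trans (h.old t) (subset_update_cons _ _ _ _), fun _ y x hx hb => ?_,
    fun _ y x hx1 hx2 hb => ?_, fun j hj1 hj2 y x hx1 hx2 hb =>
      (h.done j hj1 hj2 y x hx1 hx2 hb).mono (subset_update_cons _ _ _), ?_⟩
  · rcases mem_update_cons hj with hj | ⟨rfl, rfl⟩
    · exact h.new t j hj
    · exact .inr ⟨heD, by omega, by omega⟩
  · rcases h.left hm y x hx hb with h' | h'
    · linarith [h'.1]
    · exact h'.2
  · rcases h.here hm y x hx1 hx2 hb with (h' | h') | h'
    · exact .inr ⟨e.2, he, by simp, h'.2⟩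
    · exact .inl h'.2
    · exact .inr (h'.mono (subset_update_cons _ _ _))
  · simp only [List.length_cons, RealRAM.total] at h2 h3 ⊢
    omega

/-- The piece `e` reaches back to the left end of leaf `m - 1`, so with `e` recorded this leaf is
complete; `e` stays on top for the next leaf. -/
theorem WalkState.next (h : WalkState A B X S u v m D stk (e :: l) inc₀ inc) (hm : u < m)
    (he : e.2 < S) (heD : e.2 ∈ D) (hlt : e.1 ≤ X (m - 1))
    (hX : ∀ j, j < v → X j ≤ X (j + 1)) :
    WalkState A B X S u v (m - 1) D stk (e :: l) inc₀
      (Function.update inc e.2 ((m - 1) :: inc e.2)) := by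
  have h1 := h.m_le
  have h2 := h.total
  have h3 := sum_length_update inc he ((m - 1) :: inc e.2)
  refine ⟨by omega, by omega, h.suffix, fun t j hj => ?_,
    fun t => List.Subset.trans (h.old t) (subset_update_cons _ _ _ _), fun hm' y x hx hb => ?_,
    fun hm' y x hx1 hx2 hb => .inl (h.left hm y x hx2 hb), fun j hj1 hj2 y x hx1 hx2 hb => ?_, ?_⟩
  · rcases mem_update_cons hj with hj | ⟨rfl, rfl⟩
    · exact h.new t j hj
    · exact .inr ⟨heD, by omega, by omega⟩
  · refine h.left hm y x (hx.trans ?_) hb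
    have := hX (m - 1 - 1) (by omega)
    rwa [show m - 1 - 1 + 1 = m - 1 by omega] at this
  · rcases Nat.lt_or_ge j m with hj | hj
    · obtain rfl : j = m - 1 := by omega
      rw [show m - 1 + 1 = m by omega] at hx2
      rcases h.here hm y x hx1 hx2 hb with (h' | h') | h'
      · exact ⟨e.2, he, by simp, h'.2⟩
      · linarith [h'.1]
      · exact h'.mono (subset_update_cons _ _ _)
    · exact (h.done j hj hj2 y x hx1 hx2 hb).mono (subset_update_cons _ _ _)
  · simp only [List.length_cons, RealRAM.total] at h2 h3 ⊢
    omega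

theorem WalkState.finish (h : WalkState A B X S u v m D stk l inc₀ inc) (hml : u < m → l = [])
    (hX : ∀ i j, i ≤ j → j ≤ v → X i ≤ X j) {j : ℕ} (hj1 : u ≤ j) (hj2 : j < v) {y x : ℝ}
    (hx1 : X j ≤ x) (hx2 : x ≤ X (j + 1)) (hb : Below A B y x stk) :
    Reached A B S inc j y x := by
  rcases Nat.lt_or_ge j m with hj | hj
  · have hl := hml (by omega)
    rw [hl] at h
    have hmv := h.m_le
    rcases Nat.lt_or_ge j (m - 1) with hj' | hj'
    · exact (h.left (by omega) y x (hx2.trans (hX _ _ (by omega) (by omega))) hb).elim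
    · obtain rfl : j = m - 1 := by omega
      rw [show m - 1 + 1 = m by omega] at hx2
      exact (h.here (by omega) y x hx1 hx2 hb).resolve_left id
  · exact h.done j hj hj2 y x hx1 hx2 hb

end

/-- As in a merge of two sorted lists, every recorded incidence is followed by giving up either a
piece or a leaf. Hence there are at most as many incidences as pieces and leaves together, although
a piece may meet many leaves and a leaf many pieces. -/
theorem walkCell_spec {σ : Mem} {n S c u v : ℕ} {stk : ℕ → List (ℝ × ℕ)} {D : ℕ → Set ℕ}
    {inc : ℕ → List ℕ} (h : Hulls σ n stk D) (hcn : c < n) (hc : σ.nat 40 0 = c)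
    (hD : ∀ t ∈ D c, t < S) (hi : Incidences σ S inc)
    (hu : σ.nat 46 c = u) (hv : σ.nat 46 (c + 1) = v) (huv : u ≤ v)
    (hcu : σ.real 43 c = σ.real 46 u) (hcv : σ.real 43 (c + 1) = σ.real 46 v)
    (hX : ∀ i j, i ≤ j → j ≤ v → σ.real 46 i ≤ σ.real 46 j) :
    Runs walkCell σ fun τ T => ∃ inc', Incidences τ S inc' ∧
      (∀ t, ∀ j ∈ inc' t, j ∈ inc t ∨ (t ∈ D c ∧ u ≤ j ∧ j < v)) ∧
      (∀ t, inc t ⊆ inc' t) ∧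
      (∀ s ∈ D c, ∀ j, u ≤ j → j < v → ∀ x, σ.real 46 j ≤ x → x ≤ σ.real 46 (j + 1) →
        Reached (σ.real 44) (σ.real 45) S inc' j (val (σ.real 44) (σ.real 45) s x) x) ∧
      total S inc' ≤ total S inc + (stk c).length + (v - u) ∧
      T ≤ 100 * ((stk c).length + (v - u)) + 100 := by
  simp only [walkCell, runs_seq, runs_setNat, NExp.eval, NExp.cost]
  have hull := h.hull c hcn
  refine (runs_loop (α := List (ℝ × ℕ) × ℕ × (ℕ → List ℕ))
    (fun a τ => WalkState (σ.real 44) (σ.real 45) (σ.real 46) S u v a.2.1 (D c) (stk c) a.1 inc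
        a.2.2 ∧ Incidences τ S a.2.2 ∧ τ.nat 56 0 = a.2.1 ∧
        ListAt (σ.nat 43) (fun i => (σ.real 42 i, σ.nat 44 i)) (σ.nat 45 0) (τ.nat 57 0) a.1)
    (fun a => 80 * (a.1.length + (a.2.1 - u))) (a₀ := (stk c, v, inc)) ?_ ?_).mono ?_
  · refine ⟨⟨huv, le_rfl, List.suffix_rfl, fun t j hj => .inl hj, fun t => List.Subset.refl _,
      fun _ y x _ hb => hb, fun _ y x _ _ hb => .inl hb, fun j h1 h2 => absurd h2 (not_lt.2 h1),
      rfl⟩, ⟨by simpa using hi.free_pos, by simpa using hi.list⟩, by simp [hc, hv],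
      by simpa [hc] using h.stack.list c hcn⟩
  · rintro ⟨l, m, inc'⟩ τ hf ⟨hw, hI, h56, hl⟩ ht
    have e40 : τ.nat 40 0 = c := by rw [hf.nat 40 (by decide)]; simp [hc]
    have e46 : τ.nat 46 = σ.nat 46 := by rw [hf.nat 46 (by decide)]; simp
    have e43 : τ.nat 43 = σ.nat 43 := by rw [hf.nat 43 (by decide)]; simp
    have e44 : τ.nat 44 = σ.nat 44 := by rw [hf.nat 44 (by decide)]; simp
    have er : τ.real = σ.real := by
      funext a; exact hf.real a (by simp [Prog.realWrites, recordProg])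
    dsimp only at hw hI h56 hl
    simp [e40, e46, hu, h56] at ht
    rcases l with _ | ⟨e, l⟩
    · exact absurd (show τ.nat 57 0 = 0 from hl) ht.2.ne'
    have heD := hull.mem e (hw.suffix.subset (by simp))
    obtain ⟨h0, h1, rfl, h3⟩ := hl
    rw [runs_seq]
    refine (recordProg_spec hI rfl (by rw [e44]) (hD _ heD) h56).mono ?_
    rintro τ₁ T₁ hf₁ ⟨hI₁, hT₁⟩
    have a56 : τ₁.nat 56 0 = m := by rw [hf₁.nat 56 (by decide), h56]
    have a57 : τ₁.nat 57 0 = τ.nat 57 0 := by rw [hf₁.nat 57 (by decide)]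
    have a43 : τ₁.nat 43 = σ.nat 43 := by rw [hf₁.nat 43 (by decide), e43]
    have ar : τ₁.real = σ.real := by
      rw [← er]; funext a; exact hf₁.real a (by simp [Prog.realWrites, recordProg])
    rw [runs_cond]
    refine ⟨fun hb => ?_, fun hb => ?_⟩
    · simp [ar, a56, a57] at hb
      simp [a56, a57, a43]
      refine ⟨l, ⟨_, hw.down ht.1 (hD _ heD) heD hb, ⟨by simpa using hI₁.free_pos,
        by simpa using hI₁.list⟩, h3⟩, by omega⟩
    · simp [ar, a56, a57] at hb
      simp [a57, a56]
      refine ⟨_ :: l, ⟨_, hw.next ht.1 (hD _ heD) heD hb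
        (fun j hj => hX _ _ (Nat.le_succ j) hj), ⟨by simpa using hI₁.free_pos,
        by simpa using hI₁.list⟩, h0, h1, rfl, h3⟩, by simp; omega⟩
  · rintro τ T hf ⟨⟨l, m, inc'⟩, ⟨hw, hI, h56, hl⟩, ht, hT⟩
    dsimp only at hw hI h56 hl hT
    have e40 : τ.nat 40 0 = c := by rw [hf.nat 40 (by decide)]; simp [hc]
    have e46 : τ.nat 46 = σ.nat 46 := by rw [hf.nat 46 (by decide)]; simp
    simp [e40, e46, hu, h56] at ht
    have htot := hw.total
    refine ⟨inc', hI, hw.new, hw.old, fun s hs j hj1 hj2 x hx1 hx2 => ?_, by omega, ?_⟩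
    · refine hw.finish (fun hm => hl.eq_nil_iff.1 (ht hm)) hX hj1 hj2 hx1 hx2
        (hull.below s hs x ?_ ?_)
      · rw [hcu]; exact (hX _ _ hj1 (by omega)).trans hx1
      · rw [hcv]; exact hx2.trans (hX _ _ (by omega) le_rfl)
    · simp at hT
      omega

/-- Walk through all cells; their number is in `49`. -/
def walkProg : Prog := .forTo 40 (.var 49) walkCell

/-- The cells of one level have disjoint leaf ranges, so the bounds of the single cells add up to
the number of pieces plus the number of leaves. -/
theorem walkProg_spec {σ : Mem} {n S : ℕ} {stk : ℕ → List (ℝ × ℕ)} {D : ℕ → Set ℕ}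
    {inc : ℕ → List ℕ} (h : Hulls σ n stk D) (hn : σ.nat 49 0 = n)
    (hD : ∀ c, ∀ t ∈ D c, t < S) (hi : Incidences σ S inc)
    (hs : ∀ c < n, σ.nat 46 c ≤ σ.nat 46 (c + 1)) (hs' : ∀ c ≤ n, σ.nat 46 c ≤ σ.nat 46 n)
    (hc : ∀ c ≤ n, σ.real 43 c = σ.real 46 (σ.nat 46 c))
    (hX : ∀ i j, i ≤ j → j ≤ σ.nat 46 n → σ.real 46 i ≤ σ.real 46 j) :
    Runs walkProg σ fun τ T => ∃ inc', Incidences τ S inc' ∧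
      (∀ t, ∀ j ∈ inc' t, j ∈ inc t ∨ ∃ c < n, t ∈ D c ∧ σ.nat 46 c ≤ j ∧ j < σ.nat 46 (c + 1)) ∧
      (∀ t, inc t ⊆ inc' t) ∧
      (∀ c < n, ∀ s ∈ D c, ∀ j, σ.nat 46 c ≤ j → j < σ.nat 46 (c + 1) →
        ∀ x, σ.real 46 j ≤ x → x ≤ σ.real 46 (j + 1) →
        Reached (σ.real 44) (σ.real 45) S inc' j (val (σ.real 44) (σ.real 45) s x) x) ∧
      total S inc' ≤ total S inc + total n stk + (σ.nat 46 n - σ.nat 46 0) ∧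
      T ≤ 100 * (total n stk + σ.nat 46 n) + 200 * n + 10 := by
  unfold walkProg
  refine (runs_forTo_amortized (α := ℕ → List ℕ)
    (fun i inc' τ => Incidences τ S inc' ∧
      (∀ t, ∀ j ∈ inc' t, j ∈ inc t ∨ ∃ c < i, t ∈ D c ∧ σ.nat 46 c ≤ j ∧ j < σ.nat 46 (c + 1)) ∧
      (∀ t, inc t ⊆ inc' t) ∧
      (∀ c < i, ∀ s ∈ D c, ∀ j, σ.nat 46 c ≤ j → j < σ.nat 46 (c + 1) →
        ∀ x, σ.real 46 j ≤ x → x ≤ σ.real 46 (j + 1) →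
        Reached (σ.real 44) (σ.real 45) S inc' j (val (σ.real 44) (σ.real 45) s x) x) ∧
      total S inc' + ∑ c ∈ Ico i n, (stk c).length + (σ.nat 46 n - σ.nat 46 i) ≤
        total S inc + total n stk + (σ.nat 46 n - σ.nat 46 0))
    (fun i _ => 100 * (∑ c ∈ Ico i n, (stk c).length + (σ.nat 46 n - σ.nat 46 i))) 100 n (a₀ := inc)
    (by decide) (by decide) (by decide) hn ?_ ?_ ?_).mono ?_
  · exact ⟨hi, fun t j hj => .inl hj, fun t => List.Subset.refl _, by simp,
      by simp only [total, range_eq_Ico]; exact le_rfl⟩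
  · rintro i inc' τ v ⟨h1, h2⟩
    exact ⟨⟨by simpa using h1.free_pos, by simpa using h1.list⟩, h2⟩
  · rintro i inc' τ hin hci hf ⟨h1, h2, h3, h4, h5⟩
    have e42 : τ.nat 42 = σ.nat 42 := hf.nat 42 (by decide)
    have e43 : τ.nat 43 = σ.nat 43 := hf.nat 43 (by decide)
    have e44 : τ.nat 44 = σ.nat 44 := hf.nat 44 (by decide)
    have e45 : τ.nat 45 = σ.nat 45 := hf.nat 45 (by decide)
    have e46 : τ.nat 46 = σ.nat 46 := hf.nat 46 (by decide)
    have er : τ.real = σ.real := by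
      funext a; exact hf.real a (by simp [Prog.realWrites, walkCell, recordProg])
    have hi1 := hs i hin
    have hi2 := hs' (i + 1) hin
    refine (walkCell_spec (n := n) (stk := stk) (D := D) (inc := inc') (u := σ.nat 46 i)
      (v := σ.nat 46 (i + 1)) ⟨⟨by simpa [e45] using h.stack.free_pos,
      by simpa [e42, e43, e44, e45, er] using h.stack.list⟩, by simpa [er] using h.hull⟩ hin hci
      (hD i) h1 (by rw [e46]) (by rw [e46]) hi1 (by rw [er]; exact hc i hin.le)
      (by rw [er]; exact hc (i + 1) hin)
      (by rw [er]; exact fun a b hab hb => hX a b hab (hb.trans hi2))).mono ?_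
    rintro ρ T hfr ⟨inc₁, g1, g2, g3, g4, g5, g6⟩
    rw [er] at g4
    have hsum := sum_eq_sum_Ico_succ_bot hin fun c => (stk c).length
    refine ⟨inc₁, ⟨g1, fun t j hj => ?_, fun t => List.Subset.trans (h3 t) (g3 t), fun c hci s hs j hj1 hj2 => ?_,
      ?_⟩, ?_⟩
    · rcases g2 t j hj with hj | hj
      · rcases h2 t j hj with hj | ⟨c, hc, hj⟩
        · exact .inl hj
        · exact .inr ⟨c, by omega, hj⟩
      · exact .inr ⟨i, by omega, hj⟩
    · rcases Nat.lt_or_ge c i with hc' | hc'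
      · exact fun x hx1 hx2 => (h4 c hc' s hs j hj1 hj2 x hx1 hx2).mono g3
      · obtain rfl : c = i := by omega
        exact g4 s hs j hj1 hj2
    · omega
    · omega
  · rintro τ T - ⟨inc', ⟨h1, h2, h3, h4, h5⟩, -, hT⟩
    refine ⟨inc', h1, h2, h3, h4, by simpa using h5, ?_⟩
    have : (∑ c ∈ Ico 0 n, (stk c).length) = total n stk := by rw [total, range_eq_Ico]
    rw [this] at hT
    omega

end RealRAM

/-! ### Running through the dyadic levels -/

namespace RealRAM

open Hull Finset

/-- Process the cells of the current level and pass to cells of the double width. -/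
def levelProg : Prog :=
  clearStacks 49 ;; emitProg ;; walkProg ;;
  .setNat 49 (.const 0) (.read 51 (.var 49)) ;;
  .setNat 58 (.const 0) (.add (.var 49) (.const 1)) ;;
  .forTo 40 (.var 58)
    (.setReal 43 (.var 40) (.read 43 (.add (.var 40) (.var 40))) ;;
     .setNat 46 (.var 40) (.read 46 (.add (.var 40) (.var 40))))

/-- The memory after `k` levels: the cells have width `2 ^ k`, and `inc` lists the leaves that have
been assigned to the lines so far. -/
structure LevelState (A B X : ℕ → ℝ) (Q S : ℕ) (l r : ℕ → ℕ) (σ : Mem) (k : ℕ)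
    (inc : ℕ → List ℕ) : Prop where
  num : σ.nat 49 0 = Q / 2 ^ k
  size : σ.nat 50 0 = S
  half : ∀ j ≤ Q, σ.nat 51 j = j / 2
  const : σ.real 44 = A
  slope : σ.real 45 = B
  bounds : σ.real 46 = X
  start : ∀ c ≤ Q / 2 ^ k, σ.nat 46 c = c * 2 ^ k ∧ σ.real 43 c = X (c * 2 ^ k)
  range : ∀ t < S, σ.nat 47 t ≤ σ.nat 48 t ∧ σ.nat 48 t ≤ Q / 2 ^ k
  stored : Incidences σ S inc
  sound : ∀ t, ∀ j ∈ inc t, l t ≤ j ∧ j < r t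
  sub : ∀ t < S, ∀ j, σ.nat 47 t ≤ j / 2 ^ k → j / 2 ^ k < σ.nat 48 t → l t ≤ j ∧ j < r t
  cover : ∀ t < S, ∀ j, l t ≤ j → j < r t →
    (σ.nat 47 t ≤ j / 2 ^ k ∧ j / 2 ^ k < σ.nat 48 t) ∨
    ∀ x, X j ≤ x → x ≤ X (j + 1) → Reached A B S inc j (val A B t x) x
  total : total S inc ≤ k * (2 * S + Q)

variable {A B X : ℕ → ℝ} {Q S : ℕ} {l r : ℕ → ℕ}

/-- For every line and every leaf of its range, either the leaf still lies in the halved range of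
the line, or lines assigned to the leaf dominate it over the whole leaf. A level moves the split-off
cells to the second case and adds at most `2 * S + Q` assignments. -/
theorem levelProg_spec {σ : Mem} {k : ℕ} {inc : ℕ → List ℕ}
    (h : LevelState A B X Q S l r σ k inc)
    (hX : ∀ i j, i ≤ j → j ≤ Q → X i ≤ X j)
    (hB : ∀ s t, s ≤ t → t < S → B s ≤ B t) :
    Runs levelProg σ fun τ T => ∃ inc', LevelState A B X Q S l r τ (k + 1) inc' ∧
      T ≤ 2000 * (S + Q + 1) := by
  set n := Q / 2 ^ k with hn
  have hnQ : n ≤ Q := Nat.div_le_self _ _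
  have hnk : n * 2 ^ k ≤ Q := Nat.div_mul_le_self _ _
  have hmono : ∀ a b, a ≤ b → a * 2 ^ k ≤ b * 2 ^ k := fun a b hab => Nat.mul_le_mul_right _ hab
  have hn' : n / 2 = Q / 2 ^ (k + 1) := by rw [hn, Nat.div_div_eq_div_mul, pow_succ]
  have hj' : ∀ j, j / 2 ^ (k + 1) = j / 2 ^ k / 2 := fun j => by
    rw [Nat.div_div_eq_div_mul, pow_succ]
  have hcell : ∀ c j, c * 2 ^ k ≤ j → j < (c + 1) * 2 ^ k → j / 2 ^ k = c := fun c j h1 h2 =>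
    Nat.div_eq_of_lt_le h1 h2
  have hcell' : ∀ j, j / 2 ^ k * 2 ^ k ≤ j ∧ j < (j / 2 ^ k + 1) * 2 ^ k := fun j =>
    ⟨Nat.div_mul_le_self _ _, by rw [mul_comm]; exact Nat.lt_mul_div_succ j (by positivity)⟩
  rw [levelProg, runs_seq]
  refine (clearStacks_spec (by norm_num) h.num).mono ?_
  rintro τ₁ T₁ hf₁ ⟨hh₁, hT₁⟩
  have a43 : τ₁.real 43 = σ.real 43 := hf₁.real 43 (by decide)
  have a45 : τ₁.real 45 = B := by rw [hf₁.real 45 (by decide), h.slope]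
  have a47 : τ₁.nat 47 = σ.nat 47 := hf₁.nat 47 (by decide)
  have a48 : τ₁.nat 48 = σ.nat 48 := hf₁.nat 48 (by decide)
  have a50 : τ₁.nat 50 0 = S := by rw [hf₁.nat 50 (by decide), h.size]
  have a51 : τ₁.nat 51 = σ.nat 51 := hf₁.nat 51 (by decide)
  rw [runs_seq]
  refine (emitProg_spec hh₁ a50 (fun j hj => by rw [a51]; exact h.half j (hj.trans hnQ))
    (by rw [a47, a48]; exact h.range) ?_ (by rw [a45]; exact hB)).mono ?_
  · intro c hc
    rw [a43, (h.start c (by omega)).2, (h.start (c + 1) hc).2]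
    exact hX _ _ (hmono _ _ (by omega)) ((hmono _ _ hc).trans hnk)
  rintro τ₂ T₂ hf₂ ⟨stk, D, hh₂, hem, htot, hT₂⟩
  rw [a47, a48] at hem
  have b43 : τ₂.real 43 = σ.real 43 := by rw [hf₂.real 43 (by decide), a43]
  have b44 : τ₂.real 44 = A := by
    rw [hf₂.real 44 (by decide), hf₁.real 44 (by decide), h.const]
  have b45 : τ₂.real 45 = B := by rw [hf₂.real 45 (by decide), a45]
  have b46 : τ₂.real 46 = X := by
    rw [hf₂.real 46 (by decide), hf₁.real 46 (by decide), h.bounds]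
  have c46 : τ₂.nat 46 = σ.nat 46 := by rw [hf₂.nat 46 (by decide), hf₁.nat 46 (by decide)]
  have b49 : τ₂.nat 49 0 = n := by
    rw [hf₂.nat 49 (by decide), hf₁.nat 49 (by decide), h.num]
  have b50 : τ₂.nat 50 0 = S := by rw [hf₂.nat 50 (by decide), a50]
  have b51 : τ₂.nat 51 = σ.nat 51 := by rw [hf₂.nat 51 (by decide), a51]
  have b52 : τ₂.nat 52 = σ.nat 52 := by rw [hf₂.nat 52 (by decide), hf₁.nat 52 (by decide)]
  have b53 : τ₂.nat 53 = σ.nat 53 := by rw [hf₂.nat 53 (by decide), hf₁.nat 53 (by decide)]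
  have b54 : τ₂.nat 54 = σ.nat 54 := by rw [hf₂.nat 54 (by decide), hf₁.nat 54 (by decide)]
  have b55 : τ₂.nat 55 = σ.nat 55 := by rw [hf₂.nat 55 (by decide), hf₁.nat 55 (by decide)]
  rw [runs_seq]
  have s46 : ∀ c ≤ n, τ₂.nat 46 c = c * 2 ^ k := fun c hc => by rw [c46, (h.start c hc).1]
  refine (walkProg_spec (inc := inc) hh₂ b49 (fun c t ht => (hem.mem c t ht).1)
    ⟨by rw [b55]; exact h.stored.free_pos, by rw [b52, b53, b54, b55]; exact h.stored.list⟩ ?_ ?_ ?_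
    ?_).mono ?_
  · intro c hc
    rw [s46 c hc.le, s46 (c + 1) hc]
    exact hmono _ _ (by omega)
  · intro c hc
    rw [s46 c hc, s46 n le_rfl]
    exact hmono _ _ hc
  · intro c hc
    rw [s46 c hc, b43, b46, (h.start c hc).2]
  · intro i j hij hj
    rw [s46 n le_rfl] at hj
    rw [b46]
    exact hX i j hij (hj.trans hnk)
  rintro τ₃ T₃ hf₃ ⟨inc', hi, hnew, hold, hreach, htot', hT₃⟩
  rw [s46 n le_rfl] at htot' hT₃
  rw [b44, b45, b46] at hreach
  have d43 : τ₃.real 43 = σ.real 43 := by rw [hf₃.real 43 (by decide), b43]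
  have d44 : τ₃.real 44 = A := by rw [hf₃.real 44 (by decide), b44]
  have d45 : τ₃.real 45 = B := by rw [hf₃.real 45 (by decide), b45]
  have d46 : τ₃.real 46 = X := by rw [hf₃.real 46 (by decide), b46]
  have d46' : τ₃.nat 46 = σ.nat 46 := by rw [hf₃.nat 46 (by decide), c46]
  have d47 : τ₃.nat 47 = τ₂.nat 47 := hf₃.nat 47 (by decide)
  have d48 : τ₃.nat 48 = τ₂.nat 48 := hf₃.nat 48 (by decide)
  have d49 : τ₃.nat 49 0 = n := by rw [hf₃.nat 49 (by decide), b49]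
  have d50 : τ₃.nat 50 0 = S := by rw [hf₃.nat 50 (by decide), b50]
  have d51 : τ₃.nat 51 = σ.nat 51 := by rw [hf₃.nat 51 (by decide), b51]
  simp [d49, d51, h.half n hnQ]
  -- The tables of cell starts are thinned out in place: step `i` reads entry `2 * i ≥ i`, which has
  -- not been overwritten yet.
  refine (runs_forTo (fun i ρ => (∀ c < i, ρ.nat 46 c = c * 2 ^ (k + 1) ∧
        ρ.real 43 c = X (c * 2 ^ (k + 1))) ∧
      (∀ c, i ≤ c → ρ.nat 46 c = σ.nat 46 c ∧ ρ.real 43 c = σ.real 43 c)) 50 (n / 2 + 1)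
      (by decide) (by decide) (by decide) (by simp)
      ⟨by simp, by simp [d43, d46']⟩ (fun i τ v h => by simpa using h) ?_).mono ?_
  · rintro i ρ hi hc _ ⟨h1, h2⟩
    simp [hc]
    have h3 := h2 (i + i) (by omega)
    have h4 := h.start (i + i) (by omega)
    have h5 : (i + i) * 2 ^ k = i * 2 ^ (k + 1) := by ring
    refine ⟨fun c hci => ?_, fun c hci => ?_⟩
    · rcases Nat.lt_or_ge c i with h | h
      · rw [Function.update_of_ne h.ne, Function.update_of_ne h.ne]; exact h1 c h
      · obtain rfl : c = i := by omega
        simp only [Function.update_self]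
        rw [h3.1, h3.2, h4.1, h4.2, h5]
        exact ⟨rfl, rfl⟩
    · rw [Function.update_of_ne (by omega), Function.update_of_ne (by omega)]
      exact h2 c (by omega)
  · rintro ρ T hf ⟨⟨h1, -⟩, -, hT⟩
    have e44 : ρ.real 44 = A := by rw [hf.real 44 (by decide)]; simp [d44]
    have e45 : ρ.real 45 = B := by rw [hf.real 45 (by decide)]; simp [d45]
    have e46 : ρ.real 46 = X := by rw [hf.real 46 (by decide)]; simp [d46]
    have e47 : ρ.nat 47 = τ₂.nat 47 := by rw [hf.nat 47 (by decide)]; simp [d47]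
    have e48 : ρ.nat 48 = τ₂.nat 48 := by rw [hf.nat 48 (by decide)]; simp [d48]
    have e49 : ρ.nat 49 0 = n / 2 := by rw [hf.nat 49 (by decide)]; simp
    have e50 : ρ.nat 50 0 = S := by rw [hf.nat 50 (by decide)]; simp [d50]
    have e51 : ρ.nat 51 = σ.nat 51 := by rw [hf.nat 51 (by decide)]; simp [d51]
    have e52 : ρ.nat 52 = τ₃.nat 52 := by rw [hf.nat 52 (by decide)]; simp
    have e53 : ρ.nat 53 = τ₃.nat 53 := by rw [hf.nat 53 (by decide)]; simp
    have e54 : ρ.nat 54 = τ₃.nat 54 := by rw [hf.nat 54 (by decide)]; simp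
    have e55 : ρ.nat 55 = τ₃.nat 55 := by rw [hf.nat 55 (by decide)]; simp
    refine ⟨⟨inc', e49.trans hn', e50, by rw [e51]; exact h.half, e44, e45, e46,
      fun c hc => h1 c (by omega), ?_,
      ⟨by rw [e55]; exact hi.free_pos, by rw [e52, e53, e54, e55]; exact hi.list⟩, ?_, ?_, ?_, ?_⟩,
      by omega⟩
    · intro t ht
      rw [e47, e48, ← hn']
      exact hem.le t ht
    · intro t j hj
      rcases hnew t j hj with hj | ⟨c, hcn, htc, hj1, hj2⟩
      · exact h.sound t j hj
      · obtain ⟨m1, m2, m3⟩ := hem.mem c t htc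
        rw [s46 c hcn.le] at hj1
        rw [s46 (c + 1) hcn] at hj2
        have := hcell c j hj1 hj2
        exact h.sub t m1 j (by omega) (by omega)
    · intro t ht j h5 h6
      rw [e47, hj'] at h5
      rw [e48, hj'] at h6
      have := hem.sub t ht _ h5 h6
      exact h.sub t ht j this.1 this.2
    · intro t ht j h5 h6
      rw [e47, e48, hj']
      rcases h.cover t ht j h5 h6 with h7 | h7
      · rcases hem.cover t ht _ h7.1 h7.2 with h8 | h8
        · right
          have hcn : j / 2 ^ k < n := h7.2.trans_le (h.range t ht).2
          refine hreach _ hcn t h8 j ?_ ?_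
          · rw [s46 _ hcn.le]; exact (hcell' j).1
          · rw [s46 _ hcn]; exact (hcell' j).2
        · exact .inl h8
      · exact .inr fun x hx1 hx2 => (h7 x hx1 hx2).mono hold
    · have := h.total
      rw [add_mul, one_mul]
      omega

/-- Assign lines to leaves so that on every leaf the maximum of the assigned lines is the maximum of
all lines whose ranges contain the leaf. -/
def distributeProg : Prog :=
  .setNat 49 (.const 0) (.var 60) ;;
  .setNat 58 (.const 0) (.add (.var 60) (.const 1)) ;;
  .forTo 40 (.var 58)
    (.setReal 43 (.var 40) (.read 46 (.var 40)) ;; .setNat 46 (.var 40) (.var 40)) ;;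
  .forTo 41 (.var 50) (.setNat 52 (.var 41) (.const 0)) ;;
  .setNat 55 (.const 0) (.const 1) ;;
  .loop (.natLt (.const 0) (.var 49)) levelProg

/-- After `Nat.log 2 Q + 1` levels no cells are left. Each level is charged the full `S + Q`, which
is where the single logarithmic factor arises. -/
theorem distributeProg_spec {σ : Mem} (hQ : σ.nat 60 0 = Q) (hS : σ.nat 50 0 = S)
    (hhalf : ∀ j ≤ Q, σ.nat 51 j = j / 2)
    (hlr : ∀ t < S, σ.nat 47 t ≤ σ.nat 48 t ∧ σ.nat 48 t ≤ Q)
    (hX : ∀ i j, i ≤ j → j ≤ Q → σ.real 46 i ≤ σ.real 46 j)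
    (hB : ∀ s t, s ≤ t → t < S → σ.real 45 s ≤ σ.real 45 t) :
    Runs distributeProg σ fun τ T => ∃ inc, Incidences τ S inc ∧
      (∀ t, ∀ j ∈ inc t, σ.nat 47 t ≤ j ∧ j < σ.nat 48 t) ∧
      (∀ t < S, ∀ j, σ.nat 47 t ≤ j → j < σ.nat 48 t → ∀ x, σ.real 46 j ≤ x →
        x ≤ σ.real 46 (j + 1) → Reached (σ.real 44) (σ.real 45) S inc j
          (val (σ.real 44) (σ.real 45) t x) x) ∧
      total S inc ≤ (Nat.log 2 Q + 1) * (2 * S + Q) ∧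
      T ≤ 2100 * ((S + Q + 1) * (Nat.log 2 Q + 2)) := by
  simp [distributeProg, hQ, -runs_skip]
  refine (runs_forTo (fun i ρ => ∀ c < i, ρ.nat 46 c = c ∧ ρ.real 43 c = σ.real 46 c) 50 (Q + 1)
    (by decide) (by decide) (by decide) (by simp) (by simp)
    (fun i τ v h => by simpa using h) ?_).mono ?_
  · rintro i ρ hi hc hf h1
    have e46 : ρ.real 46 = σ.real 46 := by rw [hf.real 46 (by decide)]; simp
    simp [hc, e46]
    intro c hci
    rcases Nat.lt_or_ge c i with h | h
    · rw [Function.update_of_ne h.ne, Function.update_of_ne h.ne]; exact h1 c h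
    · obtain rfl : c = i := by omega
      simp
  rintro τ T hf ⟨h1, -, hT⟩
  refine (runs_forTo (fun i ρ => ∀ t < i, ρ.nat 52 t = 0) 20 S
    (by decide) (by decide) (by decide) (by rw [hf.nat 50 (by decide)]; simp [hS]) (by simp)
    (fun i τ v h => by simpa using h) ?_).mono ?_
  · rintro i ρ hi hc _ h1
    simp [hc]
    intro c hci
    rcases Nat.lt_or_ge c i with h | h
    · rw [Function.update_of_ne h.ne]; exact h1 c h
    · obtain rfl : c = i := by omega
      simp
  rintro ρ T' hf' ⟨h2, -, hT'⟩
  have hnat : ∀ a, a ≠ 40 → a ≠ 41 → a ≠ 46 → a ≠ 49 → a ≠ 52 → a ≠ 58 →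
      ρ.nat a = σ.nat a := fun a _ _ _ _ _ _ => by
    rw [hf'.nat a (by simp [Prog.natWrites]; tauto), hf.nat a (by simp [Prog.natWrites]; tauto)]
    simp [*]
  have hreal : ∀ a, a ≠ 43 → ρ.real a = σ.real a := fun a _ => by
    rw [hf'.real a (by simp [Prog.realWrites]), hf.real a (by simp [Prog.realWrites]; tauto)]
    simp
  have e49 : ρ.nat 49 0 = Q := by rw [hf'.nat 49 (by decide), hf.nat 49 (by decide)]; simp
  have e46 : ρ.nat 46 = τ.nat 46 := hf'.nat 46 (by decide)
  have e43 : ρ.real 43 = τ.real 43 := hf'.real 43 (by decide)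
  refine (runs_loop (α := ℕ × (ℕ → List ℕ))
    (fun a ρ => LevelState (σ.real 44) (σ.real 45) (σ.real 46) Q S (σ.nat 47) (σ.nat 48) ρ a.1 a.2 ∧
      a.1 ≤ Nat.log 2 Q + 1)
    (fun a => (Nat.log 2 Q + 1 - a.1) * (2000 * (S + Q + 1) + 10)) (a₀ := (0, fun _ => []))
    ⟨⟨?_, ?_, ?_, ?_, ?_, ?_, ?_, ?_, ?_, ?_, ?_, ?_, ?_⟩, by simp⟩ ?_).mono ?_
  · simp [e49]
  · simp [hnat, hS]
  · simpa [hnat] using hhalf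
  · simp [hreal]
  · simp [hreal]
  · simp [hreal]
  · intro c hc
    simp at hc
    simp [e46, e43, h1 c (by omega)]
  · simpa [hnat] using hlr
  · exact ⟨by simp, fun t ht => by simpa [ListAt] using h2 t ht⟩
  · simp
  · intro t ht j
    simp [hnat]
    tauto
  · intro t ht j h3 h4
    left
    simpa [hnat] using ⟨h3, h4⟩
  · simp [total]
  · rintro ⟨k, inc⟩ ρ - ⟨hI, hk⟩ ht
    dsimp only at hI hk
    simp [hI.num] at ht
    have hk' : k ≤ Nat.log 2 Q := Nat.le_log_of_pow_le (by norm_num) ht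
    refine (levelProg_spec hI hX hB).mono ?_
    rintro ρ' T'' - ⟨inc', hI', hT''⟩
    refine ⟨(k + 1, inc'), ⟨hI', by simpa using hk'⟩, ?_⟩
    obtain ⟨d, hd⟩ := Nat.exists_eq_add_of_le hk'
    have e1 : Nat.log 2 Q + 1 - k = d + 1 := by omega
    have e2 : Nat.log 2 Q + 1 - (k + 1) = d := by omega
    simp only [e1, e2, Test.cost, NExp.cost]
    linarith
  · rintro ρ' T'' - ⟨⟨k, inc⟩, ⟨hI, hk⟩, ht, hT''⟩
    dsimp only at hI hk
    simp only [Test.Holds, NExp.eval, hI.num, not_lt, Nat.le_zero] at ht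
    refine ⟨inc, hI.stored, hI.sound, fun t hts j h3 h4 => ?_, ?_, ?_⟩
    · refine (hI.cover t hts j h3 h4).resolve_left fun h5 => ?_
      have := (hI.range t hts).2
      omega
    · exact hI.total.trans (Nat.mul_le_mul_right _ hk)
    · simp only [Nat.sub_zero, Test.cost, NExp.cost] at hT''
      have h0 : 0 ≤ (Nat.log 2 Q + 1 - k) * (2000 * (S + Q + 1) + 10) := Nat.zero_le _
      nlinarith [Nat.zero_le (S * Nat.log 2 Q), Nat.zero_le (Q * Nat.log 2 Q)]

end RealRAM

/-! ## Minimizing the maximum of the lines over all leaves -/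

namespace Hull

variable {A B : ℕ → ℝ} {a b : ℝ}

theorem Chain.lt_head {e : ℝ × ℕ} {l : List (ℝ × ℕ)} (h : Chain A B a b (e :: l)) :
    ∀ f ∈ l, f.1 < e.1 := by
  induction l generalizing e with
  | nil => simp
  | cons g l ih =>
    intro f hf
    rcases List.mem_cons.1 hf with rfl | hf
    · exact h.2.1
    · exact (ih h.2.2.2 f hf).trans h.2.1

/-- The pieces above `e` on the stack start strictly later, so the piece that contains `e.1` is `e`
itself. Hence the value computed at a vertex bounds all lines there. -/
theorem Chain.le_of_below_start {l : List (ℝ × ℕ)} (h : Chain A B a b l) {e : ℝ × ℕ} (he : e ∈ l)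
    {y : ℝ} (hb : Below A B y e.1 l) : y ≤ val A B e.2 e.1 := by
  induction l with
  | nil => simp at he
  | cons f l ih =>
    rcases List.mem_cons.1 he with rfl | he
    · exact (hb.resolve_right fun h' => absurd h'.1 (lt_irrefl _)).2
    · have := h.lt_head e he
      rcases hb with hb | hb
      · linarith [hb.1]
      · exact ih h.tail he hb.2

theorem Chain.mem_Icc {l : List (ℝ × ℕ)} (h : Chain A B a b l) {e : ℝ × ℕ} (he : e ∈ l) :
    a ≤ e.1 ∧ e.1 ≤ b := by
  induction l with
  | nil => simp at he
  | cons f l ih =>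
    rcases List.mem_cons.1 he with rfl | he
    · exact ⟨h.le_head, h.head_le⟩
    · exact ih h.tail he

/-- A lower bound for the hull at its vertices is a lower bound everywhere. -/
theorem Chain.vertex_bound {e : ℝ × ℕ} {l : List (ℝ × ℕ)} (h : Chain A B a b (e :: l)) {z y : ℝ}
    (hz : ∀ f ∈ e :: l, z ≤ val A B f.2 f.1) (hy : z ≤ val A B e.2 y) (hey : e.1 ≤ y)
    {x : ℝ} (hax : a ≤ x) (hxy : x ≤ y) : ∃ f ∈ e :: l, z ≤ val A B f.2 x := by
  -- An affine function on an interval is at least the smaller of its end values; the sign of the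
  -- slope tells which end to compare with.
  have hlin : ∀ f : ℝ × ℕ, ∀ u v, u ≤ x → x ≤ v → z ≤ val A B f.2 u → z ≤ val A B f.2 v →
      z ≤ val A B f.2 x := by
    intro f u v hu hv h1 h2
    unfold val at *
    rcases le_total 0 (B f.2) with hB | hB <;> nlinarith
  induction l generalizing e y with
  | nil => exact ⟨e, by simp, hlin e _ _ (h.1.trans_le hax) hxy (hz e (by simp)) hy⟩
  | cons f l ih =>
    rcases le_or_gt e.1 x with hx | hx
    · exact ⟨e, by simp, hlin e _ _ hx hxy (hz e (by simp)) hy⟩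
    · obtain ⟨g, hg, hgx⟩ := ih h.2.2.2 (fun g hg => hz g (List.mem_cons_of_mem _ hg))
        (by rw [h.2.2.1]; exact hz e (by simp)) h.2.1.le hx.le
      exact ⟨g, List.mem_cons_of_mem _ hg, hgx⟩

end Hull

/-! ### Scanning the hulls of the leaves for the best point -/

namespace RealRAM

open Hull Finset

/-- The output cells hold a value that is at most `y`. -/
def Beats (σ : Mem) (y : ℝ) : Prop := σ.nat 59 0 ≠ 0 ∧ σ.real 5 1 ≤ y

/-- The output cells are empty or satisfy `P`. -/
def Valid (P : ℕ → ℕ → ℝ → ℝ → Prop) (σ : Mem) : Prop :=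
  σ.nat 59 0 ≠ 0 → P (σ.nat 5 0) (σ.nat 5 1) (σ.real 5 0) (σ.real 5 1)

/-- Replace the output by the point at `47` of the edge number `11`, with value `48`, if it is
better. -/
def updateProg : Prog :=
  .cond (.and (.natLt (.const 0) (.var 59)) (.not (.realLt (.var 48) (.read 5 (.const 1))))) .skip
    (.setNat 59 (.const 0) (.const 1) ;;
     .setNat 5 (.const 0) (.read 1 (.var 11)) ;;
     .setNat 5 (.const 1) (.read 2 (.var 11)) ;;
     .setReal 5 (.const 0) (.var 47) ;;
     .setReal 5 (.const 1) (.var 48))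

theorem updateProg_spec {P : ℕ → ℕ → ℝ → ℝ → Prop} {σ : Mem} {k u v : ℕ}
    (hk : σ.nat 11 0 = k) (hu : σ.nat 1 k = u) (hv : σ.nat 2 k = v)
    (hP : P u v (σ.real 47 0) (σ.real 48 0)) (hV : Valid P σ) :
    Runs updateProg σ fun τ T => Valid P τ ∧ Beats τ (σ.real 48 0) ∧
      (∀ y, Beats σ y → Beats τ y) ∧ T ≤ 40 := by
  rw [updateProg, runs_cond]
  refine ⟨fun h => ?_, fun h => ?_⟩
  · simp at h
    simp only [runs_skip]
    exact ⟨hV, ⟨h.1.ne', h.2⟩, fun y hy => hy, by simp⟩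
  · simp at h
    simp [hk, hu, hv, Valid, Beats]
    exact ⟨hP, fun y h1 h2 => (h (Nat.pos_of_ne_zero h1)).le.trans h2⟩

/-- Evaluate the hull of cell `40` at its vertices. -/
def scanCell : Prog :=
  .setNat 57 (.const 0) (.read 42 (.var 40)) ;;
  .cond (.natLt (.const 0) (.var 57))
    (.setReal 47 (.const 0) (.read 43 (.add (.var 40) (.const 1))) ;;
     .setReal 48 (.const 0) (lineAt (.read 44 (.var 57)) (.var 47)) ;;
     updateProg) .skip ;;
  .loop (.natLt (.const 0) (.var 57))
    (.setReal 47 (.const 0) (.read 42 (.var 57)) ;;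
     .setReal 48 (.const 0) (lineAt (.read 44 (.var 57)) (.var 47)) ;;
     updateProg ;;
     .setNat 57 (.const 0) (.read 43 (.var 57)))

/-- Candidates are the starts of the pieces and the right end of the cell. The value of a candidate
bounds all lines of the cell there, so the output remains valid; and the output value ends up below
the hull at all vertices, hence below it everywhere. -/
theorem scanCell_spec {P : ℕ → ℕ → ℝ → ℝ → Prop} {σ : Mem} {n c k u v : ℕ}
    {stk : ℕ → List (ℝ × ℕ)} {D : ℕ → Set ℕ} (h : Hulls σ n stk D) (hcn : c < n)
    (hc : σ.nat 40 0 = c) (hk : σ.nat 11 0 = k) (hu : σ.nat 1 k = u) (hv : σ.nat 2 k = v)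
    (hle : σ.real 43 c ≤ σ.real 43 (c + 1))
    (hP : ∀ x y, σ.real 43 c ≤ x → x ≤ σ.real 43 (c + 1) →
      (∀ s ∈ D c, val (σ.real 44) (σ.real 45) s x ≤ y) → P u v x y)
    (hV : Valid P σ) :
    Runs scanCell σ fun τ T => Valid P τ ∧ (∀ y, Beats σ y → Beats τ y) ∧
      (∀ x, σ.real 43 c ≤ x → x ≤ σ.real 43 (c + 1) → (D c).Nonempty →
        ∃ t ∈ D c, Beats τ (val (σ.real 44) (σ.real 45) t x)) ∧
      T ≤ 100 * (stk c).length + 200 := by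
  set A := σ.real 44 with hA
  set B := σ.real 45 with hB
  have hull := h.hull c hcn
  have hlist := h.stack.list c hcn
  simp only [scanCell, runs_seq, runs_setNat, NExp.eval, NExp.cost, hc]
  have hstep : Runs (.cond (.natLt (.const 0) (.var 57))
      (.setReal 47 (.const 0) (.read 43 (.add (.var 40) (.const 1))) ;;
       .setReal 48 (.const 0) (lineAt (.read 44 (.var 57)) (.var 47)) ;;
       updateProg) .skip) (σ.writeNat 57 0 (σ.nat 42 c)) fun τ T => Valid P τ ∧
      (∀ y, Beats σ y → Beats τ y) ∧ (∀ e l, stk c = e :: l → Beats τ (val A B e.2 (σ.real 43 (c + 1)))) ∧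
      T ≤ 80 := by
    rw [runs_cond]
    refine ⟨fun ht => ?_, fun ht => ?_⟩
    · simp at ht
      rcases hsc : stk c with _ | ⟨e, l⟩
      · rw [hsc] at hlist
        exact absurd (show σ.nat 42 c = 0 from hlist) ht.ne'
      rw [hsc] at hlist
      obtain ⟨h0, h1, rfl, h3⟩ := hlist
      simp [hc]
      refine (updateProg_spec (P := P) (k := k) (u := u) (v := v) (by simp [hk]) (by simp [hu])
        (by simp [hv]) ?_ (by simpa [Valid] using hV)).mono ?_
      · simp
        refine hP _ _ hle le_rfl fun s hs => ?_
        have hb := hull.below s hs _ hle le_rfl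
        rw [hsc] at hb
        rcases hb with hb | hb
        · exact hb.2
        · have := hull.chain
          rw [hsc] at this
          linarith [this.head_le, hb.1]
      · rintro τ T - ⟨h1, h2, h3, h4⟩
        refine ⟨h1, fun y hy => h3 y (by simpa [Beats] using hy), ?_, by omega⟩
        simpa [Hull.val, hA, hB] using h2
    · simp at ht
      simp
      refine ⟨by simpa [Valid] using hV, by simp [Beats], fun a b l hl => ?_⟩
      rw [hl] at hlist
      exact absurd ht hlist.1
  refine hstep.mono ?_
  rintro τ T hf ⟨hV₁, hm₁, htop, hT⟩
  have e57 : τ.nat 57 0 = σ.nat 42 c := by rw [hf.nat 57 (by decide)]; simp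
  refine (runs_loop (α := List (ℝ × ℕ))
    (fun l ρ => Valid P ρ ∧ (∀ y, Beats τ y → Beats ρ y) ∧ l <:+ stk c ∧
      (∀ e ∈ stk c, e ∈ l ∨ Beats ρ (val A B e.2 e.1)) ∧
      ListAt (σ.nat 43) (fun i => (σ.real 42 i, σ.nat 44 i)) (σ.nat 45 0) (ρ.nat 57 0) l)
    (fun l => 100 * l.length) (a₀ := stk c)
    ⟨hV₁, fun y hy => hy, List.suffix_rfl, fun e he => .inl he, by rw [e57]; exact hlist⟩
    ?_).mono ?_
  · rintro l ρ hfr ⟨g1, g2, g3, g4, g5⟩ ht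
    simp at ht
    rcases l with _ | ⟨e, l⟩
    · exact absurd (show ρ.nat 57 0 = 0 from g5) ht.ne'
    obtain ⟨h0, h1, rfl, h3⟩ := g5
    have r11 : ρ.nat 11 0 = k := by
      rw [hfr.nat 11 (by decide), hf.nat 11 (by decide)]; simp [hk]
    have r1 : ρ.nat 1 = σ.nat 1 := by rw [hfr.nat 1 (by decide), hf.nat 1 (by decide)]; simp
    have r2 : ρ.nat 2 = σ.nat 2 := by rw [hfr.nat 2 (by decide), hf.nat 2 (by decide)]; simp
    have r43 : ρ.nat 43 = σ.nat 43 := by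
      rw [hfr.nat 43 (by decide), hf.nat 43 (by decide)]; simp
    have r44 : ρ.nat 44 = σ.nat 44 := by
      rw [hfr.nat 44 (by decide), hf.nat 44 (by decide)]; simp
    have s42 : ρ.real 42 = σ.real 42 := by
      rw [hfr.real 42 (by decide), hf.real 42 (by decide)]; simp
    have s44 : ρ.real 44 = A := by rw [hfr.real 44 (by decide), hf.real 44 (by decide)]; simp [hA]
    have s45 : ρ.real 45 = B := by rw [hfr.real 45 (by decide), hf.real 45 (by decide)]; simp [hB]
    have hmem := g3.subset (List.mem_cons_self (a := (σ.real 42 (ρ.nat 57 0), σ.nat 44 (ρ.nat 57 0))))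
    have hI := hull.chain.mem_Icc hmem
    simp [r44, s42, s44, s45]
    refine (updateProg_spec (P := P) (k := k) (u := u) (v := v) (by simp [r11]) (by simp [r1, hu])
        (by simp [r2, hv]) ?_ (by simpa [Valid] using g1)).mono ?_
    · simp
      exact hP _ _ hI.1 hI.2 fun s hs =>
        hull.chain.le_of_below_start hmem (hull.below s hs _ hI.1 hI.2)
    · rintro ρ' T' hf' ⟨q1, q2, q3, q4⟩
      have t57 : ρ'.nat 57 0 = ρ.nat 57 0 := by rw [hf'.nat 57 (by decide)]; simp
      have t43 : ρ'.nat 43 = σ.nat 43 := by rw [hf'.nat 43 (by decide)]; simp [r43]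
      have hmono : ∀ y, Beats ρ y → Beats ρ' y := fun y hy => q3 y (by simpa [Beats] using hy)
      refine ⟨l, ⟨by simpa [Valid] using q1, fun y hy => ?_, (List.suffix_cons _ l).trans g3, ?_,
        ?_⟩, by omega⟩
      · simpa [Beats] using hmono y (g2 y hy)
      · intro x t he
        rcases g4 (x, t) he with he' | he'
        · rcases List.mem_cons.1 he' with he' | he'
          · right
            obtain ⟨rfl, rfl⟩ := Prod.mk.inj he'
            simpa [Beats, Hull.val] using q2
          · exact .inl he'
        · right; simpa [Beats] using hmono _ he'
      · simpa [t57, t43] using h3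
  · rintro ρ T' hfr ⟨l, ⟨g1, g2, g3, g4, g5⟩, ht, hT'⟩
    simp at ht
    obtain rfl := g5.eq_nil_iff.1 ht
    refine ⟨g1, fun y hy => g2 y (hm₁ y hy), fun x hx1 hx2 hne => ?_, ?_⟩
    · obtain ⟨s, hs⟩ := hne
      rcases hsc : stk c with _ | ⟨e, l⟩
      · have := hull.below s hs x hx1 hx2
        rw [hsc] at this
        exact this.elim
      have hch := hull.chain
      have hmem := hull.mem
      rw [hsc] at g4 hch hmem
      have hb := g2 _ (htop e l hsc)
      -- The lower bound `z` is the final output value, which beats each vertex.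
      obtain ⟨f, hf1, hf2⟩ := hch.vertex_bound (z := ρ.real 5 1)
        (fun f hf => ((g4 f hf).resolve_left (by simp)).2) hb.2 hch.head_le hx1 hx2
      exact ⟨f.2, hmem f hf1, hb.1, hf2⟩
    · simp at hT'
      omega

/-- Insert the lines into the hulls of the leaves that they have been assigned to. -/
def insertProg : Prog :=
  .forTo 41 (.var 50)
    (.setNat 57 (.const 0) (.read 52 (.var 41)) ;;
     .loop (.natLt (.const 0) (.var 57))
      (.setNat 40 (.const 0) (.read 54 (.var 57)) ;;
       pushProg ;;
       .setNat 57 (.const 0) (.read 53 (.var 57))))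

/-- Incidences are listed by line and not by leaf, so this loop visits every leaf with its lines in
order of slope and no sorting per leaf is needed. -/
theorem insertProg_spec {σ : Mem} {n S : ℕ} {inc : ℕ → List ℕ}
    (h : Hulls σ n (fun _ => []) (fun _ => ∅)) (hi : Incidences σ S inc)
    (hS : σ.nat 50 0 = S) (hinc : ∀ t < S, ∀ j ∈ inc t, j < n)
    (hle : ∀ c < n, σ.real 43 c ≤ σ.real 43 (c + 1))
    (hB : ∀ s t, s ≤ t → t < S → σ.real 45 s ≤ σ.real 45 t) :
    Runs insertProg σ fun τ T => ∃ stk D, Hulls τ n stk D ∧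
      (∀ c t, t ∈ D c ↔ t < S ∧ c ∈ inc t) ∧
      T + 100 * total n stk ≤ 600 * total S inc + 200 * (S + 1) := by
  unfold insertProg
  refine (runs_forTo_amortized (α := (ℕ → List (ℝ × ℕ)) × (ℕ → Set ℕ))
    (fun i a τ => Hulls τ n a.1 a.2 ∧ ∀ c t, t ∈ a.2 c ↔ t < i ∧ c ∈ inc t)
    (fun i a => 100 * total n a.1 + 600 * ∑ t ∈ Ico i S, (inc t).length) 100 S
    (a₀ := (fun _ => [], fun _ => ∅)) (by decide) (by decide) (by decide) hS ⟨h, by simp⟩ ?_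
    ?_).mono ?_
  · rintro i a τ v ⟨h1, h2⟩
    exact ⟨⟨⟨by simpa using h1.stack.free_pos, by simpa using h1.stack.list⟩,
      by simpa using h1.hull⟩, h2⟩
  · rintro i ⟨stk, D⟩ τ hin hci hf ⟨h1, h2⟩
    dsimp only at h1 h2
    have e52 : τ.nat 52 = σ.nat 52 := hf.nat 52 (by decide)
    have e53 : τ.nat 53 = σ.nat 53 := hf.nat 53 (by decide)
    have e54 : τ.nat 54 = σ.nat 54 := hf.nat 54 (by decide)
    have e55 : τ.nat 55 = σ.nat 55 := hf.nat 55 (by decide)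
    have e43 : τ.real 43 = σ.real 43 := hf.real 43 (by decide)
    have e45 : τ.real 45 = σ.real 45 := hf.real 45 (by decide)
    simp only [runs_seq, runs_setNat, NExp.eval, NExp.cost, hci]
    -- The second condition only limits which lines may be present; that line `i` reaches all its
    -- leaves follows from the third one when the list is exhausted.
    refine (runs_loop (α := List ℕ × (ℕ → List (ℝ × ℕ)) × (ℕ → Set ℕ))
      (fun a ρ => Hulls ρ n a.2.1 a.2.2 ∧
        (∀ c t, t ∈ a.2.2 c ↔ (t < i ∧ c ∈ inc t) ∨ (t = i ∧ c ∈ inc i ∧ t ∈ a.2.2 c)) ∧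
        (∀ c ∈ inc i, c ∈ a.1 ∨ i ∈ a.2.2 c) ∧ a.1 <:+ inc i ∧
        ListAt (σ.nat 53) (σ.nat 54) (σ.nat 55 0) (ρ.nat 57 0) a.1)
      (fun a => 100 * total n a.2.1 + 600 * a.1.length) (a₀ := (inc i, stk, D)) ?_ ?_).mono ?_
    · refine ⟨⟨⟨by simpa using h1.stack.free_pos, by simpa using h1.stack.list⟩,
        by simpa using h1.hull⟩, fun c t => ?_, fun c hc => .inl hc, List.suffix_rfl,
        by simpa [e52] using hi.list i hin⟩
      have := h2 c t
      dsimp only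
      constructor
      · intro h; exact .inl (this.1 h)
      · rintro (h | h)
        · exact this.2 h
        · exact h.2.2
    · rintro ⟨l, stk', D'⟩ ρ hfr ⟨g1, g2, g3, g4, g5⟩ ht
      dsimp only at g1 g2 g3 g4 g5
      simp at ht
      rcases l with _ | ⟨e, l⟩
      · exact absurd (show ρ.nat 57 0 = 0 from g5) ht.ne'
      obtain ⟨h0, h1', rfl, h3⟩ := g5
      have r41 : ρ.nat 41 0 = i := by rw [hfr.nat 41 (by decide)]; simp [hci]
      have r53 : ρ.nat 53 = σ.nat 53 := by rw [hfr.nat 53 (by decide)]; simp [e53]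
      have r54 : ρ.nat 54 = σ.nat 54 := by rw [hfr.nat 54 (by decide)]; simp [e54]
      have s43 : ρ.real 43 = σ.real 43 := by rw [hfr.real 43 (by decide)]; simp [e43]
      have s45 : ρ.real 45 = σ.real 45 := by rw [hfr.real 45 (by decide)]; simp [e45]
      have hmem := g4.subset (List.mem_cons_self (a := σ.nat 54 (ρ.nat 57 0)))
      have hcn := hinc i hin _ hmem
      simp only [runs_seq, runs_setNat, NExp.eval, NExp.cost, r54]
      set c := σ.nat 54 (ρ.nat 57 0) with hcdef
      refine (Hulls.push (n := n) (c := c) (t := i) (stk := stk') (D := D')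
        ⟨⟨by simpa using g1.stack.free_pos, by simpa using g1.stack.list⟩, by simpa using g1.hull⟩
        hcn (by simp) (by simp [r41]) (by simpa [s43] using hle c hcn) ?_).mono ?_
      · intro s hs
        simp only [Mem.writeNat_real, s45]
        rcases (g2 c s).1 hs with h | ⟨rfl, -⟩
        · exact hB s i h.1.le hin
        -- The invariant does not exclude that line `i` is already there; inserting it twice is
        -- harmless.
        · exact le_rfl
      · rintro ρ' T' hf' ⟨stk'', q1, q2, q3⟩
        have t57 : ρ'.nat 57 0 = ρ.nat 57 0 := by rw [hf'.nat 57 (by decide)]; simp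
        have t53 : ρ'.nat 53 = σ.nat 53 := by rw [hf'.nat 53 (by decide)]; simp [r53]
        refine ⟨(l, stk'', Function.update D' c (insert i (D' c))), ⟨⟨⟨by simpa using
          q1.stack.free_pos, by simpa using q1.stack.list⟩, by simpa using q1.hull⟩, fun d t => ?_,
          fun d hd => ?_, (List.suffix_cons _ l).trans g4, by simpa [t57, t53] using h3⟩, ?_⟩
        · dsimp only
          rcases eq_or_ne d c with rfl | hdc
          · have := g2 c t
            simp only [Function.update_self, Set.mem_insert_iff]
            tauto
          · simpa only [Function.update_of_ne hdc] using g2 d t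
        · dsimp only
          rcases eq_or_ne d c with rfl | hdc
          · right; simp
          · rw [Function.update_of_ne hdc]
            rcases g3 d hd with h | h
            · exact .inl ((List.mem_cons.1 h).resolve_left hdc)
            · exact .inr h
        · simp only [Test.cost, NExp.cost, List.length_cons]
          omega
    · rintro ρ T' hfr ⟨⟨l, stk', D'⟩, ⟨g1, g2, g3, g4, g5⟩, ht, hT'⟩
      dsimp only at g1 g2 g3 g4 g5 hT'
      simp at ht
      obtain rfl := g5.eq_nil_iff.1 ht
      have hsum := sum_eq_sum_Ico_succ_bot hin fun c => (inc c).length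
      refine ⟨(stk', D'), ⟨g1, fun c t => ?_⟩, ?_⟩
      · dsimp only
        constructor
        · intro h
          rcases (g2 c t).1 h with h | ⟨rfl, h, -⟩
          · exact ⟨by omega, h.2⟩
          · exact ⟨by omega, h⟩
        · rintro ⟨h3, h4⟩
          rcases Nat.lt_or_ge t i with h | h
          · exact (g2 c t).2 (.inl ⟨h, h4⟩)
          · obtain rfl : t = i := by omega
            exact (g3 c h4).resolve_left (by simp)
      · simp only [Test.cost, NExp.cost, List.length_nil] at hT' ⊢
        omega
  · rintro τ T - ⟨⟨stk, D⟩, ⟨h1, h2⟩, -, hT⟩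
    refine ⟨stk, D, h1, h2, ?_⟩
    have e1 : total n (fun _ => ([] : List (ℝ × ℕ))) = 0 := by simp [total]
    have e2 : (∑ c ∈ Ico 0 S, (inc c).length) = total S inc := by rw [total, range_eq_Ico]
    simp only [e1, e2, Ico_self, sum_empty] at hT
    omega

/-- Build the hulls of the leaves and evaluate them at their vertices. -/
def leavesProg : Prog :=
  .setNat 58 (.const 0) (.add (.var 60) (.const 1)) ;;
  .forTo 40 (.var 58) (.setReal 43 (.var 40) (.read 46 (.var 40))) ;;
  clearStacks 60 ;; insertProg ;;
  .forTo 40 (.var 60) scanCell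

/-- The push loop is paid for by the number of incidences, and the hulls it leaves behind carry
enough credit to pay for scanning them. -/
theorem leavesProg_spec {P : ℕ → ℕ → ℝ → ℝ → Prop} {σ : Mem} {Q S k u v : ℕ} {inc : ℕ → List ℕ}
    (hi : Incidences σ S inc) (hQ : σ.nat 60 0 = Q) (hS : σ.nat 50 0 = S)
    (hinc : ∀ t < S, ∀ j ∈ inc t, j < Q)
    (hX : ∀ j < Q, σ.real 46 j ≤ σ.real 46 (j + 1))
    (hB : ∀ s t, s ≤ t → t < S → σ.real 45 s ≤ σ.real 45 t)
    (hk : σ.nat 11 0 = k) (hu : σ.nat 1 k = u) (hv : σ.nat 2 k = v)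
    (hP : ∀ j < Q, ∀ x y, σ.real 46 j ≤ x → x ≤ σ.real 46 (j + 1) →
      (∀ t < S, j ∈ inc t → val (σ.real 44) (σ.real 45) t x ≤ y) → P u v x y)
    (hV : Valid P σ) :
    Runs leavesProg σ fun τ T => Valid P τ ∧ (∀ y, Beats σ y → Beats τ y) ∧
      (∀ j < Q, ∀ x, σ.real 46 j ≤ x → x ≤ σ.real 46 (j + 1) → (∃ t < S, j ∈ inc t) →
        ∃ t < S, j ∈ inc t ∧ Beats τ (val (σ.real 44) (σ.real 45) t x)) ∧
      T ≤ 2000 * (total S inc + S + Q + 1) := by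
  simp [leavesProg, hQ, -runs_skip]
  refine (runs_forTo (fun i ρ => ∀ c < i, ρ.real 43 c = σ.real 46 c) 50 (Q + 1)
    (by decide) (by decide) (by decide) (by simp) (by simp)
    (fun i τ v h => by simpa using h) ?_).mono ?_
  · rintro i ρ hi hc hf h1
    have e46 : ρ.real 46 = σ.real 46 := by rw [hf.real 46 (by decide)]; simp
    simp [hc, e46]
    intro c hci
    rcases Nat.lt_or_ge c i with h | h
    · rw [Function.update_of_ne h.ne]; exact h1 c h
    · obtain rfl : c = i := by omega
      simp
  rintro τ₁ T₁ hf₁ ⟨h1, -, hT₁⟩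
  refine (clearStacks_spec (by norm_num)
    (show τ₁.nat 60 0 = Q by rw [hf₁.nat 60 (by decide)]; simp [hQ])).mono ?_
  rintro τ₂ T₂ hf₂ ⟨hh₂, hT₂⟩
  have hnat₂ : ∀ a, a ≠ 40 → a ≠ 58 → a ≠ 42 → a ≠ 45 → τ₂.nat a = σ.nat a := fun a _ _ _ _ => by
    rw [hf₂.nat a (by simp [Prog.natWrites, clearStacks]; tauto),
      hf₁.nat a (by simp [Prog.natWrites]; tauto)]
    simp [*]
  have hreal₂ : ∀ a, a ≠ 43 → τ₂.real a = σ.real a := fun a _ => by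
    rw [hf₂.real a (by simp [Prog.realWrites, clearStacks]),
      hf₁.real a (by simp [Prog.realWrites]; tauto)]
    simp
  have h43 : ∀ c ≤ Q, τ₂.real 43 c = σ.real 46 c := fun c hc => by
    rw [hf₂.real 43 (by decide)]; exact h1 c (by omega)
  refine (insertProg_spec (inc := inc) hh₂ ⟨by simpa [hnat₂] using hi.free_pos,
    by simpa [hnat₂] using hi.list⟩ (by simp [hnat₂, hS]) hinc (fun c hc => ?_)
    (by simpa [hreal₂] using hB)).mono ?_
  · rw [h43 c hc.le, h43 (c + 1) hc]; exact hX c hc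
  rintro τ₃ T₃ hf₃ ⟨stk, D, hh₃, hD, hT₃⟩
  have hnat₃ : ∀ a, a < 40 ∨ 55 < a → a ≠ 57 → a ≠ 58 → τ₃.nat a = σ.nat a := fun a _ _ _ => by
    rw [hf₃.nat a (by simp [Prog.natWrites, insertProg, natWrites_pushProg]; omega),
      hnat₂ a (by omega) (by omega) (by omega) (by omega)]
  have hreal₃ : ∀ a, a ≠ 42 → a ≠ 43 → τ₃.real a = σ.real a := fun a _ _ => by
    rw [hf₃.real a (by simp [Prog.realWrites, insertProg, realWrites_pushProg]; omega),
      hreal₂ a (by omega)]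
  have h43' : ∀ c ≤ Q, τ₃.real 43 c = σ.real 46 c := fun c hc => by
    rw [hf₃.real 43 (by decide)]; exact h43 c hc
  have hB₃ : ∀ y, Beats σ y ↔ Beats τ₃ y := fun y => by simp [Beats, hnat₃, hreal₃]
  have hV₃ : Valid P τ₃ := by simpa [Valid, hnat₃, hreal₃] using hV
  refine (runs_forTo_amortized (α := Unit)
    (fun i _ ρ => Valid P ρ ∧ (∀ y, Beats τ₃ y → Beats ρ y) ∧
      ∀ j < i, ∀ x, σ.real 46 j ≤ x → x ≤ σ.real 46 (j + 1) → (∃ t < S, j ∈ inc t) →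
        ∃ t < S, j ∈ inc t ∧ Beats ρ (val (σ.real 44) (σ.real 45) t x))
    (fun i _ => 100 * ∑ c ∈ Ico i Q, (stk c).length) 200 Q (a₀ := ())
    (by decide) (by decide) (by decide) (by simp [hnat₃, hQ]) ⟨hV₃, fun y hy => hy, by simp⟩
    (fun i _ τ v h => by simpa [Valid, Beats] using h) ?_).mono ?_
  · rintro i - ρ hiQ hci hf ⟨g1, g2, g3⟩
    have hnat : ∀ a, a ≠ 57 → a ≠ 59 → a ≠ 5 → a ≠ 40 → ρ.nat a = τ₃.nat a :=
      fun a _ _ _ _ => hf.nat a (by simp [Prog.natWrites, scanCell, updateProg]; tauto)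
    have hreal : ∀ a, a ≠ 47 → a ≠ 48 → a ≠ 5 → ρ.real a = τ₃.real a :=
      fun a _ _ _ => hf.real a (by simp [Prog.realWrites, scanCell, updateProg]; tauto)
    have hl := h43' i hiQ.le
    have hr := h43' (i + 1) hiQ
    refine (scanCell_spec (P := P) (n := Q) (k := k) (u := u) (v := v) (stk := stk) (D := D)
      ⟨⟨by simpa [hnat] using hh₃.stack.free_pos, by simpa [hnat, hreal] using hh₃.stack.list⟩,
      by simpa [hreal] using hh₃.hull⟩ hiQ hci (by simp [hnat, hnat₃, hk])
      (by simp [hnat, hnat₃, hu]) (by simp [hnat, hnat₃, hv])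
      (by simpa [hreal, hl, hr] using hX i hiQ) ?_ g1).mono ?_
    · intro x y hx1 hx2 hy
      simp only [hreal 43 (by norm_num) (by norm_num) (by norm_num), hl, hr] at hx1 hx2
      refine hP i hiQ x y hx1 hx2 fun t ht hjt => ?_
      simpa [hreal, hreal₃] using hy t ((hD i t).2 ⟨ht, hjt⟩)
    · rintro ρ' T hf' ⟨q1, q2, q3, q4⟩
      have hsum := sum_eq_sum_Ico_succ_bot hiQ fun c => (stk c).length
      refine ⟨(), ⟨q1, fun y hy => q2 y (g2 y hy), fun j hj x hx1 hx2 hne => ?_⟩, by omega⟩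
      rcases Nat.lt_or_ge j i with h | h
      · obtain ⟨t, h5, h6, h7⟩ := g3 j h x hx1 hx2 hne
        exact ⟨t, h5, h6, q2 _ h7⟩
      · obtain rfl : j = i := by omega
        obtain ⟨t, ht1, ht2⟩ := hne
        obtain ⟨s, hs, hb⟩ := q3 x (by simpa [hreal, hl] using hx1) (by simpa [hreal, hr] using hx2)
          ⟨t, (hD j t).2 ⟨ht1, ht2⟩⟩
        have := (hD j s).1 hs
        exact ⟨s, this.1, this.2, by simpa [hreal, hreal₃] using hb⟩
  · rintro ρ T hf ⟨-, ⟨g1, g2, g3⟩, -, hT⟩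
    refine ⟨g1, fun y hy => g2 y ((hB₃ y).1 hy),
      fun j hj x hx1 hx2 t ht hjt => g3 j hj x hx1 hx2 ⟨t, ht, hjt⟩, ?_⟩
    have e2 : (∑ c ∈ Ico 0 Q, (stk c).length) = total Q stk := by rw [total, range_eq_Ico]
    simp only [e2, Ico_self, sum_empty] at hT
    omega

end RealRAM

/-! ## Minimizing the maximum of piecewise linear functions -/

namespace RealRAM

open Hull Finset

/-- Indicator functions turn the equality of sums back into statements about `ord`: here the
indicator of the indices from `q` on, and in `exists_of_sum_eq` that of a single index. -/
theorem lt_of_sum_eq {q : ℕ} {ord : ℕ → ℕ}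
    (h : ∀ F : ℕ → ℝ, ∑ t ∈ range q, F (ord t) = ∑ t ∈ range q, F t) {t : ℕ} (ht : t < q) :
    ord t < q := by
  by_contra hq
  have h1 := h fun v => if v < q then 0 else 1
  rw [sum_eq_zero (s := range q) (f := fun t => if t < q then (0 : ℝ) else 1)
    fun s hs => if_pos (mem_range.1 hs)] at h1
  rw [sum_eq_zero_iff_of_nonneg fun s _ => by positivity] at h1
  simpa [hq] using h1 t (mem_range.2 ht)

theorem exists_of_sum_eq {q : ℕ} {ord : ℕ → ℕ}
    (h : ∀ F : ℕ → ℝ, ∑ t ∈ range q, F (ord t) = ∑ t ∈ range q, F t) {v : ℕ} (hv : v < q) :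
    ∃ t < q, ord t = v := by
  by_contra! hne
  have h1 := h fun w => if w = v then 1 else 0
  rw [sum_eq_zero (s := range q) (f := fun t => if ord t = v then (1 : ℝ) else 0)
    fun s hs => if_neg (hne s (mem_range.1 hs))] at h1
  simp at h1
  omega

/-- The function with value `a` and slope `b` at `0` whose slope changes by `c e` at `x e`, for
all `e < q` with owner `i`. -/
noncomputable def hingeSum (q : ℕ) (own : ℕ → ℕ) (x c : ℕ → ℝ) (a b : ℝ) (i : ℕ) (t : ℝ) : ℝ :=
  a + b * t + ∑ e ∈ range q, if own e = i then c e * max (t - x e) 0 else 0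

/-- The line that agrees with `hingeSum` after its first `j` breakpoints. -/
noncomputable def hingeLine (own : ℕ → ℕ) (x c : ℕ → ℝ) (ord : ℕ → ℕ) (a b : ℝ) (i j : ℕ) (t : ℝ) :
    ℝ :=
  a + b * t + ∑ e ∈ range j, if own (ord e) = i then c (ord e) * (t - x (ord e)) else 0

/-- Between consecutive sorted breakpoints exactly the hinges of the first `j` breakpoints are
active. The equality of sums is used with the hinge terms themselves as `F`. -/
theorem hingeSum_eq_hingeLine {q : ℕ} {own ord : ℕ → ℕ} {x c : ℕ → ℝ} {a b : ℝ} {i j : ℕ} {t : ℝ}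
    (h : ∀ F : ℕ → ℝ, ∑ t ∈ range q, F (ord t) = ∑ t ∈ range q, F t) (hj : j ≤ q)
    (h₁ : ∀ e < j, x (ord e) ≤ t) (h₂ : ∀ e, j ≤ e → e < q → t ≤ x (ord e)) :
    hingeSum q own x c a b i t = hingeLine own x c ord a b i j t := by
  unfold hingeSum hingeLine
  congr 1
  rw [← h fun e => if own e = i then c e * max (t - x e) 0 else 0,
    ← sum_range_add_sum_Ico _ hj]
  rw [sum_eq_zero (s := Ico j q), add_zero]
  · refine sum_congr rfl fun e he => ?_
    rw [max_eq_left (sub_nonneg.2 (h₁ e (mem_range.1 he)))]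
  · intro e he
    rw [mem_Ico] at he
    rw [max_eq_right (sub_nonpos.2 (h₂ e he.1 he.2)), mul_zero, ite_self]

/-- Sort the breakpoints, and cut the functions into segments. -/
def sweepProg : Prog :=
  sortProg 49 20 ;;
  .setReal 46 (.const 0) (.const 0) ;;
  .forTo 22 (.read 0 (.const 2)) (.setNat 63 (.var 22) (.const 0)) ;;
  .forTo 22 (.var 20)
    (.setNat 24 (.const 0) (.read 30 (.var 22)) ;;
     .setNat 25 (.const 0) (.read 62 (.var 24)) ;;
     .setReal 46 (.add (.var 22) (.const 1)) (.read 49 (.var 24)) ;;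
     .setNat 64 (.var 22) (.read 63 (.var 25)) ;;
     .setNat 65 (.var 22) (.add (.var 22) (.const 1)) ;;
     .setReal 54 (.var 22) (.read 51 (.var 25)) ;;
     .setReal 55 (.var 22) (.read 52 (.var 25)) ;;
     .setNat 63 (.var 25) (.add (.var 22) (.const 1)) ;;
     .setReal 51 (.var 25) (.sub (.read 51 (.var 25))
      (.mul (.read 50 (.var 24)) (.read 49 (.var 24)))) ;;
     .setReal 52 (.var 25) (.add (.read 52 (.var 25)) (.read 50 (.var 24)))) ;;
  .setNat 60 (.const 0) (.add (.var 20) (.const 1)) ;;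
  .setReal 46 (.var 60) (.var 53) ;;
  .setNat 21 (.const 0) (.var 20) ;;
  .forTo 22 (.read 0 (.const 2))
    (.setNat 64 (.var 21) (.read 63 (.var 22)) ;;
     .setNat 65 (.var 21) (.var 60) ;;
     .setReal 54 (.var 21) (.read 51 (.var 22)) ;;
     .setReal 55 (.var 21) (.read 52 (.var 22)) ;;
     .setNat 21 (.const 0) (.add (.var 21) (.const 1)))

/-- State of the sweep after `e` breakpoints: segments `0, …, e - 1` are closed, the last segment of
the function `i` is open since leaf `st i` and has coefficients `a i`, `b i`. -/
structure SweepState (n e : ℕ) (line : ℕ → ℕ → ℝ → ℝ) (st sl sr : ℕ → ℕ) (a b sa sb : ℕ → ℝ) :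
    Prop where
  st_le : ∀ i < n, st i ≤ e
  open_line : ∀ i < n, ∀ j, st i ≤ j → j ≤ e → ∀ t, a i + b i * t = line i j t
  range : ∀ s < e, sl s ≤ sr s ∧ sr s ≤ e
  sound : ∀ s < e, ∀ j, sl s ≤ j → j < sr s → ∃ i < n, ∀ t, sa s + sb s * t = line i j t
  cover : ∀ i < n, ∀ j < st i, ∃ s < e, (sl s ≤ j ∧ j < sr s) ∧ ∀ t, sa s + sb s * t = line i j t

/-- Breakpoint `e` separates leaf `e` from leaf `e + 1`. It closes the open segment of its owner,
which becomes segment number `e`, and opens one at leaf `e + 1`; changing the slope by `c o` and the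
constant by `-c o * x o` keeps the value at the breakpoint. -/
theorem SweepState.step {n e : ℕ} {own ord : ℕ → ℕ} {x c a₀ b₀ : ℕ → ℝ} {st sl sr : ℕ → ℕ}
    {a b sa sb : ℕ → ℝ}
    (h : SweepState n e (fun i => hingeLine own x c ord (a₀ i) (b₀ i) i) st sl sr a b sa sb)
    {o i : ℕ} (ho : ord e = o) (hi : own o = i) (hin : i < n) :
    SweepState n (e + 1) (fun i => hingeLine own x c ord (a₀ i) (b₀ i) i)
      (Function.update st i (e + 1)) (Function.update sl e (st i)) (Function.update sr e (e + 1))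
      (Function.update a i (a i - c o * x o)) (Function.update b i (b i + c o))
      (Function.update sa e (a i)) (Function.update sb e (b i)) := by
  have hline : ∀ i' t, hingeLine own x c ord (a₀ i') (b₀ i') i' (e + 1) t =
      hingeLine own x c ord (a₀ i') (b₀ i') i' e t + if i = i' then c o * (t - x o) else 0 := by
    intro i' t
    simp only [hingeLine, sum_range_succ, ho, hi]
    ring
  refine ⟨fun i' hi' => ?_, fun i' hi' j hj1 hj2 t => ?_, fun s hs => ?_, fun s hs j hj1 hj2 => ?_,
    fun i' hi' j hj => ?_⟩
  · rcases eq_or_ne i' i with rfl | hne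
    · simp
    · rw [Function.update_of_ne hne]; exact (h.st_le i' hi').trans (Nat.le_succ e)
  · rcases eq_or_ne i' i with rfl | hne
    · simp only [Function.update_self] at hj1 ⊢
      obtain rfl : j = e + 1 := by omega
      rw [hline, if_pos rfl, ← h.open_line i' hi' e (h.st_le i' hi') le_rfl]
      ring
    · rw [Function.update_of_ne hne] at hj1
      rw [Function.update_of_ne hne, Function.update_of_ne hne]
      rcases Nat.lt_or_ge j (e + 1) with h' | h'
      · exact h.open_line i' hi' j hj1 (by omega) t
      · obtain rfl : j = e + 1 := by omega
        rw [hline, if_neg hne.symm, add_zero]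
        exact h.open_line i' hi' e (h.st_le i' hi') le_rfl t
  · rcases eq_or_ne s e with rfl | hne
    · simp only [Function.update_self]
      have := h.st_le i hin
      omega
    · rw [Function.update_of_ne hne, Function.update_of_ne hne]
      have := h.range s (by omega)
      omega
  · rcases eq_or_ne s e with rfl | hne
    · simp only [Function.update_self] at hj1 hj2 ⊢
      exact ⟨i, hin, h.open_line i hin j hj1 (by omega)⟩
    · rw [Function.update_of_ne hne] at hj1 hj2
      rw [Function.update_of_ne hne, Function.update_of_ne hne]
      exact h.sound s (by omega) j hj1 hj2
  · have hold : j < st i' → ∃ s < e + 1, (Function.update sl e (st i) s ≤ j ∧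
        j < Function.update sr e (e + 1) s) ∧ ∀ t, Function.update sa e (a i) s +
        Function.update sb e (b i) s * t = hingeLine own x c ord (a₀ i') (b₀ i') i' j t := by
      intro hj'
      obtain ⟨s, hs, h1, h2⟩ := h.cover i' hi' j hj'
      refine ⟨s, by omega, ?_⟩
      rw [Function.update_of_ne hs.ne, Function.update_of_ne hs.ne, Function.update_of_ne hs.ne,
        Function.update_of_ne hs.ne]
      exact ⟨h1, h2⟩
    rcases eq_or_ne i' i with rfl | hne
    · rw [Function.update_self] at hj
      rcases Nat.lt_or_ge j (st i') with hj' | hj'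
      · exact hold hj'
      · refine ⟨e, Nat.lt_succ_self e, ?_⟩
        simp only [Function.update_self]
        exact ⟨⟨hj', hj⟩, h.open_line i' hi' j hj' (by omega)⟩
    · rw [Function.update_of_ne hne] at hj
      exact hold hj

/-- Segments `[sl, sr)` over leaves, with their lines, that make up `n` functions. -/
structure Segments (n Q S : ℕ) (G : ℕ → ℝ → ℝ) (X : ℕ → ℝ) (sl sr : ℕ → ℕ) (sa sb : ℕ → ℝ) :
    Prop where
  range : ∀ s < S, sl s ≤ sr s ∧ sr s ≤ Q
  sound : ∀ s < S, ∀ j, sl s ≤ j → j < sr s → ∃ i < n, ∀ t, X j ≤ t → t ≤ X (j + 1) →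
    sa s + sb s * t = G i t
  cover : ∀ i < n, ∀ j < Q, ∃ s < S, (sl s ≤ j ∧ j < sr s) ∧ ∀ t, X j ≤ t → t ≤ X (j + 1) →
    sa s + sb s * t = G i t

/-- Each of the `q` breakpoints closes one segment and `n` segments are still open at the end, so `q
+ n` lines suffice, although `n` functions over `q + 1` leaves have many more restrictions. -/
theorem sweepProg_spec {σ : Mem} {n q : ℕ} {L : ℝ} (hq : σ.nat 20 0 = q) (hn : σ.nat 0 2 = n)
    (hL : σ.real 53 0 = L) (hL0 : 0 ≤ L) (hown : ∀ e < q, σ.nat 62 e < n)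
    (hx : ∀ e < q, 0 ≤ σ.real 49 e ∧ σ.real 49 e ≤ L) :
    Runs sweepProg σ fun τ T => τ.nat 60 0 = q + 1 ∧ τ.nat 21 0 = q + n ∧
      τ.real 46 0 = 0 ∧ τ.real 46 (q + 1) = L ∧
      (∀ i j, i ≤ j → j ≤ q + 1 → τ.real 46 i ≤ τ.real 46 j) ∧
      Segments n (q + 1) (q + n)
        (fun i => hingeSum q (σ.nat 62) (σ.real 49) (σ.real 50) (σ.real 51 i) (σ.real 52 i) i)
        (τ.real 46) (τ.nat 64) (τ.nat 65) (τ.real 54) (τ.real 55) ∧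
      T ≤ 700 * ((q + n + 1) * (Nat.clog 2 q + 1)) := by
  rw [sweepProg, runs_seq]
  refine (sortProg_spec (by norm_num) hq).mono ?_
  rintro τ₁ T₁ hf₁ ⟨hsort, hsum, hT₁⟩
  have hnat₁ : ∀ a, a < 30 ∨ 37 < a → τ₁.nat a = σ.nat a := fun a _ =>
    hf₁.nat a (by simp [sortProg, mergePass, Prog.natWrites]; omega)
  have hreal₁ : τ₁.real = σ.real := by
    funext a; exact hf₁.real a (by simp [sortProg, mergePass, Prog.realWrites])
  set ord := τ₁.nat 30 with hord
  have hlt : ∀ {t}, t < q → ord t < q := fun ht => lt_of_sum_eq hsum ht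
  simp only [runs_seq, runs_setReal, NExp.eval, RExp.eval, NExp.cost, RExp.cost]
  refine (runs_forTo (fun i ρ => ∀ t < i, ρ.nat 63 t = 0) 20 n
    (by decide) (by decide) (by decide) (by simp [hnat₁, hn]) (by simp)
    (fun i τ v h => by simpa using h) ?_).mono ?_
  · rintro i ρ hi hc _ h1
    simp [hc]
    intro c hci
    rcases Nat.lt_or_ge c i with h | h
    · rw [Function.update_of_ne h.ne]; exact h1 c h
    · obtain rfl : c = i := by omega
      simp
  rintro τ₂ T₂ hf₂ ⟨h63, -, hT₂⟩
  have hnat₂ : ∀ a, a ≠ 63 → a ≠ 22 → a < 30 ∨ 37 < a → τ₂.nat a = σ.nat a := fun a _ _ _ => by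
    rw [hf₂.nat a (by simp [Prog.natWrites]; omega)]; simp; exact hnat₁ a ‹_›
  have hreal₂ : ∀ a, a ≠ 46 → τ₂.real a = σ.real a := fun a _ => by
    rw [hf₂.real a (by simp [Prog.realWrites])]; simp [*]
  have e30 : τ₂.nat 30 = ord := by rw [hf₂.nat 30 (by decide)]; simp [hord]
  have e46 : τ₂.real 46 0 = 0 := by rw [hf₂.real 46 (by decide)]; simp
  refine (runs_forTo (fun e ρ => SweepState n e
      (fun i => hingeLine (σ.nat 62) (σ.real 49) (σ.real 50) ord (σ.real 51 i) (σ.real 52 i) i)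
      (ρ.nat 63) (ρ.nat 64) (ρ.nat 65) (ρ.real 51) (ρ.real 52) (ρ.real 54) (ρ.real 55) ∧
      ρ.real 46 0 = 0 ∧ ∀ s < e, ρ.real 46 (s + 1) = σ.real 49 (ord s)) 120 q
    (by decide) (by decide) (by decide) (by simp [hnat₂, hq]) ⟨?_, e46, by simp⟩
    (fun i τ v h => by simpa using h) ?_).mono ?_
  · refine ⟨fun i hi => (h63 i hi).le, fun i hi j h1 h2 t => ?_, by simp, by simp, fun i hi j hj => ?_⟩
    · obtain rfl : j = 0 := by omega
      simp [hingeLine, hreal₂]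
    · rw [h63 i hi] at hj; omega
  · rintro e ρ he hc hf ⟨hI, h0, hX⟩
    have r30 : ρ.nat 30 = ord := by rw [hf.nat 30 (by decide), e30]
    have r62 : ρ.nat 62 = σ.nat 62 := by rw [hf.nat 62 (by decide), hnat₂ 62] <;> norm_num
    have s49 : ρ.real 49 = σ.real 49 := by rw [hf.real 49 (by decide), hreal₂ 49]; norm_num
    have s50 : ρ.real 50 = σ.real 50 := by rw [hf.real 50 (by decide), hreal₂ 50]; norm_num
    simp [hc, r30, r62, s49, s50]
    refine ⟨hI.step rfl rfl (hown _ (hlt he)), h0, fun s hs => ?_⟩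
    rcases Nat.lt_or_ge s e with h | h
    · rw [Function.update_of_ne (by omega)]; exact hX s h
    · obtain rfl : s = e := by omega
      simp
  rintro τ₃ T₃ hf₃ ⟨⟨hI, h0, hX⟩, -, hT₃⟩
  have e20 : τ₃.nat 20 0 = q := by rw [hf₃.nat 20 (by decide), hnat₂ 20, hq] <;> norm_num
  have e53 : τ₃.real 53 0 = L := by rw [hf₃.real 53 (by decide), hreal₂ 53, hL]; norm_num
  have e0 : τ₃.nat 0 2 = n := by rw [hf₃.nat 0 (by decide), hnat₂ 0, hn] <;> norm_num
  simp only [runs_setNat, NExp.eval, NExp.cost, e20,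
    Mem.writeNat_real, e53]
  -- The leaf boundaries are 0, the sorted breakpoints at the indices `1` to `q`, and `L`.
  set X := Function.update (τ₃.real 46) (q + 1) L with hXdef
  have hX0 : X 0 = 0 := by rw [hXdef, Function.update_of_ne (by omega), h0]
  have hXs : ∀ s < q, X (s + 1) = σ.real 49 (ord s) := fun s hs => by
    rw [hXdef, Function.update_of_ne (by omega), hX s hs]
  have hXL : X (q + 1) = L := by rw [hXdef, Function.update_self]
  have hmono : ∀ i j, i ≤ j → j ≤ q + 1 → X i ≤ X j := by
    intro i j hij hj
    rcases Nat.eq_zero_or_pos i with rfl | hi0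
    · rw [hX0]
      rcases Nat.eq_zero_or_pos j with rfl | hj0
      · rw [hX0]
      · obtain ⟨j, rfl⟩ := Nat.exists_eq_add_of_lt hj0
        rcases Nat.lt_or_ge j q with h | h
        · rw [zero_add, hXs j h]; exact (hx _ (hlt h)).1
        · obtain rfl : j = q := by omega
          rw [zero_add, hXL]; exact hL0
    · obtain ⟨i, rfl⟩ := Nat.exists_eq_add_of_lt hi0
      obtain ⟨j, rfl⟩ := Nat.exists_eq_add_of_lt (hi0.trans_le hij)
      rw [zero_add, zero_add] at *
      rcases Nat.lt_or_ge j q with h | h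
      · rw [hXs j h, hXs i (by omega)]; exact hsort i j (by omega) h
      · obtain rfl : j = q := by omega
        rcases Nat.lt_or_ge i j with h' | h'
        · rw [hXL, hXs i h']; exact (hx _ (hlt h')).2
        · obtain rfl : i = j := by omega
          exact le_rfl
  have hG : ∀ i, ∀ j ≤ q, ∀ t, X j ≤ t → t ≤ X (j + 1) →
      hingeSum q (σ.nat 62) (σ.real 49) (σ.real 50) (σ.real 51 i) (σ.real 52 i) i t =
      hingeLine (σ.nat 62) (σ.real 49) (σ.real 50) ord (σ.real 51 i) (σ.real 52 i) i j t := by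
    intro i j hj t ht1 ht2
    refine hingeSum_eq_hingeLine hsum hj (fun e he => ?_) fun e he1 he2 => ?_
    · rw [← hXs e (by omega)]; exact (hmono _ _ he (by omega)).trans ht1
    · rw [← hXs e he2]; exact ht2.trans (hmono _ _ (by omega) (by omega))
  refine (runs_forTo (fun i ρ => ρ.nat 21 0 = q + i ∧
      (∀ s < q, ρ.nat 64 s = τ₃.nat 64 s ∧ ρ.nat 65 s = τ₃.nat 65 s ∧
        ρ.real 54 s = τ₃.real 54 s ∧ ρ.real 55 s = τ₃.real 55 s) ∧
      (∀ i' < i, ρ.nat 64 (q + i') = τ₃.nat 63 i' ∧ ρ.nat 65 (q + i') = q + 1 ∧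
        ρ.real 54 (q + i') = τ₃.real 51 i' ∧ ρ.real 55 (q + i') = τ₃.real 52 i')) 100 n
    (by decide) (by decide) (by decide) (by simp [e0]) ⟨by simp [e20], by simp, by simp⟩
    (fun i τ v h => by simpa using h) ?_).mono ?_
  · rintro i ρ hi hc hf ⟨g1, g2, g3⟩
    have r60 : ρ.nat 60 0 = q + 1 := by rw [hf.nat 60 (by decide)]; simp
    have r63 : ρ.nat 63 = τ₃.nat 63 := by rw [hf.nat 63 (by decide)]; simp
    have s51 : ρ.real 51 = τ₃.real 51 := by rw [hf.real 51 (by decide)]; simp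
    have s52 : ρ.real 52 = τ₃.real 52 := by rw [hf.real 52 (by decide)]; simp
    simp [hc, g1, r60, r63, s51, s52]
    refine ⟨rfl, fun s hs => ?_, fun s hs => ?_⟩
    · rw [Function.update_of_ne (by omega), Function.update_of_ne (by omega),
        Function.update_of_ne (by omega), Function.update_of_ne (by omega)]
      exact g2 s hs
    · rcases Nat.lt_or_ge s i with h | h
      · rw [Function.update_of_ne (by omega), Function.update_of_ne (by omega),
          Function.update_of_ne (by omega), Function.update_of_ne (by omega)]
        exact g3 s h
      · obtain rfl : s = i := by omega
        simp
  rintro ρ T₄ hf₄ ⟨⟨g1, g2, g3⟩, -, hT₄⟩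
  have r46 : ρ.real 46 = X := by rw [hf₄.real 46 (by decide)]; simp [hXdef]
  rw [r46]
  refine ⟨by rw [hf₄.nat 60 (by decide)]; simp [e20], g1, hX0, hXL, hmono, ⟨fun s hs => ?_,
    fun s hs j hj1 hj2 => ?_, fun i hi j hj => ?_⟩, ?_⟩
  · rcases Nat.lt_or_ge s q with h | h
    · obtain ⟨e1, e2, -, -⟩ := g2 s h
      rw [e1, e2]
      have := hI.range s h
      omega
    · obtain ⟨i, rfl⟩ := Nat.exists_eq_add_of_le h
      obtain ⟨e1, e2, -, -⟩ := g3 i (by omega)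
      rw [e1, e2]
      have := hI.st_le i (by omega)
      omega
  · rcases Nat.lt_or_ge s q with h | h
    · obtain ⟨e1, e2, e3, e4⟩ := g2 s h
      rw [e1] at hj1
      rw [e2] at hj2
      obtain ⟨i, hi, hl⟩ := hI.sound s h j hj1 hj2
      have := hI.range s h
      refine ⟨i, hi, fun t ht1 ht2 => ?_⟩
      rw [e3, e4, hl, hG i j (by omega) t ht1 ht2]
    · obtain ⟨i, rfl⟩ := Nat.exists_eq_add_of_le h
      obtain ⟨e1, e2, e3, e4⟩ := g3 i (by omega)
      rw [e1] at hj1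
      rw [e2] at hj2
      refine ⟨i, by omega, fun t ht1 ht2 => ?_⟩
      rw [e3, e4, hG i j (by omega) t ht1 ht2]
      exact hI.open_line i (by omega) j hj1 (by omega) t
  · rcases Nat.lt_or_ge j (τ₃.nat 63 i) with h | h
    · obtain ⟨s, hs, hj', hl⟩ := hI.cover i hi j h
      obtain ⟨e1, e2, e3, e4⟩ := g2 s hs
      refine ⟨s, by omega, by rw [e1, e2]; exact hj', fun t ht1 ht2 => ?_⟩
      rw [e3, e4, hl, hG i j (by omega) t ht1 ht2]
    · obtain ⟨e1, e2, e3, e4⟩ := g3 i hi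
      refine ⟨q + i, by omega, by rw [e1, e2]; exact ⟨h, hj⟩, fun t ht1 ht2 => ?_⟩
      rw [e3, e4, hG i j (by omega) t ht1 ht2]
      exact hI.open_line i hi j h (by omega) t
  · nlinarith [Nat.zero_le (n * Nat.clog 2 q), Nat.zero_le (q * Nat.clog 2 q)]

/-- Sort the segments by slope. -/
def slopeProg : Prog :=
  sortProg 55 21 ;;
  .setNat 50 (.const 0) (.var 21) ;;
  .forTo 22 (.var 50)
    (.setNat 24 (.const 0) (.read 30 (.var 22)) ;;
     .setNat 47 (.var 22) (.read 64 (.var 24)) ;;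
     .setNat 48 (.var 22) (.read 65 (.var 24)) ;;
     .setReal 44 (.var 22) (.read 54 (.var 24)) ;;
     .setReal 45 (.var 22) (.read 55 (.var 24)))

theorem slopeProg_spec {σ : Mem} {n Q S : ℕ} {G : ℕ → ℝ → ℝ} {X : ℕ → ℝ} (hS : σ.nat 21 0 = S)
    (h : Segments n Q S G X (σ.nat 64) (σ.nat 65) (σ.real 54) (σ.real 55)) :
    Runs slopeProg σ fun τ T => τ.nat 50 0 = S ∧
      Segments n Q S G X (τ.nat 47) (τ.nat 48) (τ.real 44) (τ.real 45) ∧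
      (∀ s t, s ≤ t → t < S → τ.real 45 s ≤ τ.real 45 t) ∧
      T ≤ 500 * ((S + 1) * (Nat.clog 2 S + 1)) := by
  rw [slopeProg, runs_seq]
  refine (sortProg_spec (by norm_num) hS).mono ?_
  rintro τ₁ T₁ hf₁ ⟨hsort, hsum, hT₁⟩
  have hreal₁ : τ₁.real = σ.real := by
    funext a; exact hf₁.real a (by simp [sortProg, mergePass, Prog.realWrites])
  have e21 : τ₁.nat 21 0 = S := by rw [hf₁.nat 21 (by decide), hS]
  have e64 : τ₁.nat 64 = σ.nat 64 := hf₁.nat 64 (by decide)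
  have e65 : τ₁.nat 65 = σ.nat 65 := hf₁.nat 65 (by decide)
  simp only [runs_seq, runs_setNat, NExp.eval, NExp.cost, e21]
  refine (runs_forTo (fun i ρ => ∀ t < i, ρ.nat 47 t = σ.nat 64 (τ₁.nat 30 t) ∧
      ρ.nat 48 t = σ.nat 65 (τ₁.nat 30 t) ∧ ρ.real 44 t = σ.real 54 (τ₁.nat 30 t) ∧
      ρ.real 45 t = σ.real 55 (τ₁.nat 30 t)) 60 S
    (by decide) (by decide) (by decide) (by simp) (by simp)
    (fun i τ v h => by simpa using h) ?_).mono ?_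
  · rintro i ρ hi hc hf h1
    have r30 : ρ.nat 30 = τ₁.nat 30 := by rw [hf.nat 30 (by decide)]; simp
    have r64 : ρ.nat 64 = σ.nat 64 := by rw [hf.nat 64 (by decide)]; simp [e64]
    have r65 : ρ.nat 65 = σ.nat 65 := by rw [hf.nat 65 (by decide)]; simp [e65]
    have s54 : ρ.real 54 = σ.real 54 := by rw [hf.real 54 (by decide)]; simp [hreal₁]
    have s55 : ρ.real 55 = σ.real 55 := by rw [hf.real 55 (by decide)]; simp [hreal₁]
    simp [hc, r30, r64, r65, s54, s55]
    intro c hci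
    rcases Nat.lt_or_ge c i with h | h
    · rw [Function.update_of_ne h.ne, Function.update_of_ne h.ne, Function.update_of_ne h.ne,
        Function.update_of_ne h.ne]
      exact h1 c h
    · obtain rfl : c = i := by omega
      simp
  rintro ρ T₂ hf₂ ⟨h1, -, hT₂⟩
  refine ⟨by rw [hf₂.nat 50 (by decide)]; simp, ⟨fun t ht => ?_, fun t ht j hj1 hj2 => ?_,
    fun i hi j hj => ?_⟩, fun s t hst ht => ?_, ?_⟩
  · obtain ⟨e1, e2, -, -⟩ := h1 t ht
    rw [e1, e2]
    exact h.range _ (lt_of_sum_eq hsum ht)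
  · obtain ⟨e1, e2, e3, e4⟩ := h1 t ht
    rw [e1] at hj1
    rw [e2] at hj2
    rw [e3, e4]
    exact h.sound _ (lt_of_sum_eq hsum ht) j hj1 hj2
  · obtain ⟨s, hs, hj', hl⟩ := h.cover i hi j hj
    obtain ⟨t, ht, rfl⟩ := exists_of_sum_eq hsum hs
    obtain ⟨e1, e2, e3, e4⟩ := h1 t ht
    exact ⟨t, ht, by rw [e1, e2]; exact hj', by rw [e3, e4]; exact hl⟩
  · rw [(h1 s (by omega)).2.2.2, (h1 t ht).2.2.2]
    exact hsort s t hst ht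
  · nlinarith [Nat.zero_le (S * Nat.clog 2 S)]

/-- Minimize the maximum of the piecewise linear functions given by their values and slopes at `0`
(real arrays `51`, `52`) and their breakpoints and slope changes (real arrays `49`, `50`, owners in
array `62`) over the interval from `0` to the real in `53`. -/
def envelopeProg : Prog := sweepProg ;; slopeProg ;; distributeProg ;; leavesProg

theorem exists_leaf {X : ℕ → ℝ} {Q : ℕ} {x : ℝ} (h₀ : X 0 ≤ x) (h₁ : x ≤ X (Q + 1)) :
    ∃ j < Q + 1, X j ≤ x ∧ x ≤ X (j + 1) := by
  induction Q with
  | zero => exact ⟨0, by omega, h₀, h₁⟩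
  | succ Q ih =>
    rcases le_total x (X (Q + 1)) with h | h
    · obtain ⟨j, hj, h⟩ := ih h
      exact ⟨j, by omega, h⟩
    · exact ⟨Q + 1, by omega, h, h₁⟩

/-- On each leaf the assigned lines are restrictions of the given functions, and they dominate all
of these functions. So a bound on the assigned lines bounds every function, and the output beats the
value of some function at each point of the interval. -/
theorem envelopeProg_spec {P : ℕ → ℕ → ℝ → ℝ → Prop} {σ : Mem} {n q k u v : ℕ} {L : ℝ}
    (hq : σ.nat 20 0 = q) (hn : σ.nat 0 2 = n) (hn0 : 0 < n) (hL : σ.real 53 0 = L) (hL0 : 0 ≤ L)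
    (hown : ∀ e < q, σ.nat 62 e < n) (hx : ∀ e < q, 0 ≤ σ.real 49 e ∧ σ.real 49 e ≤ L)
    (hhalf : ∀ j ≤ q + 1, σ.nat 51 j = j / 2)
    (hk : σ.nat 11 0 = k) (hu : σ.nat 1 k = u) (hv : σ.nat 2 k = v)
    (hP : ∀ x y, 0 ≤ x → x ≤ L → (∀ i < n, hingeSum q (σ.nat 62) (σ.real 49) (σ.real 50)
      (σ.real 51 i) (σ.real 52 i) i x ≤ y) → P u v x y)
    (hV : Valid P σ) :
    Runs envelopeProg σ fun τ T => Valid P τ ∧ (∀ y, Beats σ y → Beats τ y) ∧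
      (∀ x, 0 ≤ x → x ≤ L → ∃ i < n, Beats τ (hingeSum q (σ.nat 62) (σ.real 49) (σ.real 50)
        (σ.real 51 i) (σ.real 52 i) i x)) ∧
      T ≤ 20000 * ((q + n + 1) * (Nat.clog 2 (q + n + 1) + 2)) := by
  rw [envelopeProg, runs_seq]
  refine (sweepProg_spec hq hn hL hL0 hown hx).mono ?_
  rintro τ₁ T₁ hf₁ ⟨hQ₁, hS₁, hX0, hXL, hmono, hseg₁, hT₁⟩
  rw [runs_seq]
  refine (slopeProg_spec hS₁ hseg₁).mono ?_
  rintro τ₂ T₂ hf₂ ⟨hS₂, hseg, hB, hT₂⟩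
  have e46 : τ₂.real 46 = τ₁.real 46 := hf₂.real 46 (by decide)
  have e51 : τ₂.nat 51 = σ.nat 51 := by rw [hf₂.nat 51 (by decide), hf₁.nat 51 (by decide)]
  have e60 : τ₂.nat 60 0 = q + 1 := by rw [hf₂.nat 60 (by decide), hQ₁]
  rw [runs_seq]
  refine (distributeProg_spec e60 hS₂ (by rw [e51]; exact hhalf) hseg.range
    (by rw [e46]; exact hmono) hB).mono ?_
  rintro τ₃ T₃ hf₃ ⟨inc, hi, hsound, hreach, htot, hT₃⟩
  have f44 : τ₃.real 44 = τ₂.real 44 := hf₃.real 44 (by decide)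
  have f45 : τ₃.real 45 = τ₂.real 45 := hf₃.real 45 (by decide)
  have f46 : τ₃.real 46 = τ₁.real 46 := by rw [hf₃.real 46 (by decide), e46]
  have f60 : τ₃.nat 60 0 = q + 1 := by rw [hf₃.nat 60 (by decide), e60]
  have f50 : τ₃.nat 50 0 = q + n := by rw [hf₃.nat 50 (by decide), hS₂]
  have hnat₃ : ∀ a, a = 1 ∨ a = 2 ∨ a = 5 ∨ a = 11 ∨ a = 59 → τ₃.nat a = σ.nat a := by
    rintro a (rfl | rfl | rfl | rfl | rfl) <;>
    rw [hf₃.nat _ (by decide), hf₂.nat _ (by decide), hf₁.nat _ (by decide)]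
  have hreal₃ : τ₃.real 5 = σ.real 5 := by
    rw [hf₃.real _ (by decide), hf₂.real _ (by decide), hf₁.real _ (by decide)]
  rw [e46] at hreach
  refine (leavesProg_spec (P := P) (k := k) (u := u) (v := v) hi f60 f50 (fun t ht j hj => ?_) ?_
    (by rw [f45]; exact hB) (by simp [hnat₃, hk]) (by simp [hnat₃, hu]) (by simp [hnat₃, hv]) ?_
    (by simpa [Valid, hnat₃, hreal₃] using hV)).mono ?_
  · have h1 := hsound t j hj
    have h2 := hseg.range t ht
    omega
  · intro j hj
    rw [f46]; exact hmono _ _ (Nat.le_succ j) hj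
  · intro j hj x y hx1 hx2 hy
    rw [f46] at hx1 hx2
    rw [f44, f45] at hy
    refine hP x y ?_ ?_ fun i hi' => ?_
    · rw [← hX0]; exact (hmono _ _ (Nat.zero_le j) hj.le).trans hx1
    · rw [← hXL]; exact hx2.trans (hmono _ _ hj le_rfl)
    · obtain ⟨s, hs, ⟨hj1, hj2⟩, hl⟩ := hseg.cover i hi' j hj
      obtain ⟨t, ht1, ht2, ht3⟩ := hreach s hs j hj1 hj2 x hx1 hx2
      exact (hl x hx1 hx2).ge.trans (ht3.trans (hy t ht1 ht2))
  · rintro τ₄ T₄ - ⟨g1, g2, g3, hT₄⟩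
    refine ⟨g1, fun y hy => g2 y (by simpa [Beats, hnat₃, hreal₃] using hy), fun x hx1 hx2 => ?_, ?_⟩
    · rw [← hX0] at hx1
      rw [← hXL] at hx2
      obtain ⟨j, hj, hjx1, hjx2⟩ := exists_leaf hx1 hx2
      -- Function 0 only serves to show that the leaf has some line assigned to it, so that its hull
      -- is not empty.
      obtain ⟨s, hs, ⟨hj1, hj2⟩, -⟩ := hseg.cover 0 hn0 j hj
      obtain ⟨t, ht1, ht2, -⟩ := hreach s hs j hj1 hj2 x hjx1 hjx2
      rw [f44, f45, f46] at g3
      obtain ⟨t', h1, h2, h3⟩ := g3 j hj x hjx1 hjx2 ⟨t, ht1, ht2⟩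
      have h4 := hsound t' j h2
      obtain ⟨i, hi', hl⟩ := hseg.sound t' h1 j h4.1 h4.2
      refine ⟨i, hi', ?_⟩
      exact ⟨h3.1, h3.2.trans (hl x hjx1 hjx2).le⟩
    · set c := Nat.clog 2 (q + n + 1)
      have h1 : Nat.clog 2 q ≤ c := Nat.clog_mono_right 2 (by omega)
      have h2 : Nat.clog 2 (q + n) ≤ c := Nat.clog_mono_right 2 (by omega)
      have h3 : Nat.log 2 (q + 1) ≤ c := (Nat.log_mono_right (by omega)).trans (Nat.log_le_clog 2 _)
      have i1 : (q + n + 1) * (Nat.clog 2 q + 1) ≤ (q + n + 1) * (c + 2) :=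
        Nat.mul_le_mul_left _ (by omega)
      have i2 : (q + n + 1) * (Nat.clog 2 (q + n) + 1) ≤ (q + n + 1) * (c + 2) :=
        Nat.mul_le_mul_left _ (by omega)
      have i3 : (q + n + (q + 1) + 1) * (Nat.log 2 (q + 1) + 2) ≤ (2 * (q + n + 1)) * (c + 2) :=
        Nat.mul_le_mul (by omega) (by omega)
      have i4 : (Nat.log 2 (q + 1) + 1) * (2 * (q + n) + (q + 1)) ≤ (c + 2) * (3 * (q + n + 1)) :=
        Nat.mul_le_mul (by omega) (by omega)
      have i5 : (q + n + 1) * 1 ≤ (q + n + 1) * (c + 2) := Nat.mul_le_mul_left _ (by omega)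
      have i6 : 2 * (q + n + 1) * (c + 2) = 2 * ((q + n + 1) * (c + 2)) := by ring
      have i7 : (c + 2) * (3 * (q + n + 1)) = 3 * ((q + n + 1) * (c + 2)) := by ring
      omega

end RealRAM

/-! ## Distances along an edge -/

namespace Network

variable {V : Type*} {Γ : Network V}

theorem walkLength_nonneg {u v : V} (W : Γ.graph.Walk u v) : 0 ≤ Γ.walkLength W := by
  refine List.sum_nonneg fun l hl => ?_
  obtain ⟨e, he, rfl⟩ := List.mem_map.1 hl
  exact (Γ.len_pos e (W.edges_subset_edgeSet he)).le

theorem vertexDist_le {u v : V} (W : Γ.graph.Walk u v) : Γ.vertexDist u v ≤ Γ.walkLength W :=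
  csInf_le ⟨0, by rintro l ⟨W, rfl⟩; exact walkLength_nonneg W⟩ ⟨W, rfl⟩

theorem le_vertexDist (hG : Γ.graph.Connected) {u v : V} {c : ℝ}
    (h : ∀ W : Γ.graph.Walk u v, c ≤ Γ.walkLength W) : c ≤ Γ.vertexDist u v := by
  obtain ⟨W⟩ := hG.preconnected u v
  exact le_csInf ⟨_, W, rfl⟩ (by rintro l ⟨W, rfl⟩; exact h W)

theorem vertexDist_nonneg (u v : V) : 0 ≤ Γ.vertexDist u v :=
  Real.sInf_nonneg (by rintro l ⟨W, rfl⟩; exact walkLength_nonneg W)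

theorem vertexDist_self (u : V) : Γ.vertexDist u u = 0 :=
  le_antisymm ((vertexDist_le SimpleGraph.Walk.nil).trans (by simp [walkLength]))
    (vertexDist_nonneg u u)

theorem vertexDist_le_add_len (hG : Γ.graph.Connected) (x : V) {u v : V} (h : Γ.graph.Adj u v) :
    Γ.vertexDist x v ≤ Γ.vertexDist x u + Γ.len s(u, v) := by
  rw [← sub_le_iff_le_add]
  refine le_vertexDist hG fun W => ?_
  rw [sub_le_iff_le_add]
  refine (vertexDist_le (W.concat h)).trans_eq ?_
  simp [walkLength, SimpleGraph.Walk.edges_concat]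

/-- The distance from a point of the network to a vertex. -/
noncomputable def Point.toVertex (p : Γ.Point) (x : V) : ℝ :=
  min (p.pos + Γ.vertexDist p.fst x)
    (Γ.len s(p.fst, p.snd) - p.pos + Γ.vertexDist p.snd x)

theorem Point.toVertex_nonneg (p : Γ.Point) (x : V) : 0 ≤ p.toVertex x :=
  le_min (add_nonneg p.pos_nonneg (vertexDist_nonneg _ _))
    (add_nonneg (sub_nonneg.2 p.pos_le) (vertexDist_nonneg _ _))

theorem Point.toVertex_le_add_len (hG : Γ.graph.Connected) (p : Γ.Point) {u v : V}
    (h : Γ.graph.Adj u v) : p.toVertex v ≤ p.toVertex u + Γ.len s(u, v) := by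
  have h1 := vertexDist_le_add_len hG p.fst h
  have h2 := vertexDist_le_add_len hG p.snd h
  unfold Point.toVertex
  rw [← min_add_add_right]
  exact min_le_min (by linarith) (by linarith)

theorem Point.toVertex_fst_le (p : Γ.Point) : p.toVertex p.fst ≤ p.pos :=
  (min_le_left _ _).trans_eq (by rw [vertexDist_self, add_zero])

theorem Point.toVertex_snd_le (p : Γ.Point) :
    p.toVertex p.snd ≤ Γ.len s(p.fst, p.snd) - p.pos :=
  (min_le_right _ _).trans_eq (by rw [vertexDist_self, add_zero])

theorem bddBelow_routeLengths (p q : Γ.Point) : BddBelow (routeLengths p q) := by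
  refine ⟨0, ?_⟩
  rintro l (h | ⟨x, y, a, b, W, hp, hq, rfl⟩)
  · obtain ⟨-, -, rfl⟩ | ⟨-, -, rfl⟩ := h <;> exact abs_nonneg _
  · have h1 : 0 ≤ a := by
      obtain ⟨-, rfl⟩ | ⟨-, rfl⟩ := hp
      exacts [p.pos_nonneg, sub_nonneg.2 p.pos_le]
    have h2 : 0 ≤ b := by
      obtain ⟨-, rfl⟩ | ⟨-, rfl⟩ := hq
      exacts [q.pos_nonneg, sub_nonneg.2 q.pos_le]
    have := walkLength_nonneg W
    positivity

theorem pointDist_le_ends (hG : Γ.graph.Connected) {p q : Γ.Point} {x y : V} {a b : ℝ}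
    (hp : p.ToEnd x a) (hq : q.ToEnd y b) : pointDist p q ≤ a + Γ.vertexDist x y + b := by
  have : pointDist p q - a - b ≤ Γ.vertexDist x y := le_vertexDist hG fun W => by
    have := csInf_le (bddBelow_routeLengths p q) (Or.inr ⟨x, y, a, b, W, hp, hq, rfl⟩)
    change pointDist p q ≤ _ at this
    linarith
  linarith

theorem pointDist_le_toVertex (hG : Γ.graph.Connected) (p : Γ.Point) {q : Γ.Point} {y : V} {b : ℝ}
    (hq : q.ToEnd y b) : pointDist p q ≤ p.toVertex y + b := by
  unfold Point.toVertex
  rw [← min_add_add_right]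
  exact le_min (pointDist_le_ends hG (.inl ⟨rfl, rfl⟩) hq)
    (pointDist_le_ends hG (.inr ⟨rfl, rfl⟩) hq)

theorem toVertex_le_route {p : Γ.Point} {x y : V} {a : ℝ} (hp : p.ToEnd x a)
    (W : Γ.graph.Walk x y) : p.toVertex y ≤ a + Γ.walkLength W := by
  have := vertexDist_le W
  obtain ⟨rfl, rfl⟩ | ⟨rfl, rfl⟩ := hp
  · exact (min_le_left _ _).trans (by linarith)
  · exact (min_le_right _ _).trans (by linarith)

theorem routeLengths_nonempty (hG : Γ.graph.Connected) (p q : Γ.Point) :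
    (routeLengths p q).Nonempty := by
  obtain ⟨W⟩ := hG.preconnected p.fst q.fst
  exact ⟨_, .inr ⟨_, _, _, _, W, .inl ⟨rfl, rfl⟩, .inl ⟨rfl, rfl⟩, rfl⟩⟩

/-- A route to `q` either stays on a common edge or enters the edge of `q` through one of its ends;
up to that end it is at least as long as `toVertex`. -/
theorem min_le_pointDist (hG : Γ.graph.Connected) {p q : Γ.Point} {c : ℝ}
    (hc : ∀ l, p.OnSameEdge q l → c ≤ l) (h₁ : c ≤ p.toVertex q.fst + q.pos)
    (h₂ : c ≤ p.toVertex q.snd + (Γ.len s(q.fst, q.snd) - q.pos)) : c ≤ pointDist p q := by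
  refine le_csInf (routeLengths_nonempty hG p q) ?_
  rintro l (h | ⟨x, y, a, b, W, hp, hq, rfl⟩)
  · exact hc l h
  · have := toVertex_le_route hp W
    obtain ⟨rfl, rfl⟩ | ⟨rfl, rfl⟩ := hq <;> linarith

theorem pointDist_of_not_onSameEdge (hG : Γ.graph.Connected) {p q : Γ.Point}
    (h : ∀ l, ¬ p.OnSameEdge q l) : pointDist p q =
      min (p.toVertex q.fst + q.pos) (p.toVertex q.snd + (Γ.len s(q.fst, q.snd) - q.pos)) :=
  le_antisymm (le_min (pointDist_le_toVertex hG p (.inl ⟨rfl, rfl⟩))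
      (pointDist_le_toVertex hG p (.inr ⟨rfl, rfl⟩)))
    (min_le_pointDist hG (fun l hl => absurd hl (h l)) (min_le_left _ _) (min_le_right _ _))

/-- The graph has no loops, so two points cannot share an edge in the same and in opposite
directions at once. -/
theorem Point.OnSameEdge.unique {p q : Γ.Point} {l l' : ℝ} (h : p.OnSameEdge q l)
    (h' : p.OnSameEdge q l') : l = l' := by
  have := q.adj.ne
  obtain ⟨h1, h2, rfl⟩ | ⟨h1, h2, rfl⟩ := h <;> obtain ⟨h3, h4, rfl⟩ | ⟨h3, h4, rfl⟩ := h'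
  · rfl
  · exact absurd (h1.symm.trans h3) this
  · exact absurd (h3.symm.trans h1) this
  · rfl

theorem pointDist_of_onSameEdge (hG : Γ.graph.Connected) {p q : Γ.Point} {l : ℝ}
    (h : p.OnSameEdge q l) : pointDist p q =
      min l (min (p.toVertex q.fst + q.pos)
        (p.toVertex q.snd + (Γ.len s(q.fst, q.snd) - q.pos))) :=
  le_antisymm (le_min (csInf_le (bddBelow_routeLengths p q) (.inl h))
      (le_min (pointDist_le_toVertex hG p (.inl ⟨rfl, rfl⟩))
        (pointDist_le_toVertex hG p (.inr ⟨rfl, rfl⟩))))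
    (min_le_pointDist hG (fun _ hl => (min_le_left _ _).trans_eq (h.unique hl))
      ((min_le_right _ _).trans (min_le_left _ _)) ((min_le_right _ _).trans (min_le_right _ _)))

/-- The function with value `a` and slope `1` at `0` whose slope changes by `-2`, `2`, `-2` at
`x`, `y`, `z`. -/
noncomputable def zigzag (a x y z t : ℝ) : ℝ :=
  a + t - 2 * max (t - x) 0 + 2 * max (t - y) 0 - 2 * max (t - z) 0

/-- The three slope changes at one point add up to -2, and this point is where `a + t` and `b + (L -
t)` cross. Coinciding breakpoints give every location exactly three of them, whether or not it lies
on the edge. -/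
theorem zigzag_eq_min {a b L t : ℝ} : zigzag a ((b + L - a) / 2) ((b + L - a) / 2)
    ((b + L - a) / 2) t = min (a + t) (b + (L - t)) := by
  unfold zigzag
  rcases le_total t ((b + L - a) / 2) with h | h
  · rw [max_eq_right (by linarith), min_eq_left (by linarith)]; ring
  · rw [max_eq_left (by linarith), min_eq_right (by linarith)]; ring

/-- The graph rises with `a + t`, meets the descending `s - t` at `(s - a) / 2`, vanishes at `s`,
rises with `t - s`, and meets `b + (L - t)` at `(s + b + L) / 2`. The order of these points comes
from `a ≤ s` and `b ≤ L - s`: the part of the edge itself is one route to either end. -/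
theorem zigzag_eq_min_abs {a b L s t : ℝ} (ha : a ≤ s) (hb : b ≤ L - s) (ha' : 0 ≤ a)
    (hb' : 0 ≤ b) : zigzag a ((s - a) / 2) s ((s + b + L) / 2) t =
      min |s - t| (min (a + t) (b + (L - t))) := by
  unfold zigzag
  rcases le_total t s with h | h
  · rw [max_eq_right (b := (0 : ℝ)) (a := t - s) (by linarith),
      max_eq_right (b := (0 : ℝ)) (a := t - (s + b + L) / 2) (by linarith),
      abs_of_nonneg (by linarith)]
    rcases le_total t ((s - a) / 2) with h' | h'
    · rw [max_eq_right (by linarith), min_eq_left (a := a + t) (by linarith),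
        min_eq_right (by linarith)]; ring
    · rw [max_eq_left (by linarith), min_eq_left (a := s - t)
        (le_min (by linarith) (by linarith))]; ring
  · rw [max_eq_left (b := (0 : ℝ)) (a := t - s) (by linarith),
      max_eq_left (b := (0 : ℝ)) (a := t - (s - a) / 2) (by linarith),
      abs_of_nonpos (by linarith)]
    rcases le_total t ((s + b + L) / 2) with h' | h'
    · rw [max_eq_right (by linarith), min_eq_left (a := -(s - t))
        (le_min (by linarith) (by linarith))]; ring
    · rw [max_eq_left (by linarith), min_eq_right (a := a + t) (by linarith),
        min_eq_right (by linarith)]; ring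

/-- The distance from a fixed point as a function on an edge. -/
theorem pointDist_eq_zigzag (hG : Γ.graph.Connected) {p q : Γ.Point} {u v : V} {a b L s x y z : ℝ}
    (hu : q.fst = u) (hv : q.snd = v) (hL : L = Γ.len s(u, v))
    (ha : a = p.toVertex u) (hb : b = p.toVertex v)
    (h : (p.fst = u ∧ p.snd = v ∧ s = p.pos ∧ x = (s - a) / 2 ∧ y = s ∧ z = (s + b + L) / 2) ∨
      (p.fst = v ∧ p.snd = u ∧ s = L - p.pos ∧ x = (s - a) / 2 ∧ y = s ∧ z = (s + b + L) / 2) ∨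
      (¬ (p.fst = u ∧ p.snd = v) ∧ ¬ (p.fst = v ∧ p.snd = u) ∧ x = (b + L - a) / 2 ∧ y = x ∧
        z = x)) :
    pointDist p q = zigzag a x y z q.pos := by
  subst hu hv hL ha hb
  obtain ⟨h1, h2, rfl, rfl, rfl, rfl⟩ | ⟨h1, h2, rfl, rfl, rfl, rfl⟩ | ⟨h1, h2, rfl, rfl, rfl⟩ := h
  · have ha := p.toVertex_fst_le
    have hb := p.toVertex_snd_le
    rw [h1] at ha
    rw [h1, h2] at hb
    rw [zigzag_eq_min_abs ha hb (p.toVertex_nonneg _) (p.toVertex_nonneg _)]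
    exact pointDist_of_onSameEdge hG (.inl ⟨h1, h2, rfl⟩)
  · have ha := p.toVertex_snd_le
    have hb := p.toVertex_fst_le
    rw [h1] at hb
    rw [h1, h2, Sym2.eq_swap] at ha
    rw [zigzag_eq_min_abs ha (by linarith) (p.toVertex_nonneg _) (p.toVertex_nonneg _)]
    refine pointDist_of_onSameEdge hG (.inr ⟨h1, h2, ?_⟩)
    rw [abs_sub_comm]
    congr 1
    ring_nf
  · rw [zigzag_eq_min]
    refine pointDist_of_not_onSameEdge hG ?_
    rintro l (⟨h3, h4, -⟩ | ⟨h3, h4, -⟩)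
    exacts [h1 ⟨h3, h4⟩, h2 ⟨h3, h4⟩]

/-- Off the edge this is `|a - b| ≤ L`, the triangle inequality along the edge; on the edge it is
that the distances to the ends do not exceed the parts of the edge. -/
theorem breakpoints_mem (hG : Γ.graph.Connected) {p : Γ.Point} {u v : V} {a b L s x y z : ℝ}
    (huv : Γ.graph.Adj u v) (hL : L = Γ.len s(u, v))
    (ha : a = p.toVertex u) (hb : b = p.toVertex v)
    (h : (p.fst = u ∧ p.snd = v ∧ s = p.pos ∧ x = (s - a) / 2 ∧ y = s ∧ z = (s + b + L) / 2) ∨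
      (p.fst = v ∧ p.snd = u ∧ s = L - p.pos ∧ x = (s - a) / 2 ∧ y = s ∧ z = (s + b + L) / 2) ∨
      (¬ (p.fst = u ∧ p.snd = v) ∧ ¬ (p.fst = v ∧ p.snd = u) ∧ x = (b + L - a) / 2 ∧ y = x ∧
        z = x)) :
    (0 ≤ x ∧ x ≤ L) ∧ (0 ≤ y ∧ y ≤ L) ∧ (0 ≤ z ∧ z ≤ L) := by
  have h1 := p.toVertex_le_add_len hG huv
  have h2 := p.toVertex_le_add_len hG huv.symm
  have h3 := p.toVertex_nonneg u
  have h4 := p.toVertex_nonneg v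
  have h5 := p.toVertex_fst_le
  have h6 := p.toVertex_snd_le
  have h7 := p.pos_nonneg
  have h8 := p.pos_le
  rw [Sym2.eq_swap] at h2
  subst hL ha hb
  obtain ⟨rfl, rfl, rfl, rfl, rfl, rfl⟩ | ⟨rfl, rfl, rfl, rfl, rfl, rfl⟩ | ⟨-, -, rfl, rfl, rfl⟩ := h
  · refine ⟨⟨?_, ?_⟩, ⟨?_, ?_⟩, ?_, ?_⟩ <;> linarith
  · rw [Sym2.eq_swap] at h6 h8
    refine ⟨⟨?_, ?_⟩, ⟨?_, ?_⟩, ?_, ?_⟩ <;> linarith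
  · refine ⟨⟨?_, ?_⟩, ⟨?_, ?_⟩, ?_, ?_⟩ <;> linarith

/-- The same point, given from the other end of its edge. -/
def Point.flip (q : Γ.Point) : Γ.Point where
  fst := q.snd
  snd := q.fst
  adj := q.adj.symm
  pos := Γ.len s(q.fst, q.snd) - q.pos
  pos_nonneg := sub_nonneg.2 q.pos_le
  pos_le := by rw [Sym2.eq_swap]; linarith [q.pos_nonneg]

/-- The search treats each edge in its listed direction only, while a center competes with points
given in either direction. Flipping merely exchanges the alternatives in `OnSameEdge` and in
`ToEnd`. -/
theorem pointDist_flip (p q : Γ.Point) : pointDist p q.flip = pointDist p q := by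
  have h : Γ.len s(q.snd, q.fst) = Γ.len s(q.fst, q.snd) := by rw [Sym2.eq_swap]
  unfold pointDist
  congr 1
  ext l
  simp only [routeLengths, Point.OnSameEdge, Point.ToEnd, Point.flip, Set.mem_ofPred_eq, h,
    sub_sub_cancel]
  refine or_congr or_comm ?_
  simp only [or_comm]

theorem objective_flip {n m : ℕ} (P : Fin n → Γ.UncertainPoint m) (q : Γ.Point) :
    objective P q.flip = objective P q := by
  simp only [objective, UncertainPoint.expDist, pointDist_flip]

theorem le_objective {n m : ℕ} (P : Fin n → Γ.UncertainPoint m) (x : Γ.Point) (i : Fin n) :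
    (P i).weight * (P i).expDist x ≤ objective P x :=
  le_ciSup (f := fun i => (P i).weight * (P i).expDist x) (Set.finite_range _).bddAbove i

theorem objective_le {n m : ℕ} (hn : 0 < n) {P : Fin n → Γ.UncertainPoint m} {x : Γ.Point} {y : ℝ}
    (h : ∀ i, (P i).weight * (P i).expDist x ≤ y) : objective P x ≤ y :=
  haveI : Nonempty (Fin n) := ⟨⟨0, hn⟩⟩
  ciSup_le h

end Network

/-! ## The breakpoints of the distance functions along an edge -/

namespace RealRAM

open Network Finset OneCenter

/-- `if x < y then y := x`, for real scalars. -/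
def minProg (y x : ℕ) : Prog :=
  .cond (.realLt (.var x) (.var y)) (.setReal y (.const 0) (.var x)) .skip

/-- Compute the distance from location number `14` to the vertex in `e` into the real `y`. -/
def toVertexProg (e y x : ℕ) : Prog :=
  .setReal y (.const 0) (.add (.var 61) (.read 1 (.add (.read 10 (.var 17)) (.var e)))) ;;
  .setReal x (.const 0) (.add (.sub (.var 62) (.var 61))
    (.read 1 (.add (.read 10 (.var 18)) (.var e)))) ;;
  minProg y x

/-- Breakpoints on a common edge, where the real `67` is the position of the location. -/
def peaksProg : Prog :=
  .setReal 68 (.const 0) (.div (.sub (.var 67) (.var 63)) (.const 2)) ;;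
  .setReal 69 (.const 0) (.var 67) ;;
  .setReal 70 (.const 0) (.div (.add (.add (.var 67) (.var 65)) (.var 53)) (.const 2))

/-- Compute the breakpoints (reals `68`, `69`, `70`) and the value at the first end (real `63`) of
the distance from location number `14` along edge number `11`. -/
def breaksProg : Prog :=
  .setNat 17 (.const 0) (.read 3 (.var 14)) ;;
  .setNat 18 (.const 0) (.read 4 (.var 14)) ;;
  .setNat 26 (.const 0) (.read 1 (.var 11)) ;;
  .setNat 27 (.const 0) (.read 2 (.var 11)) ;;
  .setReal 61 (.const 0) (.read 3 (.var 14)) ;;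
  .setReal 62 (.const 0) (.read 60 (.add (.read 10 (.var 17)) (.var 18))) ;;
  toVertexProg 26 63 64 ;;
  toVertexProg 27 65 66 ;;
  .cond (.and (.natEq (.var 17) (.var 26)) (.natEq (.var 18) (.var 27)))
    (.setReal 67 (.const 0) (.var 61) ;; peaksProg)
    (.cond (.and (.natEq (.var 17) (.var 27)) (.natEq (.var 18) (.var 26)))
      (.setReal 67 (.const 0) (.sub (.var 53) (.var 61)) ;; peaksProg)
      (.setReal 68 (.const 0) (.div (.sub (.add (.var 65) (.var 53)) (.var 63)) (.const 2)) ;;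
        .setReal 69 (.const 0) (.var 68) ;;
        .setReal 70 (.const 0) (.var 68)))

theorem runs_minProg {x y : ℕ} {σ : Mem} {Q : Mem → ℕ → Prop} {r : ℝ}
    (hr : min (σ.real y 0) (σ.real x 0) = r)
    (h : ∀ τ T, τ.nat = σ.nat → (∀ a, a ≠ y → τ.real a = σ.real a) →
      τ.real y 0 = r → T ≤ 20 → Q τ T) : Runs (minProg y x) σ Q := by
  refine Runs.mono (Q := fun τ T => τ.nat = σ.nat ∧ (∀ a, a ≠ y → τ.real a = σ.real a) ∧
    τ.real y 0 = r ∧ T ≤ 20) ?_ fun τ T _ h' => h τ T h'.1 h'.2.1 h'.2.2.1 h'.2.2.2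
  subst hr
  simp only [minProg, runs_cond, Test.Holds, RExp.eval, NExp.eval]
  constructor <;> intro hlt
  · simp +contextual [min_eq_right hlt.le]
  · simp [min_eq_left (not_lt.1 hlt)]

theorem runs_toVertexProg {N : ℕ} {Γ : Network (Fin N)} {p : Γ.Point} {e y x : ℕ} {w : Fin N}
    (hxy : x ≠ y) (hy : y ≠ 1 ∧ y ≠ 61 ∧ y ≠ 62) {σ : Mem}
    (hD : ∀ u v : Fin N, σ.real 1 (u * N + v) = Γ.vertexDist u v)
    (hrow : ∀ u < N, σ.nat 10 u = u * N)
    (h17 : σ.nat 17 0 = p.fst) (h18 : σ.nat 18 0 = p.snd) (he : σ.nat e 0 = w)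
    (h61 : σ.real 61 0 = p.pos) (h62 : σ.real 62 0 = Γ.len s(p.fst, p.snd)) :
    Runs (toVertexProg e y x) σ fun τ T => τ.nat = σ.nat ∧
      (∀ a, a ≠ x → a ≠ y → τ.real a = σ.real a) ∧ τ.real y 0 = p.toVertex w ∧ T ≤ 60 := by
  simp only [toVertexProg, runs_seq, runs_setReal]
  refine runs_minProg (r := p.toVertex w) ?_ ?_
  · simp [hxy.symm, hy.1.symm, hy.2.1.symm,
      hy.2.2.symm, h17, h18, he, hrow, hD, h61, h62, Point.toVertex]
  · intro τ T h1 h2 h3 h4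
    refine ⟨by rw [h1]; simp, fun a ha hb => ?_, h3, ?_⟩
    · rw [h2 a hb]; simp [ha, hb]
    · simp; omega

/-- The edge of the location is found through the length table at the address of its ends; that
entry is meaningful because the ends are adjacent. -/
theorem runs_breaksProg {N : ℕ} {Γ : Network (Fin N)} (hG : Γ.graph.Connected) {p : Γ.Point}
    {u v : Fin N} (huv : Γ.graph.Adj u v) {σ : Mem} {id k : ℕ}
    (hD : ∀ u v : Fin N, σ.real 1 (u * N + v) = Γ.vertexDist u v)
    (hrow : ∀ u < N, σ.nat 10 u = u * N)
    (hlen : ∀ u v : Fin N, Γ.graph.Adj u v → σ.real 60 (u * N + v) = Γ.len s(u, v))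
    (hid : σ.nat 14 0 = id) (hk : σ.nat 11 0 = k) (hu : σ.nat 1 k = u) (hv : σ.nat 2 k = v)
    (hfst : σ.nat 3 id = p.fst) (hsnd : σ.nat 4 id = p.snd) (hpos : σ.real 3 id = p.pos)
    (hL : σ.real 53 0 = Γ.len s(u, v)) :
    Runs breaksProg σ fun τ T =>
      (0 ≤ τ.real 68 0 ∧ τ.real 68 0 ≤ Γ.len s(u, v)) ∧
      (0 ≤ τ.real 69 0 ∧ τ.real 69 0 ≤ Γ.len s(u, v)) ∧
      (0 ≤ τ.real 70 0 ∧ τ.real 70 0 ≤ Γ.len s(u, v)) ∧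
      (∀ q : Γ.Point, q.fst = u → q.snd = v → pointDist p q =
        zigzag (τ.real 63 0) (τ.real 68 0) (τ.real 69 0) (τ.real 70 0) q.pos) ∧ T ≤ 400 := by
  have key : Runs breaksProg σ fun τ T => (∃ s b, τ.real 63 0 = p.toVertex u ∧ b = p.toVertex v ∧
      ((p.fst = u ∧ p.snd = v ∧ s = p.pos ∧ τ.real 68 0 = (s - τ.real 63 0) / 2 ∧ τ.real 69 0 = s ∧
          τ.real 70 0 = (s + b + Γ.len s(u, v)) / 2) ∨
        (p.fst = v ∧ p.snd = u ∧ s = Γ.len s(u, v) - p.pos ∧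
          τ.real 68 0 = (s - τ.real 63 0) / 2 ∧ τ.real 69 0 = s ∧
          τ.real 70 0 = (s + b + Γ.len s(u, v)) / 2) ∨
        (¬ (p.fst = u ∧ p.snd = v) ∧ ¬ (p.fst = v ∧ p.snd = u) ∧
          τ.real 68 0 = (b + Γ.len s(u, v) - τ.real 63 0) / 2 ∧ τ.real 69 0 = τ.real 68 0 ∧
          τ.real 70 0 = τ.real 68 0))) ∧ T ≤ 400 := by
    simp only [breaksProg, runs_seq, runs_setNat, runs_setReal]
    refine (runs_toVertexProg (Γ := Γ) (p := p) (w := u) (by norm_num) (by norm_num)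
      (by simpa using hD) (by simpa using hrow) (by simp [hid, hfst]) (by simp [hid, hsnd])
      (by simp [hk, hu]) (by simp [hid, hpos])
      (by simp [hid, hfst, hsnd, hrow, hlen _ _ p.adj])).mono ?_
    rintro τ₁ T₁ - ⟨hn₁, hr₁, ha, hT₁⟩
    refine (runs_toVertexProg (Γ := Γ) (p := p) (w := v) (by norm_num) (by norm_num)
      (by rw [hr₁ 1] <;> simp [hD]) (by simpa [hn₁] using hrow) (by simp [hn₁, hid, hfst])
      (by simp [hn₁, hid, hsnd]) (by simp [hn₁, hk, hv]) (by rw [hr₁ 61] <;> simp [hid, hpos])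
      (by rw [hr₁ 62] <;> simp [hid, hfst, hsnd, hrow, hlen _ _ p.adj])).mono ?_
    rintro τ₂ T₂ - ⟨hn₂, hr₂, hb, hT₂⟩
    have ha₂ : τ₂.real 63 0 = p.toVertex u := by rw [hr₂ 63 (by norm_num) (by norm_num), ha]
    have h61 : τ₂.real 61 0 = p.pos := by
      rw [hr₂ 61 (by norm_num) (by norm_num), hr₁ 61 (by norm_num) (by norm_num)]
      simp [hid, hpos]
    have h53 : τ₂.real 53 0 = Γ.len s(u, v) := by
      rw [hr₂ 53 (by norm_num) (by norm_num), hr₁ 53 (by norm_num) (by norm_num)]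
      simp [hL]
    have h17 : τ₂.nat 17 0 = p.fst := by simp [hn₂, hn₁, hid, hfst]
    have h18 : τ₂.nat 18 0 = p.snd := by simp [hn₂, hn₁, hid, hsnd]
    have h26 : τ₂.nat 26 0 = u := by simp [hn₂, hn₁, hk, hu]
    have h27 : τ₂.nat 27 0 = v := by simp [hn₂, hn₁, hk, hv]
    simp only [runs_cond, Test.Holds, NExp.eval, h17, h18, h26, h27, Fin.val_inj]
    refine ⟨fun h => ?_, fun h => ⟨fun h' => ?_, fun h' => ?_⟩⟩
    · simp only [peaksProg, runs_seq, runs_setReal]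
      refine ⟨⟨p.pos, _, by simp [ha₂], rfl, .inl ⟨h.1, h.2, rfl, ?_, ?_, ?_⟩⟩, by simp; omega⟩ <;>
      simp [ha₂, h61, hb, h53]
    · simp only [peaksProg, runs_seq, runs_setReal]
      refine ⟨⟨Γ.len s(u, v) - p.pos, _, by simp [ha₂], rfl,
        .inr (.inl ⟨h'.1, h'.2, rfl, ?_, ?_, ?_⟩)⟩, by simp; omega⟩ <;>
      simp [ha₂, h61, hb, h53]
    · simp only [runs_seq, runs_setReal]
      -- The position `s` plays no role for a location off the edge, so any witness will do.
      refine ⟨⟨0, _, by simp [ha₂], rfl, .inr (.inr ⟨h, h', ?_, ?_, ?_⟩)⟩, by simp; omega⟩ <;>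
      simp [ha₂, hb, h53]
  refine key.mono ?_
  rintro τ T - ⟨⟨s, b, ha, hb, h⟩, hT⟩
  obtain ⟨h1, h2, h3⟩ := breakpoints_mem hG huv rfl ha hb h
  exact ⟨h1, h2, h3, fun q hu hv => pointDist_eq_zigzag hG hu hv rfl ha hb h, hT⟩

end RealRAM

/-! ## Building the functions of an edge -/

namespace RealRAM

open Network Finset OneCenter

/-- Appending three hinges to the owner `o` adds a scaled zigzag to its function and leaves the
others alone; with `r` the weight times the probability, this is one term of the weighted expected
distance. -/
theorem hingeSum_add_zigzag {q o i : ℕ} {own own' : ℕ → ℕ} {x x' c c' : ℕ → ℝ}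
    {a b a' b' r α β γ δ t : ℝ}
    (h : ∀ e < q, own' e = own e ∧ x' e = x e ∧ c' e = c e)
    (h₀ : own' q = o ∧ x' q = β ∧ c' q = -2 * r)
    (h₁ : own' (q + 1) = o ∧ x' (q + 1) = γ ∧ c' (q + 1) = 2 * r)
    (h₂ : own' (q + 2) = o ∧ x' (q + 2) = δ ∧ c' (q + 2) = -2 * r)
    (ha : a' = a + if o = i then r * α else 0) (hb : b' = b + if o = i then r else 0) :
    hingeSum (q + 3) own' x' c' a' b' i t =
      hingeSum q own x c a b i t + if o = i then r * zigzag α β γ δ t else 0 := by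
  have hs : ∑ e ∈ range q, (if own' e = i then c' e * max (t - x' e) 0 else 0) =
      ∑ e ∈ range q, if own e = i then c e * max (t - x e) 0 else 0 :=
    sum_congr rfl fun e he => by
      obtain ⟨h1, h2, h3⟩ := h e (mem_range.1 he)
      rw [h1, h2, h3]
  simp only [hingeSum, sum_range_succ, hs, h₀, h₁, h₂, ha, hb, zigzag]
  split_ifs <;> ring

/-- Append the breakpoints in the reals `68`, `69`, `70`, scaled by the real `71`, to the function
of the uncertain point number `15`. -/
def eventsProg : Prog :=
  .setReal 49 (.var 23) (.var 68) ;;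
  .setReal 49 (.add (.var 23) (.const 1)) (.var 69) ;;
  .setReal 49 (.add (.var 23) (.const 2)) (.var 70) ;;
  .setReal 50 (.var 23) (.mul (.const (-2)) (.var 71)) ;;
  .setReal 50 (.add (.var 23) (.const 1)) (.mul (.const 2) (.var 71)) ;;
  .setReal 50 (.add (.var 23) (.const 2)) (.mul (.const (-2)) (.var 71)) ;;
  .setNat 62 (.var 23) (.var 15) ;;
  .setNat 62 (.add (.var 23) (.const 1)) (.var 15) ;;
  .setNat 62 (.add (.var 23) (.const 2)) (.var 15) ;;
  .setNat 23 (.const 0) (.add (.var 23) (.const 3)) ;;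
  .setReal 51 (.var 15) (.add (.read 51 (.var 15)) (.mul (.var 71) (.var 63))) ;;
  .setReal 52 (.var 15) (.add (.read 52 (.var 15)) (.var 71))

theorem runs_eventsProg {σ : Mem} {q o : ℕ} (hq : σ.nat 23 0 = q) (ho : σ.nat 15 0 = o) :
    Runs eventsProg σ fun τ T => τ.nat 23 0 = q + 3 ∧
      (∀ e < q, τ.nat 62 e = σ.nat 62 e ∧ τ.real 49 e = σ.real 49 e ∧ τ.real 50 e = σ.real 50 e) ∧
      (τ.nat 62 q = o ∧ τ.real 49 q = σ.real 68 0 ∧ τ.real 50 q = -2 * σ.real 71 0) ∧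
      (τ.nat 62 (q + 1) = o ∧ τ.real 49 (q + 1) = σ.real 69 0 ∧
        τ.real 50 (q + 1) = 2 * σ.real 71 0) ∧
      (τ.nat 62 (q + 2) = o ∧ τ.real 49 (q + 2) = σ.real 70 0 ∧
        τ.real 50 (q + 2) = -2 * σ.real 71 0) ∧
      (∀ i, τ.real 51 i = σ.real 51 i + (if o = i then σ.real 71 0 * σ.real 63 0 else 0) ∧
        τ.real 52 i = σ.real 52 i + if o = i then σ.real 71 0 else 0) ∧ T ≤ 100 := by
  simp only [eventsProg, runs_seq, runs_setReal, runs_setNat]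
  refine ⟨by simp [hq], fun e he => ?_, ?_, ?_, ?_, fun i => ?_, by simp⟩
  · have h0 : e ≠ q := by omega
    have h1 : e ≠ q + 1 := by omega
    have h2 : e ≠ q + 2 := by omega
    simp [hq, h0, h1, h2]
  · simp [hq, ho]
  · simp [hq, ho]
  · simp [hq, ho]
  · rcases eq_or_ne o i with rfl | h
    · simp [ho]
    · simp [ho, h, h.symm]

/-- Append the breakpoints of location number `14`. -/
def locationProg : Prog :=
  breaksProg ;;
  .setNat 15 (.const 0) (.read 12 (.var 14)) ;;
  .setReal 71 (.const 0) (.mul (.read 2 (.var 15)) (.read 4 (.var 14))) ;;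
  eventsProg

/-- Build the functions of all uncertain points along edge number `11`. -/
def buildProg : Prog :=
  .setReal 53 (.const 0) (.read 0 (.var 11)) ;;
  .forTo 14 (.read 0 (.const 2))
    (.setReal 51 (.var 14) (.const 0) ;; .setReal 52 (.var 14) (.const 0)) ;;
  .setNat 23 (.const 0) (.const 0) ;;
  .forTo 14 (.read 13 (.const 0)) locationProg

/-- Find the best point on edge number `11` and update the best point found so far. -/
def edgeProg : Prog := buildProg ;; envelopeProg

variable {N n m E : ℕ} {Γ : Network (Fin N)} {P : Fin n → Γ.UncertainPoint m}
  {ends : Fin E → Fin N × Fin N}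

/-- The input and the tables computed from it. -/
structure Ready (Γ : Network (Fin N)) (P : Fin n → Γ.UncertainPoint m)
    (ends : Fin E → Fin N × Fin N) (σ : Mem) : Prop where
  input : HoldsInput Γ P ends σ
  row : ∀ u < N, σ.nat 10 u = u * N
  edge : ∀ u v : Fin N, Γ.graph.Adj u v → σ.real 60 (u * N + v) = Γ.len s(u, v)
  owner : ∀ (i : Fin n) (j : Fin m), σ.nat 12 (i * m + j) = i
  count : σ.nat 13 0 = n * m
  events : σ.nat 20 0 = 3 * (n * m)
  half : ∀ j ≤ 3 * (n * m) + 1, σ.nat 51 j = j / 2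

theorem _root_.OneCenter.HoldsInput.congr {σ τ : Mem} (h : HoldsInput Γ P ends σ)
    (hn : ∀ a ≤ 4, τ.nat a = σ.nat a) (hr : ∀ a ≤ 4, τ.real a = σ.real a) :
    HoldsInput Γ P ends τ where
  num_vertices := by rw [hn 0 (by norm_num), h.num_vertices]
  num_edges := by rw [hn 0 (by norm_num), h.num_edges]
  num_points := by rw [hn 0 (by norm_num), h.num_points]
  num_locations := by rw [hn 0 (by norm_num), h.num_locations]
  edge_fst k := by rw [hn 1 (by norm_num), h.edge_fst]
  edge_snd k := by rw [hn 2 (by norm_num), h.edge_snd]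
  edge_len k := by rw [hr 0 (by norm_num), h.edge_len]
  dist_matrix u v := by rw [hr 1 (by norm_num), h.dist_matrix]
  weight i := by rw [hr 2 (by norm_num), h.weight]
  loc_fst i j := by rw [hn 3 (by norm_num), h.loc_fst]
  loc_snd i j := by rw [hn 4 (by norm_num), h.loc_snd]
  loc_pos i j := by rw [hr 3 (by norm_num), h.loc_pos]
  prob i j := by rw [hr 4 (by norm_num), h.prob]

theorem Ready.congr {σ τ : Mem} (h : Ready Γ P ends σ)
    (hn : ∀ a ∈ [0, 1, 2, 3, 4, 10, 12, 13, 20, 51], τ.nat a = σ.nat a)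
    (hr : ∀ a ∈ [0, 1, 2, 3, 4, 60], τ.real a = σ.real a) : Ready Γ P ends τ where
  input := h.input.congr (fun a ha => hn a (by interval_cases a <;> simp))
    (fun a ha => hr a (by interval_cases a <;> simp))
  row := by rw [hn 10 (by simp)]; exact h.row
  edge := by rw [hr 60 (by simp)]; exact h.edge
  owner := by rw [hn 12 (by simp)]; exact h.owner
  count := by rw [hn 13 (by simp)]; exact h.count
  events := by rw [hn 20 (by simp)]; exact h.events
  half := by rw [hn 51 (by simp)]; exact h.half

theorem natWrites_buildProg_disjoint :
    ∀ a ∈ [0, 1, 2, 3, 4, 5, 10, 11, 12, 13, 20, 51, 59], a ∉ buildProg.natWrites := by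
  decide +kernel

theorem realWrites_buildProg_disjoint : ∀ a ∈ [0, 1, 2, 3, 4, 5, 60], a ∉ buildProg.realWrites := by
  decide +kernel

theorem mul_add_inj {i i' : Fin n} {j j' : Fin m} (h : (i * m + j : ℕ) = i' * m + j') :
    i = i' ∧ j = j' := by
  have hm : 0 < m := j.pos
  have h1 := congrArg (· / m) h
  have h2 := congrArg (· % m) h
  simp only [mul_comm _ m, Nat.mul_add_div hm, Nat.div_eq_of_lt j.2, Nat.div_eq_of_lt j'.2,
    add_zero] at h1
  simp only [Nat.mul_add_mod', Nat.mod_eq_of_lt j.2, Nat.mod_eq_of_lt j'.2] at h2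
  exact ⟨Fin.ext h1, Fin.ext h2⟩

theorem sum_ite_lt_succ {i i' : Fin n} {j : Fin m} (f : Fin m → ℝ) :
    ∑ j' : Fin m, (if (i' * m + j' : ℕ) < i * m + j + 1 then f j' else 0) =
      ∑ j' : Fin m, (if (i' * m + j' : ℕ) < i * m + j then f j' else 0) +
        if i = i' then f j else 0 := by
  have h : ∀ j' : Fin m, (if (i' * m + j' : ℕ) < i * m + j + 1 then f j' else 0) =
      (if (i' * m + j' : ℕ) < i * m + j then f j' else 0) +
        if i = i' ∧ j' = j then f j' else 0 := by
    intro j'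
    have key : (i' * m + j' : ℕ) = i * m + j ↔ i = i' ∧ j' = j := by
      constructor
      · intro h
        exact (mul_add_inj h).imp Eq.symm id
      · rintro ⟨rfl, rfl⟩; rfl
    simp only [← key]
    rcases lt_trichotomy (i' * m + j' : ℕ) (i * m + j) with h | h | h
    · simp [h, h.ne, Nat.lt_succ_of_lt h]
    · simp [h]
    · simp [h.ne', h.not_gt, show ¬ (i' * m + j' : ℕ) < i * m + j + 1 by omega]
  rw [sum_congr rfl fun j' _ => h j', sum_add_distrib]
  congr 1
  by_cases hi : i = i' <;> simp [hi]

/-- State of the functions when the first `d` locations are processed. -/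
structure BuildState (P : Fin n → Γ.UncertainPoint m) (u v : Fin N) (d : ℕ) (ρ : Mem) : Prop where
  events : ρ.nat 23 0 = 3 * d
  owner : ∀ e < 3 * d, ρ.nat 62 e < n
  mem : ∀ e < 3 * d, 0 ≤ ρ.real 49 e ∧ ρ.real 49 e ≤ Γ.len s(u, v)
  value : ∀ q : Γ.Point, q.fst = u → q.snd = v → ∀ i : Fin n,
    hingeSum (3 * d) (ρ.nat 62) (ρ.real 49) (ρ.real 50) (ρ.real 51 i) (ρ.real 52 i) i q.pos =
      ∑ j : Fin m, if (i * m + j : ℕ) < d then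
        (P i).weight * ((P i).prob j * pointDist ((P i).loc j) q) else 0

theorem runs_locationProg (hG : Γ.graph.Connected) {u v : Fin N} (huv : Γ.graph.Adj u v)
    {σ : Mem} (h : Ready Γ P ends σ) {k : ℕ} (hk : σ.nat 11 0 = k)
    (hu : σ.nat 1 k = u) (hv : σ.nat 2 k = v) (hL : σ.real 53 0 = Γ.len s(u, v)) {d : ℕ}
    (hd : d < n * m) (hid : σ.nat 14 0 = d) (hI : BuildState P u v d σ) :
    Runs locationProg σ fun τ T => BuildState P u v (d + 1) τ ∧ T ≤ 550 := by
  have hm : 0 < m := Nat.pos_of_mul_pos_left (d.zero_le.trans_lt hd)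
  -- Quotient and remainder exist only in the proof; the program reads the owner from its table.
  obtain ⟨i, j, hij⟩ : ∃ (i : Fin n) (j : Fin m), d = i * m + j :=
    ⟨⟨d / m, Nat.div_lt_of_lt_mul (by rwa [mul_comm])⟩, ⟨d % m, Nat.mod_lt _ hm⟩,
      (Nat.div_add_mod' d m).symm⟩
  rw [locationProg, runs_seq]
  refine (runs_breaksProg hG huv h.input.dist_matrix h.row h.edge hid hk hu hv
    (by rw [hij]; exact h.input.loc_fst i j) (by rw [hij]; exact h.input.loc_snd i j)
    (by rw [hij]; exact h.input.loc_pos i j) hL).mono ?_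
  rintro τ₁ T₁ hf₁ ⟨hx, hy, hz, hdist, hT₁⟩
  have e12 : τ₁.nat 12 d = i := by rw [hf₁.nat 12 (by decide), hij]; exact h.owner i j
  have e14 : τ₁.nat 14 0 = d := by rw [hf₁.nat 14 (by decide), hid]
  have e2 : τ₁.real 2 i = (P i).weight := by rw [hf₁.real 2 (by decide)]; exact h.input.weight i
  have e4 : τ₁.real 4 d = (P i).prob j := by
    rw [hf₁.real 4 (by decide), hij]; exact h.input.prob i j
  have e23 : τ₁.nat 23 0 = 3 * d := by rw [hf₁.nat 23 (by decide), hI.events]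
  simp only [runs_seq, runs_setNat, runs_setReal]
  refine (runs_eventsProg (q := 3 * d) (o := i) (by simp [e23]) (by simp [e14, e12])).mono ?_
  rintro τ₂ T₂ - ⟨g1, g2, g3, g4, g5, g6, hT₂⟩
  simp [e14, e12, e2, e4, hf₁.nat 62 (by decide), hf₁.real 49 (by decide),
    hf₁.real 50 (by decide), hf₁.real 51 (by decide), hf₁.real 52 (by decide)] at g2 g3 g4 g5 g6
  refine ⟨⟨by rw [g1]; ring, fun e he => ?_, fun e he => ?_, fun q hqu hqv i' => ?_⟩, ?_⟩
  · rcases Nat.lt_or_ge e (3 * d) with h' | h'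
    · rw [(g2 e h').1]; exact hI.owner e h'
    · obtain rfl | rfl | rfl : e = 3 * d ∨ e = 3 * d + 1 ∨ e = 3 * d + 2 := by omega
      exacts [g3.1 ▸ i.2, g4.1 ▸ i.2, g5.1 ▸ i.2]
  · rcases Nat.lt_or_ge e (3 * d) with h' | h'
    · rw [(g2 e h').2.1]; exact hI.mem e h'
    · obtain rfl | rfl | rfl : e = 3 * d ∨ e = 3 * d + 1 ∨ e = 3 * d + 2 := by omega
      exacts [g3.2.1 ▸ hx, g4.2.1 ▸ hy, g5.2.1 ▸ hz]
  · rw [mul_add, mul_one, hingeSum_add_zigzag g2 (by simpa using g3) (by simpa using g4)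
      (by simpa using g5) (g6 i').1 (g6 i').2, hI.value q hqu hqv, ← hdist q hqu hqv, hij,
      sum_ite_lt_succ, mul_assoc]
    congr 1
    by_cases hii : i = i'
    · subst hii; simp
    · simp [hii, Fin.val_inj]
  · simp
    omega

theorem runs_buildProg (hG : Γ.graph.Connected) {σ : Mem} (h : Ready Γ P ends σ) {k : Fin E}
    (hadj : Γ.graph.Adj (ends k).1 (ends k).2) (hk : σ.nat 11 0 = k) :
    Runs buildProg σ fun τ T => BuildState P (ends k).1 (ends k).2 (n * m) τ ∧
      τ.real 53 0 = Γ.len s((ends k).1, (ends k).2) ∧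
      T ≤ n * 50 + n * m * 562 + 50 := by
  simp only [buildProg, runs_seq, runs_setReal]
  refine (runs_forTo (fun i ρ => ∀ i' < i, ρ.real 51 i' = 0 ∧ ρ.real 52 i' = 0) 30 n
    (by decide) (by decide) (by decide) (by simp [h.input.num_points]) (by simp)
    (fun i τ v h => by simpa using h) ?_).mono ?_
  · intro i ρ hi hc hf hI
    simp [hc]
    intro i' hi'
    rcases Nat.lt_or_ge i' i with h' | h'
    · rw [Function.update_of_ne h'.ne, Function.update_of_ne h'.ne]; exact hI i' h'
    · obtain rfl : i' = i := by omega
      simp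
  rintro τ₁ T₁ hf₁ ⟨h0, -, hT₁⟩
  rw [runs_setNat]
  have hr₁ : Ready Γ P ends (τ₁.writeNat 23 0 0) := h.congr
    (fun a ha => by
      rw [Mem.writeNat_nat_ne _ _ _ (by rintro rfl; revert ha; decide),
        hf₁.nat a (by revert a; decide)]
      simp)
    (fun a ha => by
      rw [Mem.writeNat_real, hf₁.real a (by revert a; decide),
        Mem.writeReal_real_ne _ _ _ (by rintro rfl; revert ha; decide)])
  have e53 : τ₁.real 53 0 = Γ.len s((ends k).1, (ends k).2) := by
    rw [hf₁.real 53 (by decide)]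
    simp [hk, h.input.edge_len]
  have e11 : τ₁.nat 11 0 = k := by rw [hf₁.nat 11 (by decide)]; simp [hk]
  refine (runs_forTo (fun d ρ => BuildState P (ends k).1 (ends k).2 d ρ) 550 (n * m)
    (by decide) (by decide) (by decide) (by simpa using hr₁.count) ⟨by simp, by simp, by simp, ?_⟩
    (fun d τ v h => ⟨by simpa using h.events, by simpa using h.owner, by simpa using h.mem,
      by simpa using h.value⟩) ?_).mono ?_
  · intro q _ _ i
    simp [hingeSum, h0 i i.2]
  · intro d ρ hd hc hf hI
    have hr : Ready Γ P ends ρ := hr₁.congr (fun a ha => hf.nat a (by revert a; decide))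
      (fun a ha => hf.real a (by revert a; decide))
    exact runs_locationProg hG hadj hr (k := k) (by rw [hf.nat 11 (by decide)]; simp [e11])
      (hr.input.edge_fst k) (hr.input.edge_snd k) (by rw [hf.real 53 (by decide)]; simp [e53])
      hd hc hI
  · rintro τ₂ T₂ hf₂ ⟨hI, -, hT₂⟩
    refine ⟨hI, by rw [hf₂.real 53 (by decide)]; simp [e53], ?_⟩
    simp
    omega

/-- `(u, v, t)` is a point of the network where the objective is at most `y`. -/
def Attains (P : Fin n → Γ.UncertainPoint m) (u v : ℕ) (t y : ℝ) : Prop :=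
  ∃ q : Γ.Point, q.fst = u ∧ q.snd = v ∧ q.pos = t ∧ objective P q ≤ y

/-- The functions given by the breakpoints are the weighted expected distances along the edge, so a
bound on all of them bounds the objective, and beating one of them beats the objective. -/
theorem runs_edgeProg (hG : Γ.graph.Connected) (hn : 0 < n) (hm : 0 < m) {σ : Mem}
    (h : Ready Γ P ends σ) {k : Fin E} (hadj : Γ.graph.Adj (ends k).1 (ends k).2)
    (hk : σ.nat 11 0 = k) (hV : Valid (Attains P) σ) :
    Runs edgeProg σ fun τ T => Valid (Attains P) τ ∧ (∀ y, Beats σ y → Beats τ y) ∧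
      (∀ q : Γ.Point, q.fst = (ends k).1 → q.snd = (ends k).2 → Beats τ (objective P q)) ∧
      T ≤ 200000 * (n * m * (Nat.clog 2 (n * m) + 5)) := by
  rw [edgeProg, runs_seq]
  refine (runs_buildProg hG h hadj hk).mono ?_
  rintro τ₁ T₁ hf₁ ⟨hI, hL, hT₁⟩
  have hr : Ready Γ P ends τ₁ := h.congr
    (fun a ha => hf₁.nat a (natWrites_buildProg_disjoint a (by revert a; decide)))
    (fun a ha => hf₁.real a (realWrites_buildProg_disjoint a (by revert a; decide)))
  have e11 : τ₁.nat 11 = σ.nat 11 := hf₁.nat 11 (natWrites_buildProg_disjoint _ (by decide))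
  have e5 : τ₁.nat 5 = σ.nat 5 := hf₁.nat 5 (natWrites_buildProg_disjoint _ (by decide))
  have e59 : τ₁.nat 59 = σ.nat 59 := hf₁.nat 59 (natWrites_buildProg_disjoint _ (by decide))
  have r5 : τ₁.real 5 = σ.real 5 := hf₁.real 5 (realWrites_buildProg_disjoint _ (by decide))
  have hval : ∀ q : Γ.Point, q.fst = (ends k).1 → q.snd = (ends k).2 → ∀ i : Fin n,
      hingeSum (3 * (n * m)) (τ₁.nat 62) (τ₁.real 49) (τ₁.real 50) (τ₁.real 51 i)
        (τ₁.real 52 i) i q.pos = (P i).weight * (P i).expDist q := by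
    intro q hu hv i
    rw [hI.value q hu hv i, UncertainPoint.expDist, mul_sum]
    refine sum_congr rfl fun j _ => if_pos ?_
    calc (i * m + j : ℕ) < i * m + m := by have := j.2; omega
      _ = (i + 1) * m := by ring
      _ ≤ n * m := Nat.mul_le_mul_right m i.2
  refine (envelopeProg_spec (P := Attains P) hr.events hr.input.num_points hn hL
    (Γ.len_pos _ hadj).le hI.owner hI.mem hr.half (by rw [e11, hk]) (hr.input.edge_fst k)
    (hr.input.edge_snd k) (fun x y hx0 hxL hy => ?_)
    (by simpa [Valid, e59, e5, r5] using hV)).mono ?_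
  · refine ⟨⟨_, _, hadj, x, hx0, hxL⟩, rfl, rfl, rfl, objective_le hn fun i => ?_⟩
    rw [← hval _ rfl rfl]
    exact hy i i.2
  · rintro τ₂ T₂ - ⟨g1, g2, g3, hT₂⟩
    refine ⟨g1, fun y hy => g2 y (by simpa [Beats, e59, r5] using hy), fun q hu hv => ?_, ?_⟩
    · obtain ⟨i, hi, hb⟩ := g3 q.pos q.pos_nonneg (by rw [← hu, ← hv]; exact q.pos_le)
      have := hval q hu hv ⟨i, hi⟩
      exact ⟨hb.1, hb.2.trans (this.trans_le (le_objective P q ⟨i, hi⟩))⟩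
    · have hK : n ≤ n * m := Nat.le_mul_of_pos_right n hm
      set K := n * m
      have hK1 : 1 ≤ K := hn.trans_le hK
      -- Since `1 ≤ K` and `n ≤ K`, the argument is at most `5 * K`, less than `8 * K`.
      have hc : Nat.clog 2 (3 * K + n + 1) ≤ Nat.clog 2 K + 3 := by
        refine Nat.clog_le_of_le_pow ?_
        have := Nat.le_pow_clog one_lt_two K
        rw [pow_add]
        omega
      have h1 : (3 * K + n + 1) * (Nat.clog 2 (3 * K + n + 1) + 2) ≤
          5 * K * (Nat.clog 2 K + 5) := Nat.mul_le_mul (by omega) (by omega)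
      have h2 : K * 1 ≤ K * (Nat.clog 2 K + 5) := Nat.mul_le_mul_left _ (by omega)
      rw [mul_assoc] at h1
      omega

end RealRAM

/-! ## The algorithm -/

namespace RealRAM

open Network Finset OneCenter

/-- Tabulate the multiples of the number of vertices. -/
def rowProg : Prog :=
  .setNat 17 (.const 0) (.const 0) ;;
  .forTo 14 (.read 0 (.const 0))
    (.setNat 10 (.var 14) (.var 17) ;;
      .setNat 17 (.const 0) (.add (.var 17) (.read 0 (.const 0))))

/-- Tabulate the lengths of the edges, indexed by their ends. -/
def edgeTableProg : Prog :=
  .forTo 14 (.read 0 (.const 1))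
    (.setReal 60 (.add (.read 10 (.read 1 (.var 14))) (.read 2 (.var 14))) (.read 0 (.var 14)) ;;
      .setReal 60 (.add (.read 10 (.read 2 (.var 14))) (.read 1 (.var 14))) (.read 0 (.var 14)))

/-- Tabulate the uncertain points to which the locations belong, and count the locations. -/
def ownerProg : Prog :=
  .setNat 13 (.const 0) (.const 0) ;;
  .forTo 14 (.read 0 (.const 2))
    (.forTo 15 (.read 0 (.const 3))
      (.setNat 12 (.var 13) (.var 14) ;; .setNat 13 (.const 0) (.add (.var 13) (.const 1))))

/-- Count the breakpoints of an edge and tabulate the halves of numbers. -/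
def halfProg : Prog :=
  .setNat 20 (.const 0) (.add (.add (.var 13) (.var 13)) (.var 13)) ;;
  .setNat 18 (.const 0) (.add (.var 20) (.const 2)) ;;
  .forTo 14 (.read 18 (.const 0))
    (.setNat 51 (.add (.var 14) (.var 14)) (.var 14) ;;
      .setNat 51 (.add (.add (.var 14) (.var 14)) (.const 1)) (.var 14)) ;;
  .setNat 59 (.const 0) (.const 0)

/-- Find a center. -/
def centerProg : Prog :=
  rowProg ;; edgeTableProg ;; ownerProg ;; halfProg ;; .forTo 11 (.read 0 (.const 1)) edgeProg

theorem runs_rowProg {σ : Mem} {N : ℕ} (hN : σ.nat 0 0 = N) :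
    Runs rowProg σ fun τ T => (∀ u < N, τ.nat 10 u = u * N) ∧ T ≤ N * 32 + 20 := by
  simp only [rowProg, runs_seq, runs_setNat]
  refine (runs_forTo (fun i ρ => ρ.nat 17 0 = i * N ∧ ∀ u < i, ρ.nat 10 u = u * N) 20 N
    (by decide) (by decide) (by decide) (by simp [hN]) (by simp)
    (fun i τ v h => by simpa using h) ?_).mono ?_
  · rintro i ρ hi hc hf ⟨h17, h10⟩
    have e0 : ρ.nat 0 0 = N := by rw [hf.nat 0 (by decide)]; simp [hN]
    simp [hc, h17, e0, add_mul]
    intro u hu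
    rcases Nat.lt_or_ge u i with h | h
    · rw [Function.update_of_ne h.ne]; exact h10 u h
    · obtain rfl : u = i := by omega
      simp
  · rintro τ T - ⟨⟨-, h10⟩, -, hT⟩
    exact ⟨h10, by simp; omega⟩

theorem runs_ownerProg {σ : Mem} {n m : ℕ} (hn : σ.nat 0 2 = n) (hm : σ.nat 0 3 = m) :
    Runs ownerProg σ fun τ T => τ.nat 13 0 = n * m ∧ (∀ d < n * m, τ.nat 12 d = d / m) ∧
      T ≤ n * (m * 32 + 30) + 20 := by
  simp only [ownerProg, runs_seq, runs_setNat]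
  refine (runs_forTo (fun i ρ => ρ.nat 13 0 = i * m ∧ ∀ d < i * m, ρ.nat 12 d = d / m)
    (m * 32 + 9) n (by decide) (by decide) (by decide) (by simp [hn]) (by simp)
    (fun i τ v h => by simpa using h) ?_).mono ?_
  · rintro i ρ hi hc hf ⟨h13, h12⟩
    refine (runs_forTo (fun j ρ => ρ.nat 13 0 = i * m + j ∧ ∀ d < i * m + j, ρ.nat 12 d = d / m)
      20 m (by decide) (by decide) (by decide) (by rw [hf.nat 0 (by decide)]; simp [hm])
      ⟨h13, h12⟩ (fun i τ v h => by simpa using h) ?_).mono ?_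
    · rintro j ρ' hj hc' hf' ⟨h13, h12⟩
      have e14 : ρ'.nat 14 0 = i := by rw [hf'.nat 14 (by decide), hc]
      simp [h13, e14]
      refine ⟨by ring, fun d hd => ?_⟩
      rcases Nat.lt_or_ge d (i * m + j) with h | h
      · rw [Function.update_of_ne h.ne]; exact h12 d h
      · obtain rfl : d = i * m + j := by omega
        rw [Function.update_self, mul_comm, Nat.mul_add_div (by omega), Nat.div_eq_of_lt hj,
          add_zero]
    · rintro τ T - ⟨⟨g1, g2⟩, -, hT⟩
      rw [Nat.succ_mul]
      exact ⟨⟨g1, g2⟩, by omega⟩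
  · rintro τ T - ⟨⟨g1, g2⟩, -, hT⟩
    refine ⟨g1, g2, ?_⟩
    have : n * (m * 32 + 9 + 12) ≤ n * (m * 32 + 30) := Nat.mul_le_mul_left n (by omega)
    simp
    omega

theorem runs_halfProg {σ : Mem} {K : ℕ} (hK : σ.nat 13 0 = K) :
    Runs halfProg σ fun τ T => τ.nat 20 0 = 3 * K ∧ (∀ j ≤ 3 * K + 1, τ.nat 51 j = j / 2) ∧
      τ.nat 59 0 = 0 ∧ T ≤ K * 150 + 200 := by
  simp only [halfProg, runs_seq, runs_setNat]
  refine (runs_forTo (fun i ρ => ∀ j < 2 * i, ρ.nat 51 j = j / 2) 30 (3 * K + 2)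
    (by decide) (by decide) (by decide) (by simp [hK]; ring) (by simp)
    (fun i τ v h => by simpa using h) ?_).mono ?_
  · rintro i ρ hi hc hf h
    simp [hc]
    intro j hj
    rcases Nat.lt_or_ge j (2 * i) with h' | h'
    · rw [Function.update_of_ne (by omega), Function.update_of_ne (by omega)]; exact h j h'
    · obtain rfl | rfl : j = i + i ∨ j = i + i + 1 := by omega
      · rw [Function.update_of_ne (by omega), Function.update_self]; omega
      · rw [Function.update_self]; omega
  · rintro τ T hf ⟨h, -, hT⟩
    have e20 : τ.nat 20 0 = 3 * K := by rw [hf.nat 20 (by decide)]; simp [hK]; ring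
    refine ⟨by simpa using e20, fun j hj => ?_, by simp, ?_⟩
    · rw [Mem.writeNat_nat_ne _ _ _ (by norm_num)]; exact h j (by omega)
    · simp
      omega

variable {N n m E : ℕ} {Γ : Network (Fin N)} {P : Fin n → Γ.UncertainPoint m}
  {ends : Fin E → Fin N × Fin N}

/-- Only the cells of the listed edges are written, in both directions, which takes time `O(|E|)`;
the other cells of the table keep arbitrary contents and are not used. -/
theorem runs_edgeTableProg {σ : Mem} (h : HoldsInput Γ P ends σ) (hE : Γ.ListsEdges ends)
    (hrow : ∀ u < N, σ.nat 10 u = u * N) :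
    Runs edgeTableProg σ fun τ T =>
      (∀ u v : Fin N, Γ.graph.Adj u v → τ.real 60 (u * N + v) = Γ.len s(u, v)) ∧
      T ≤ E * 52 + 20 := by
  refine (runs_forTo (fun i ρ => ∀ (u v : Fin N) (k : Fin E), k < i →
      s((ends k).1, (ends k).2) = s(u, v) → ρ.real 60 (u * N + v) = Γ.len s(u, v)) 40 E
    (by decide) (by decide) (by decide) h.num_edges (by simp)
    (fun i τ v h => by simpa using h) ?_).mono ?_
  · rintro i ρ hi hc hf hI
    obtain ⟨k, rfl⟩ : ∃ k : Fin E, i = k := ⟨⟨i, hi⟩, rfl⟩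
    have e1 : ρ.nat 1 k = (ends k).1 := by rw [hf.nat 1 (by decide)]; exact h.edge_fst k
    have e2 : ρ.nat 2 k = (ends k).2 := by rw [hf.nat 2 (by decide)]; exact h.edge_snd k
    have e0 : ρ.real 0 k = Γ.len s((ends k).1, (ends k).2) := by
      rw [hf.real 0 (by decide)]; exact h.edge_len k
    have e10 : ∀ u : Fin N, ρ.nat 10 u = u * N := fun u => by
      rw [hf.nat 10 (by decide)]; exact hrow u u.2
    simp [-Sym2.eq, hc, e1, e2, e0, e10]
    intro u v k' hk' hs
    by_cases h2 : (u * N + v : ℕ) = (ends k).2 * N + (ends k).1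
    · obtain ⟨rfl, rfl⟩ := mul_add_inj h2
      rw [Function.update_self, Sym2.eq_swap]
    rw [Function.update_of_ne h2]
    by_cases h1 : (u * N + v : ℕ) = (ends k).1 * N + (ends k).2
    · obtain ⟨rfl, rfl⟩ := mul_add_inj h1
      rw [Function.update_self]
    rw [Function.update_of_ne h1]
    -- Neither write of this iteration hits the cell, so edge `k'` is an earlier one.
    refine hI u v k' (lt_of_le_of_ne (by omega) fun hkk => ?_) hs
    obtain rfl : k' = k := Fin.ext hkk
    rcases Sym2.eq_iff.1 hs with ⟨rfl, rfl⟩ | ⟨rfl, rfl⟩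
    exacts [h1 rfl, h2 rfl]
  · rintro τ T - ⟨hI, -, hT⟩
    refine ⟨fun u v huv => ?_, by omega⟩
    obtain ⟨k, hk⟩ : s(u, v) ∈ Set.range fun k => s((ends k).1, (ends k).2) := by
      rw [hE.2]; exact huv
    exact hI u v k k.2 hk

theorem edgeProg_disjoint :
    (∀ a ∈ [0, 1, 2, 3, 4, 10, 11, 12, 13, 20, 51], a ∉ edgeProg.natWrites) ∧
    ∀ a ∈ [0, 1, 2, 3, 4, 60], a ∉ edgeProg.realWrites := by
  decide +kernel

theorem _root_.Network.ListsEdges.adj (hE : Γ.ListsEdges ends) (k : Fin E) :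
    Γ.graph.Adj (ends k).1 (ends k).2 := by
  rw [← SimpleGraph.mem_edgeSet, ← hE.2]
  exact ⟨k, rfl⟩

theorem _root_.Network.ListsEdges.card_le (hE : Γ.ListsEdges ends) (hG : Γ.graph.Connected) : N ≤ E + 1 := by
  have := hG.card_vert_le_card_edgeSet_add_one
  rw [← hE.2, Nat.card_range_of_injective hE.1] at this
  simpa using this

/-- The flag in cell `59` is cleared first, so the initial output is vacuously valid despite
arbitrary memory contents; each edge then preserves everything beaten before. -/
theorem runs_centerProg (hG : Γ.graph.Connected) (hn : 0 < n) (hm : 0 < m)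
    (hE : Γ.ListsEdges ends) {σ : Mem} (h : HoldsInput Γ P ends σ) :
    Runs centerProg σ fun τ T => Valid (Attains P) τ ∧
      (∀ k, ∀ q : Γ.Point, q.fst = (ends k).1 → q.snd = (ends k).2 → Beats τ (objective P q)) ∧
      T ≤ (N + E + n + 1) * 300 + n * m * 200 +
        E * (200000 * (n * m * (Nat.clog 2 (n * m) + 5)) + 12) := by
  rw [centerProg, runs_seq]
  refine (runs_rowProg h.num_vertices).mono ?_
  rintro τ₁ T₁ hf₁ ⟨hrow, hT₁⟩
  have h₁ : HoldsInput Γ P ends τ₁ := h.congr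
    (fun a ha => hf₁.nat a (by interval_cases a <;> decide))
    (fun a ha => hf₁.real a (by interval_cases a <;> decide))
  rw [runs_seq]
  refine (runs_edgeTableProg h₁ hE hrow).mono ?_
  rintro τ₂ T₂ hf₂ ⟨hedge, hT₂⟩
  have h₂ : HoldsInput Γ P ends τ₂ := h₁.congr
    (fun a ha => hf₂.nat a (by interval_cases a <;> decide))
    (fun a ha => hf₂.real a (by interval_cases a <;> decide))
  rw [runs_seq]
  refine (runs_ownerProg h₂.num_points h₂.num_locations).mono ?_
  rintro τ₃ T₃ hf₃ ⟨hK, howner, hT₃⟩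
  rw [runs_seq]
  refine (runs_halfProg hK).mono ?_
  rintro τ₄ T₄ hf₄ ⟨h20, hhalf, h59, hT₄⟩
  have hr : Ready Γ P ends τ₄ :=
    { input := (h₂.congr (fun a ha => hf₃.nat a (by interval_cases a <;> decide))
        (fun a ha => hf₃.real a (by interval_cases a <;> decide))).congr
        (fun a ha => hf₄.nat a (by interval_cases a <;> decide))
        (fun a ha => hf₄.real a (by interval_cases a <;> decide))
      row := by
        rw [hf₄.nat 10 (by decide), hf₃.nat 10 (by decide), hf₂.nat 10 (by decide)]; exact hrow
      edge := by rw [hf₄.real 60 (by decide), hf₃.real 60 (by decide)]; exact hedge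
      owner := fun i j => by
        have : (i * m + j : ℕ) < n * m :=
          calc (i * m + j : ℕ) < i * m + m := by have := j.2; omega
            _ = (i + 1) * m := by ring
            _ ≤ n * m := Nat.mul_le_mul_right m i.2
        rw [hf₄.nat 12 (by decide), howner _ this, mul_comm, Nat.mul_add_div hm,
          Nat.div_eq_of_lt j.2, add_zero]
      count := by rw [hf₄.nat 13 (by decide), hK]
      events := h20
      half := hhalf }
  obtain ⟨hdn, hdr⟩ := edgeProg_disjoint
  refine (runs_forTo (fun i ρ => Valid (Attains P) ρ ∧ ∀ k : Fin E, k < i → ∀ q : Γ.Point,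
      q.fst = (ends k).1 → q.snd = (ends k).2 → Beats ρ (objective P q))
    (200000 * (n * m * (Nat.clog 2 (n * m) + 5))) E (hdn _ (by decide)) (hdn _ (by decide))
    (by decide) hr.input.num_edges ⟨by simp [Valid, h59], by simp⟩
    (fun i τ v h => by simpa [Valid, Beats] using h) ?_).mono ?_
  · rintro i ρ hi hc hf ⟨hV, hB⟩
    have hρ : Ready Γ P ends ρ := hr.congr
      (fun a ha => hf.nat a (by
        have h1 := hdn a (by revert a; decide)
        have h2 : a ≠ 11 := by rintro rfl; revert ha; decide
        simp [h1, h2]))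
      (fun a ha => hf.real a (by simpa using hdr a ha))
    refine (runs_edgeProg hG hn hm hρ (hE.adj ⟨i, hi⟩) hc hV).mono ?_
    rintro τ T - ⟨g1, g2, g3, hT⟩
    refine ⟨⟨g1, fun k hk q hu hv => ?_⟩, hT⟩
    rcases Nat.lt_or_ge k i with h' | h'
    · exact g2 _ (hB k h' q hu hv)
    · obtain rfl : k = ⟨i, hi⟩ := Fin.ext (by simp; omega)
      exact g3 q hu hv
  · rintro τ T - ⟨⟨hV, hB⟩, -, hT⟩
    refine ⟨hV, fun k => hB k k.2, ?_⟩
    have : n * (m * 32 + 30) = 32 * (n * m) + 30 * n := by ring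
    omega

/-- Both `E` and `m * n` are at least 1, so `E * K` absorbs all linear terms; for `N` this needs the
bound from connectedness. Using `K + 1` in the logarithm keeps it at least `log 2`, so additive
constants are absorbed too. -/
theorem time_bound {N E n m T : ℕ} (hN : N ≤ E + 1) (hE : 0 < E) (hn : 0 < n) (hm : 0 < m)
    (hT : T ≤ (N + E + n + 1) * 300 + n * m * 200 +
      E * (200000 * (n * m * (Nat.clog 2 (n * m) + 5)) + 12)) :
    (T : ℝ) ≤ 2000000 / Real.log 2 * (E * ((m : ℝ) * n) * Real.log ((m : ℝ) * n + 1)) := by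
  have hnK : n ≤ n * m := Nat.le_mul_of_pos_right n hm
  have hmn : (m : ℝ) * n = (n * m : ℕ) := by push_cast; ring
  rw [hmn]
  set K := n * m
  have hK : 1 ≤ K := hn.trans_le hnK
  set c := Nat.clog 2 K
  have h1 : E * 1 ≤ E * K := Nat.mul_le_mul_left E hK
  have h2 : 1 * K ≤ E * K := Nat.mul_le_mul_right K hE
  have h3 : E * K * 5 ≤ E * K * (c + 5) := Nat.mul_le_mul_left _ (by omega)
  have h4 : E * (200000 * (K * (c + 5)) + 12) = 200000 * (E * K * (c + 5)) + 12 * E := by ring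
  have hT' : T ≤ 201000 * (E * K * (c + 5)) := by omega
  have hlog : 0 < Real.log 2 := Real.log_pos one_lt_two
  have hK' : (1 : ℝ) ≤ K := by exact_mod_cast hK
  have hl1 : Real.log 2 ≤ Real.log (K + 1) := Real.log_le_log (by norm_num) (by linarith)
  have hc : (c : ℝ) * Real.log 2 ≤ Real.log (K + 1) + Real.log 2 := by
    rcases Nat.eq_zero_or_pos c with h0 | h0
    · rw [h0]; push_cast; linarith
    · have : 2 ^ (c - 1) < K := by
        rw [← Nat.lt_clog_iff_pow_lt one_lt_two]
        omega
      have h5 : (2 : ℝ) ^ (c - 1) ≤ K + 1 := by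
        have : ((2 ^ (c - 1) : ℕ) : ℝ) ≤ K := by exact_mod_cast this.le
        push_cast at this
        linarith
      have h6 := Real.log_le_log (by positivity) h5
      rw [Real.log_pow, Nat.cast_sub h0] at h6
      push_cast at h6
      linarith
  calc (T : ℝ) ≤ 201000 * (E * K * (c + 5)) := by exact_mod_cast hT'
    _ = 201000 / Real.log 2 * (E * K * (c * Real.log 2 + 5 * Real.log 2)) := by field_simp
    -- The ceiling contributes `log (K + 1) + log 2` and the constant `5 * log 2`; each `log 2` is
    -- at most `log (K + 1)`, which makes seven.
    _ ≤ 201000 / Real.log 2 * (E * K * (7 * Real.log (K + 1))) := by gcongr; linarith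
    _ = 1407000 / Real.log 2 * (E * K * Real.log (K + 1)) := by ring
    _ ≤ 2000000 / Real.log 2 * (E * K * Real.log (K + 1)) := by
      have : 0 ≤ Real.log (K + 1 : ℝ) := hlog.le.trans hl1
      gcongr
      norm_num

end RealRAM

theorem theorem2 :
    ∃ (prog : RealRAM.Prog) (C : ℝ),
      ∀ (N E n m : ℕ) (Γ : Network (Fin N)) (P : Fin n → Γ.UncertainPoint m)
        (ends : Fin E → Fin N × Fin N) (σ : RealRAM.Mem),
        Γ.graph.Connected → 0 < n → Γ.ListsEdges ends → OneCenter.HoldsInput Γ P ends σ →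
        ∃ (τ : RealRAM.Mem) (T : ℕ) (x : Γ.Point),
          RealRAM.Exec prog σ τ T ∧
          (T : ℝ) ≤ C * ((E : ℝ) * ((m : ℝ) * n) * Real.log ((m : ℝ) * n + 1)) ∧
          Network.IsCenter P x ∧
          OneCenter.HoldsOutput x (Network.objective P x) τ := by
  refine ⟨RealRAM.centerProg, 2000000 / Real.log 2,
    fun N E n m Γ P ends σ hG hn hE hin => ?_⟩
  have hm : 0 < m := by
    rcases Nat.eq_zero_or_pos m with rfl | h
    -- With no locations the probabilities would sum to 0 and not to 1.
    · simpa using (P ⟨0, hn⟩).prob_sum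
    · exact h
  obtain ⟨τ, T, hex, hV, hB, hT⟩ := RealRAM.runs_centerProg hG hn hm hE hin
  have hall : ∀ q : Γ.Point, RealRAM.Beats τ (Network.objective P q) := by
    intro q
    obtain ⟨k, hk⟩ : s(q.fst, q.snd) ∈ Set.range fun k => s((ends k).1, (ends k).2) := by
      rw [hE.2]; exact q.adj
    rcases Sym2.eq_iff.1 hk with ⟨h1, h2⟩ | ⟨h1, h2⟩
    · exact hB k q h1.symm h2.symm
    · rw [← Network.objective_flip]
      exact hB k q.flip h1.symm h2.symm
  -- Some point is needed to know that there is an edge and that the output has been written.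
  have q₀ : Γ.Point := (P ⟨0, hn⟩).loc ⟨0, hm⟩
  have hE0 : 0 < E := by
    obtain ⟨k, -⟩ : s(q₀.fst, q₀.snd) ∈ Set.range fun k => s((ends k).1, (ends k).2) := by
      rw [hE.2]; exact q₀.adj
    exact k.pos
  obtain ⟨x, hfst, hsnd, hpos, hx⟩ := hV (hall q₀).1
  -- The stored value lies between the objective at `x` and the objective at every point, which
  -- gives both minimality and, at `x` itself, equality.
  exact ⟨τ, T, x, hex, RealRAM.time_bound (hE.card_le hG) hE0 hn hm hT,
    fun y => hx.trans (hall y).2, hfst.symm, hsnd.symm, hpos.symm, le_antisymm (hall x).2 hx⟩
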